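/- Let $p$ be a prime, let $q=p^e$ be a power of $p$, and let $V$ be a Noetherian irreducible regular scheme of characteristic $p$ which is $F$-finite, i.e. $\mathcal{O}_V$ is a finite module over its subsheaf $\mathcal{O}_V^p$ of $p$-th powers. All ideals of the structure sheaf are quasi-coherent. For a ring $R$, let $\mathrm{Diff}_R^i$ be the module of additive maps $D:R\to R$ that are absolute differential operators of order at most $i$, i.e. whose left $R$-linear extension $R\otimes_{\mathbb{Z}}R\to R$, $r_1\otimes r_2\mapsto r_1D(r_2)$, vanishes on $T^{i+1}$, where $T$ is the ideal generated by all $1\otimes r-r\otimes 1$. For an ideal $I\subseteq R$ let $\mathrm{Diff}_R^i(I)$ be the ideal generated by all $D(f)$ with $D\in \mathrm{Diff}_R^i$ and $f\in I$; for an ideal $\mathcal{I}$ of the structure sheaf of a scheme $X$, let $\mathrm{Diff}_X^i(\mathcal{I})$ be the ideal with stalks $\mathrm{Diff}_{\mathcal{O}_{X,x}}^i(\mathcal{I}_x)$. A collection $\mathcal{G}=(\mathcal{I}_1,\dots,\mathcal{I}_{q-1})$ of $\mathcal{O}_X$-ideals is called $q$-differential if $\mathrm{Diff}_X^j(\mathcal{I}_i)\subseteq\mathcal{I}_{i+j}$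 for all $i\ge 1$, $j\ge 0$ with $i+j<q$. For any collection $\mathcal{G}$ of $q-1$ ideals and any $x\in X$ put $$\eta_x(\mathcal{G})=\min\{\nu_x(\mathcal{I}_i)+i : 1\le i\le q-1\}\in\mathbb{N}\cup\{\infty\},$$ where $\nu_x(\mathcal{I})=\sup\{n:\mathcal{I}_x\subseteq\mathfrak{m}_x^n\}$ is the order of $\mathcal{I}$ at $x$. **Theorem.** Let $\mathcal{G}=(\mathcal{I}_1,\dots,\mathcal{I}_{q-1})$ be a $q$-differential collection of ideals on $V$. Let $Z\subset V$ be a regular closed subscheme, and suppose that there are integers $a,b\ge 0$ with $b<q$ such that $\eta_x(\mathcal{G})=aq+b$ for all $x\in Z$. Let $\pi:V_1\to V$ be the blowup of $V$ along $Z$, let $\mathcal{L}=\mathcal{I}(Z)\mathcal{O}_{V_1}$ be the exceptional ideal, and let $$\mathcal{G}_1^{(a)}=\bigl((\mathcal{I}_1\mathcal{O}_{V_1}:\mathcal{L}^{qa}),\dots,(\mathcal{I}_{q-1}\mathcal{O}_{V_1}:\mathcal{L}^{qa})\bigr).$$ Then $\mathcal{G}_1^{(a)}$ is again $q$-differential,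 and $$\eta_{\pi(x_1)}(\mathcal{G})\ \ge\ \eta_{x_1}(\mathcal{G}_1^{(a)})\qquad\text{for every } x_1\in V_1 .$$ -/

import Mathlib

open AlgebraicGeometry CategoryTheory
open scoped TensorProduct

universe u

noncomputable section

namespace QDiff

section Rings

variable {k R : Type*} [CommRing k] [CommRing R] [Algebra k R]

/-- The `R`-linear extension `φ_D : R ⊗ R → R`, `r₁ ⊗ r₂ ↦ r₁ * D r₂`, of a `k`-linear
map `D : R → R`. -/
def leftExtension (D : R →ₗ[k] R) : R ⊗[k] R →ₗ[k] R :=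
  LinearMap.mul' k R ∘ₗ TensorProduct.map LinearMap.id D

/-- `D` is a differential operator of `R` over `k` of order at most `i`: its left linear
extension kills `T ^ (i + 1)`, where `T ⊆ R ⊗ R` is the ideal generated by the elements
`1 ⊗ r - r ⊗ 1` (the kernel of the multiplication map). The absolute differential operators
are those over `k = ℤ`. -/
def IsDiffOp (i : ℕ) (D : R →ₗ[k] R) : Prop :=
  ∀ t ∈ KaehlerDifferential.ideal k R ^ (i + 1), leftExtension D t = 0

variable (k) in
/-- The ideal `Diff^i(I)` of `R` generated by all `D f`, with `D` a differential operator of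
order at most `i` over `k` and `f ∈ I`. -/
def diffIdeal (i : ℕ) (I : Ideal R) : Ideal R :=
  Ideal.span {g | ∃ D : R →ₗ[k] R, IsDiffOp i D ∧ ∃ f ∈ I, D f = g}

/-- `R`, a ring of characteristic `p`, is `F`-finite: finitely many elements generate `R` as a
module over its subring `R ^ p` of `p`-th powers. -/
def IsFFiniteRing (p : ℕ) (R : Type*) [CommRing R] : Prop :=
  ∃ s : Finset R, ∀ f : R, ∃ c : R → R, f = ∑ g ∈ s, c g ^ p * g

end Rings

section Schemes

/-- A scheme is regular if it is locally Noetherian and all its local rings are regular. -/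
structure IsRegularScheme (X : Scheme.{u}) : Prop where
  isLocallyNoetherian : IsLocallyNoetherian X
  isRegularLocalRing : ∀ x : X, IsRegularLocalRing (X.presheaf.stalk x)

/-- A scheme of characteristic `p` is `F`-finite if `𝒪_X` is a finite `𝒪_X ^ p`-module. -/
def IsFFinite (p : ℕ) (X : Scheme.{u}) : Prop :=
  ∀ U : X.affineOpens, IsFFiniteRing p Γ(X, U)

variable {X : Scheme.{u}}

/-- The stalk `I_x ⊆ 𝒪_{X, x}` of a quasi-coherent sheaf of ideals. -/
def stalkIdeal (I : X.IdealSheafData) (x : X) : Ideal (X.presheaf.stalk x) :=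
  ⨆ (U : X.affineOpens) (hx : x ∈ U.1), (I.ideal U).map (X.presheaf.germ U.1 x hx).hom

/-- The order `ν_x(I)` of a sheaf of ideals at `x`: the supremum of all `n` such that
`I_x ⊆ 𝔪_x ^ n` (it is `∞` if `I_x` lies in every power of `𝔪_x`). -/
def order (I : X.IdealSheafData) (x : X) : ℕ∞ :=
  ⨆ (n : ℕ) (_ : stalkIdeal I x ≤ IsLocalRing.maximalIdeal (X.presheaf.stalk x) ^ n), (n : ℕ∞)

/-- The conductor `(I : J)`: the largest quasi-coherent sheaf of ideals `K` with `J K ⊆ I`. -/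
def colon (I J : X.IdealSheafData) : X.IdealSheafData :=
  sSup {K | J * K ≤ I}

/-- A sheaf of ideals is invertible if locally it is generated by one non-zero-divisor. -/
def IsInvertible (J : X.IdealSheafData) : Prop :=
  ∀ x : X, ∃ U : X.affineOpens, x ∈ U.1 ∧
    ∃ f ∈ nonZeroDivisors Γ(X, U), J.ideal U = Ideal.span {f}

/-- `π : X₁ ⟶ X` is the blowup of `X` along the closed subscheme with ideal sheaf `Z`:
`Z 𝒪_{X₁}` is invertible, and `π` is universal with this property. -/
structure IsBlowup {X₁ : Scheme.{u}} (π : X₁ ⟶ X) (Z : X.IdealSheafData) : Prop where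
  isInvertible : IsInvertible (Z.comap π)
  existsUnique_lift : ∀ (T : Scheme.{u}) (f : T ⟶ X), IsInvertible (Z.comap f) →
    ∃! g : T ⟶ X₁, g ≫ π = f

/-- A collection `G = (I_1, …, I_{q-1})` of sheaves of ideals is `q`-differential if
`Diff^j(I_i) ⊆ I_{i+j}` whenever `i + j < q`. The sheaf `Diff^j(I)` of absolute
differential operators applied to `I` is the one with stalks `Diff^j(I_x)`, and the inclusion is expressed on the stalks. -/
def IsQDifferential {q : ℕ} (G : Set.Ico 1 q → X.IdealSheafData) : Prop :=
  ∀ (i k : Set.Ico 1 q) (j : ℕ), (i : ℕ) + j = k →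
    ∀ x : X, diffIdeal ℤ j (stalkIdeal (G i) x) ≤ stalkIdeal (G k) x

/-- `η_x(G) = min {ν_x(I_i) + i : 1 ≤ i ≤ q - 1}`. -/
def eta {q : ℕ} (G : Set.Ico 1 q → X.IdealSheafData) (x : X) : ℕ∞ :=
  ⨅ i : Set.Ico 1 q, (order (G i) x + ((i : ℕ) : ℕ∞))

/-- The `a`-transform `((I_i 𝒪_{X₁} : L ^ (q a)))_i` of the collection `G` under the blowup
`π : X₁ ⟶ X` along `Z`, where `L = Z 𝒪_{X₁}` is the exceptional ideal. -/
def aTransform {X₁ : Scheme.{u}} (π : X₁ ⟶ X) (Z : X.IdealSheafData) (a : ℕ) {q : ℕ}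
    (G : Set.Ico 1 q → X.IdealSheafData) : Set.Ico 1 q → X₁.IdealSheafData :=
  fun i => colon ((G i).comap π) (Z.comap π ^ (q * a))

end Schemes

end QDiff

end

/-!
# Transforms of `q`-differential collections of ideals under blowing up

Everything happens in local rings. Let `R` be the local ring of `V` at the image of `x₁`, a regular
local `F`-finite ring of characteristic `p`, and let `R₁` be the local ring of the blowup at `x₁`.
Kunz's theorem holds for `R` in the strong form that a regular system of parameters extends to a
finite `p`-basis (`exists_isFrobBasis`), and a `p`-basis carries Hasse derivatives, for multi-indices
with entries less than `q`, which are differential operators of order the degree of the multi-index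
(`IsFrobBasis.isDiffOp_hasse`) and satisfy Taylor's formula for all maps that are linear over `q`-th
powers (`IsFrobBasis.apply_eq_sum_hasse`).

*The transform is `q`-differential.* A differential operator `D` of order `j < q` on `R₁` is linear over
`q`-th powers (`IsDiffOp.map_pow_mul`). Hence division by the power `t ^ (q a)` of an equation of the
exceptional divisor commutes with `D`, and it suffices that `D` maps `I R₁` into `Diff ^ j (I) R₁` for
ideals `I` of `R`. By Taylor's formula, `f ↦ D (g f)` is on `R` a combination of Hasse derivatives, with
coefficients that vanish when the multi-index has degree more than `j` (`IsFrobBasis.diffIdeal_map_le`).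

*`η` does not increase.* Off the center, universality makes `R` a retract of `R₁` by local
homomorphisms, and orders do not increase for each ideal separately. Over the center, `η = a q + b` is
attained by some `I_i` with `i ≥ b`: if it is attained with `i < b`, then `a q + b - i` is `a q` plus a
number `c < q`, and since the binomial coefficient of `a q + c` over `c` is prime to `p`, a Hasse
derivative of order `c` lowers the order of some element by exactly `c`
(`exists_isDiffOp_notMem_pow`, `exists_order_add_eq_eta`). So `n = a q + b - i ≤ q a`, the ideal `I_i`
has order exactly `n` at the point, and order at least `n` along all of `Z`, as `η` is constant there.
The ideal `P` of `Z` in `R` is generated by a part of a regular system of parameters, so its symbolic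
powers are the ordinary ones, and `I_i ⊆ P ^ n` (`IsPrimeFlag.stalkIdeal_le_pow`). An element `f` of order
`n` in `I_i` can therefore be divided by `t ^ n` in `R₁`, and as `n ≤ q a` the quotient lies in the
transform. The quotient has order at most `n`, because it is up to a unit a dehomogenization of a form
of degree `n` in the generators of `P` with some coefficient a unit: this is computed in the completion
of the fibre of an explicit chart `W` (`IsPrimeFlag.exists_chart`), and only a local homomorphism
`R₁ → W` over `R` is needed, which the universal property provides (`IsBlowup.exists_stalk_hom`). So
neither the Rees algebra nor regularity of the blowup is used.
-/

namespace QDiff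

open IsLocalRing

/-! ### Regular local rings -/

section Regular

variable {R : Type*} [CommRing R]

/-- Exchange: an element of `𝔪` outside `𝔪 ^ 2` can replace one of a minimal set of generators
of `𝔪`, so the quotient by it needs one generator less. -/
lemma spanFinrank_maximalIdeal_quotient_span_singleton [IsLocalRing R] [IsNoetherianRing R] {z : R}
    (hz : z ∈ maximalIdeal R) (hz2 : z ∉ maximalIdeal R ^ 2)
    [IsLocalRing (R ⧸ Ideal.span {z})] :
    (maximalIdeal (R ⧸ Ideal.span {z})).spanFinrank + 1 ≤ (maximalIdeal R).spanFinrank := by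
  classical
  obtain ⟨s, hcard, hs⟩ :=
    Submodule.FG.exists_span_finset_card_eq_spanFinrank (maximalIdeal R).fg_of_isNoetherianRing
  rw [← hcard]
  obtain ⟨a, -, ha⟩ := Submodule.mem_span_finset.mp (hs ▸ hz : z ∈ Submodule.span R (s : Set R))
  have hsm : ∀ g ∈ s, g ∈ maximalIdeal R := fun g hg => hs ▸ Submodule.subset_span hg
  obtain ⟨g₀, hg₀, hu⟩ : ∃ g ∈ s, a g ∉ maximalIdeal R := by
    by_contra! h
    refine hz2 (ha ▸ Submodule.sum_mem _ fun g hg => ?_)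
    rw [pow_two]
    exact Ideal.mul_mem_mul (h g hg) (hsm g hg)
  obtain ⟨v, hv⟩ : IsUnit (a g₀) := by simpa using hu
  set mk := Ideal.Quotient.mk (Ideal.span {z})
  have hmax : maximalIdeal (R ⧸ Ideal.span {z}) = (Ideal.span (mk '' (s.erase g₀ : Finset R))) := by
    rw [← map_maximalIdeal_of_surjective mk Ideal.Quotient.mk_surjective]
    apply le_antisymm
    · rw [← hs, ← Ideal.span, Ideal.map_span, Ideal.span_le]
      rintro _ ⟨g, hg, rfl⟩
      by_cases h : g = g₀
      · subst h
        have h0 : mk (∑ x ∈ s, a x • x) = 0 := by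
          rw [ha]; exact Ideal.Quotient.eq_zero_iff_mem.mpr (Ideal.mem_span_singleton_self z)
        rw [← Finset.add_sum_erase s _ hg₀, map_add, smul_eq_mul, map_mul, ← hv] at h0
        have h1 : mk g = mk (↑v⁻¹) * - mk (∑ x ∈ s.erase g, a x • x) := by
          rw [← eq_neg_of_add_eq_zero_left h0, ← mul_assoc, ← map_mul]
          simp
        rw [SetLike.mem_coe, h1, map_sum]
        refine Ideal.mul_mem_left _ _ (neg_mem (Submodule.sum_mem _ fun x hx => ?_))
        rw [smul_eq_mul, map_mul]
        exact Ideal.mul_mem_left _ _ (Ideal.subset_span ⟨x, hx, rfl⟩)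
      · exact Ideal.subset_span ⟨g, by simpa [h] using hg, rfl⟩
    · rw [Ideal.span_le]
      rintro _ ⟨g, hg, rfl⟩
      exact Ideal.mem_map_of_mem _ (hsm g (Finset.mem_of_mem_erase hg))
  have h1 := Submodule.spanFinrank_span_le_ncard_of_finite (R := R ⧸ Ideal.span {z})
    ((s.erase g₀).finite_toSet.image mk)
  have h2 := Set.ncard_image_le (f := mk) (s.erase g₀).finite_toSet
  rw [Set.ncard_coe_finset, Finset.card_erase_of_mem hg₀] at h2
  have h3 : 0 < s.card := Finset.card_pos.mpr ⟨g₀, hg₀⟩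
  rw [hmax]
  change (Submodule.span _ _).spanFinrank + 1 ≤ _
  omega

lemma ringKrullDim_le_quotient_span_singleton_add_one [IsLocalRing R] [IsNoetherianRing R] {z : R}
    (hz : z ∈ maximalIdeal R) : ringKrullDim R ≤ ringKrullDim (R ⧸ Ideal.span {z}) + 1 := by
  simpa using ringKrullDim_le_ringKrullDim_quotient_add_encard ({z} : Set R)
    (by simpa [IsLocalRing.ringJacobson_eq_maximalIdeal] using hz)

/-- Cutting a regular local ring by an element of `𝔪 \ 𝔪 ^ 2` leaves a regular local ring, of
dimension one less. -/
lemma isRegularLocalRing_quotient_span_singleton [IsRegularLocalRing R] {z : R}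
    (hz : z ∈ maximalIdeal R) (hz2 : z ∉ maximalIdeal R ^ 2) :
    IsRegularLocalRing (R ⧸ Ideal.span {z}) ∧
      (ringKrullDim (R ⧸ Ideal.span {z}) + 1 ≤ ringKrullDim R) := by
  have hle : Ideal.span {z} ≤ maximalIdeal R := by simpa [Ideal.span_le] using hz
  have hne : Ideal.span {z} ≠ ⊤ := fun h => (maximalIdeal.isMaximal R).ne_top (top_le_iff.mp (h ▸ hle))
  have : Nontrivial (R ⧸ Ideal.span {z}) := Ideal.Quotient.nontrivial_iff.mpr hne
  have : IsLocalRing (R ⧸ Ideal.span {z}) := IsLocalRing.of_surjective' _ Ideal.Quotient.mk_surjective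
  have h1 := spanFinrank_maximalIdeal_quotient_span_singleton hz hz2
  have hdim := (isRegularLocalRing_iff R).mp ‹_›
  have h2 : ringKrullDim R ≤ ringKrullDim (R ⧸ Ideal.span {z}) + 1 :=
    ringKrullDim_le_quotient_span_singleton_add_one hz
  have h3 := ringKrullDim_le_spanFinrank_maximalIdeal (R ⧸ Ideal.span {z})
  have h1' : (((maximalIdeal (R ⧸ Ideal.span {z})).spanFinrank : ℕ) : WithBot ℕ∞) + 1 ≤
      ringKrullDim R := by
    rw [← hdim]; exact_mod_cast h1
  have h4 : (((maximalIdeal (R ⧸ Ideal.span {z})).spanFinrank : ℕ) : WithBot ℕ∞)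
      ≤ ringKrullDim (R ⧸ Ideal.span {z}) := by
    have := h1'.trans h2
    generalize ringKrullDim (R ⧸ Ideal.span {z}) = d at this
    induction d with
    | bot => simp at this
    | coe d =>
      induction d with
      | top => exact le_top
      | coe d => norm_cast at this ⊢; omega
  refine ⟨IsRegularLocalRing.of_spanFinrank_maximalIdeal_le _ h4, ?_⟩
  exact (add_le_add_left h3 1).trans h1'

/-- Induction on the dimension: prime avoidance gives `z ∈ 𝔪` outside `𝔪 ^ 2` and outside
every minimal prime. Then `(z)` is prime, it contains a minimal prime `Q`, and `Q = z Q` forces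
`Q = 0`. -/
theorem isDomain_of_isRegularLocalRing [IsRegularLocalRing R] : IsDomain R := by
  obtain ⟨n, hn⟩ : ∃ n : ℕ, (maximalIdeal R).spanFinrank = n := ⟨_, rfl⟩
  induction n generalizing R with
  | zero =>
    rw [Submodule.spanFinrank_eq_zero_iff_eq_bot (maximalIdeal R).fg_of_isNoetherianRing] at hn
    exact (isField_iff_maximalIdeal_eq.mpr hn).isDomain
  | succ n ih =>
    have hdim := (isRegularLocalRing_iff R).mp ‹_›
    have hlt := maximalIdeal_sq_lt_of_ringKrullDim_ne_zero (R := R) (by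
      rw [← hdim, hn]; exact_mod_cast Nat.succ_ne_zero n)
    obtain ⟨z, hz, hzm⟩ : ∃ z ∈ maximalIdeal R,
        z ∉ ⋃ I ∈ insert (maximalIdeal R ^ 2) (minimalPrimes R), ((I : Ideal R) : Set R) := by
      by_contra! h
      obtain ⟨I, hI, hle⟩ := (Ideal.subset_union_prime_finite
        ((minimalPrimes.finite_of_isNoetherianRing R).insert (maximalIdeal R ^ 2))
        (f := id) (maximalIdeal R ^ 2) (maximalIdeal R ^ 2) (by
          rintro I (rfl | hI) h1 _
          · exact absurd rfl h1
          · exact hI.1.1)).mp (fun z hz => h z hz)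
      rcases hI with rfl | hI
      · exact hlt.not_ge hle
      · have : maximalIdeal R = I := (maximalIdeal.isMaximal R).eq_of_le hI.1.1.ne_top hle
        have h0 : (maximalIdeal R).height = 0 := by
          rw [Ideal.height_eq_zero_iff, this]
          exact hI
        have := maximalIdeal_height_eq_ringKrullDim (R := R)
        rw [h0, ← hdim, hn] at this
        exact absurd this.symm (by exact_mod_cast Nat.succ_ne_zero n)
    simp only [Set.mem_iUnion, not_exists, Set.mem_insert_iff] at hzm
    have hz2 : z ∉ maximalIdeal R ^ 2 := fun h => hzm _ (Or.inl rfl) h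
    obtain ⟨hreg, hd⟩ := isRegularLocalRing_quotient_span_singleton hz hz2
    have hn' : (maximalIdeal (R ⧸ Ideal.span {z})).spanFinrank = n := by
      have h1 := spanFinrank_maximalIdeal_quotient_span_singleton hz hz2
      have h2 : ringKrullDim R ≤ ringKrullDim (R ⧸ Ideal.span {z}) + 1 :=
        ringKrullDim_le_quotient_span_singleton_add_one hz
      rw [← hdim, ← (isRegularLocalRing_iff _).mp hreg] at h2
      have : (maximalIdeal R).spanFinrank ≤ (maximalIdeal (R ⧸ Ideal.span {z})).spanFinrank + 1 := by
        exact_mod_cast h2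
      omega
    have hdom := ih hn'
    have hprime : (Ideal.span {z}).IsPrime := (Ideal.Quotient.isDomain_iff_prime _).mp hdom
    obtain ⟨Q, hQ, hQz⟩ := Ideal.exists_minimalPrimes_le (I := (⊥ : Ideal R)) (J := Ideal.span {z})
      bot_le
    have hQp := hQ.1.1
    have hzQ : z ∉ Q := fun h => hzm Q (Or.inr hQ) h
    have hQ0 : Q = ⊥ := by
      refine Submodule.eq_bot_of_le_smul_of_le_jacobson_bot (Ideal.span {z}) Q
        Q.fg_of_isNoetherianRing ?_ ?_
      · intro y hy
        obtain ⟨a, rfl⟩ := Ideal.mem_span_singleton.mp (hQz hy)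
        exact Submodule.smul_mem_smul (Ideal.mem_span_singleton_self z)
          ((hQp.mem_or_mem hy).resolve_left hzQ)
      · exact (by simpa [Ideal.span_le] using hz : Ideal.span {z} ≤ maximalIdeal R).trans
          (maximalIdeal_le_jacobson _)
    rw [hQ0] at hQp
    exact IsDomain.of_bot_isPrime R

/-- If `R` and `R / J` are regular and `J ⊆ 𝔪 ^ 2`, then both have the same embedding dimension,
hence the same dimension, so `J = 0` because `R` is a domain. -/
lemma exists_mem_notMem_maximalIdeal_sq [IsRegularLocalRing R] {J : Ideal R} (hJ : J ≠ ⊥)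
    [IsRegularLocalRing (R ⧸ J)] : ∃ z ∈ J, z ∉ maximalIdeal R ^ 2 := by
  classical
  have := isDomain_of_isRegularLocalRing (R := R)
  by_contra! hle
  obtain ⟨j, hj, hj0⟩ := Submodule.exists_mem_ne_zero_of_ne_bot hJ
  have hd : ringKrullDim (R ⧸ J) + 1 ≤ ringKrullDim R :=
    ringKrullDim_succ_le_of_surjective (Ideal.Quotient.mk J) Ideal.Quotient.mk_surjective
      (mem_nonZeroDivisors_of_ne_zero hj0) (Ideal.Quotient.eq_zero_iff_mem.mpr hj)
  rw [← (isRegularLocalRing_iff _).mp ‹IsRegularLocalRing R›,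
    ← (isRegularLocalRing_iff _).mp ‹IsRegularLocalRing (R ⧸ J)›] at hd
  have hd' : (maximalIdeal (R ⧸ J)).spanFinrank + 1 ≤ (maximalIdeal R).spanFinrank := by
    exact_mod_cast hd
  obtain ⟨s, hcard, hs⟩ := Submodule.FG.exists_span_finset_card_eq_spanFinrank
    (maximalIdeal (R ⧸ J)).fg_of_isNoetherianRing
  set mk := Ideal.Quotient.mk J
  obtain ⟨g, hg⟩ : ∃ g : R ⧸ J → R, ∀ x, mk (g x) = x :=
    ⟨_, Function.surjInv_eq Ideal.Quotient.mk_surjective⟩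
  have hmap := map_maximalIdeal_of_surjective mk Ideal.Quotient.mk_surjective
  have hgm : ∀ x ∈ s, g x ∈ maximalIdeal R := by
    intro x hx
    rw [mem_maximalIdeal, mem_nonunits_iff]
    intro hu
    have : x ∈ maximalIdeal (R ⧸ J) := hs ▸ Submodule.subset_span hx
    rw [mem_maximalIdeal, mem_nonunits_iff, ← hg x] at this
    exact this (hu.map mk)
  have hspan : maximalIdeal R = Ideal.span (s.image g : Finset R) := by
    apply le_antisymm
    · refine Submodule.le_of_le_smul_of_le_jacobson_bot (I := maximalIdeal R)
        (maximalIdeal R).fg_of_isNoetherianRing (maximalIdeal_le_jacobson _) ?_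
      intro y hy
      have h1 : mk y ∈ (Ideal.span (s.image g : Finset R)).map mk := by
        have : (Ideal.span (s.image g : Finset R)).map mk = maximalIdeal (R ⧸ J) := by
          rw [Ideal.map_span, ← hs, Finset.coe_image, ← Set.image_comp]
          congr 1
          simp [hg]
        rw [this, ← hmap]
        exact Ideal.mem_map_of_mem _ hy
      obtain ⟨w, hw, hwy⟩ := (Ideal.mem_map_iff_of_surjective mk Ideal.Quotient.mk_surjective).mp h1
      have h2 : y - w ∈ J := Ideal.Quotient.eq_zero_iff_mem.mp (by
        change mk (y - w) = 0
        rw [map_sub, hwy, sub_self])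
      have h3 := hle _ h2
      rw [pow_two] at h3
      exact Submodule.mem_sup.mpr ⟨w, hw, y - w, h3, by ring⟩
    · rw [Ideal.span_le]
      intro y hy
      obtain ⟨x, hx, rfl⟩ := Finset.mem_image.mp hy
      exact hgm x hx
  have h1 := Submodule.spanFinrank_span_le_ncard_of_finite (R := R) (s.image g).finite_toSet
  rw [Set.ncard_coe_finset] at h1
  have h2 := Finset.card_image_le (s := s) (f := g)
  have h3 : (maximalIdeal R).spanFinrank ≤ (s.image g).card := by
    rw [hspan]; exact h1
  omega

/-- A finite sequence in `R`, read from its last entry to its first, all of whose partial spans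
(including the zero ideal) are prime and which strictly increase. -/
def IsPrimeFlag : (r : ℕ) → (Fin r → R) → Prop
  | 0, _ => (⊥ : Ideal R).IsPrime
  | r + 1, x => IsPrimeFlag r (Fin.tail x) ∧ x 0 ∉ Ideal.span (Set.range (Fin.tail x)) ∧
      (Ideal.span (Set.range x)).IsPrime

lemma IsPrimeFlag.isPrime {r : ℕ} {x : Fin r → R} (h : IsPrimeFlag r x) :
    (Ideal.span (Set.range x)).IsPrime := by
  cases r with
  | zero => simpa [IsPrimeFlag] using h
  | succ r => exact h.2.2

lemma span_range_eq_tail_sup {r : ℕ} (x : Fin (r + 1) → R) :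
    Ideal.span (Set.range x) = Ideal.span (Set.range (Fin.tail x)) ⊔ Ideal.span {x 0} := by
  conv_lhs => rw [← Fin.cons_self_tail x, Fin.range_cons, Ideal.span_insert, sup_comm]

lemma exists_isRegularLocalRing_quotient_sup [IsRegularLocalRing R] {I J : Ideal R} (h : I < J)
    [IsRegularLocalRing (R ⧸ I)] [IsRegularLocalRing (R ⧸ J)] :
    ∃ z ∈ J, z ∉ I ∧ IsRegularLocalRing (R ⧸ I ⊔ Ideal.span {z}) := by
  have : IsRegularLocalRing ((R ⧸ I) ⧸ J.map (Ideal.Quotient.mk I)) :=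
    .of_ringEquiv (DoubleQuot.quotQuotEquivQuotOfLE h.le).symm
  obtain ⟨z', hz', hz2⟩ := exists_mem_notMem_maximalIdeal_sq (R := R ⧸ I)
    (J := J.map (Ideal.Quotient.mk I)) (by
      rw [Ne, Ideal.map_eq_bot_iff_le_ker, Ideal.mk_ker]
      exact h.not_ge)
  obtain ⟨z, hz, rfl⟩ := (Ideal.mem_map_iff_of_surjective _ Ideal.Quotient.mk_surjective).mp hz'
  have hzm : Ideal.Quotient.mk I z ∈ maximalIdeal (R ⧸ I) := by
    refine le_maximalIdeal ?_ hz'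
    intro htop
    have : Nontrivial ((R ⧸ I) ⧸ J.map (Ideal.Quotient.mk I)) := inferInstance
    exact (Ideal.Quotient.nontrivial_iff.mp this) htop
  have h1 := (isRegularLocalRing_quotient_span_singleton hzm hz2).1
  refine ⟨z, hz, fun hzI => hz2 ?_, ?_⟩
  · rw [Ideal.Quotient.eq_zero_iff_mem.mpr hzI]; exact zero_mem _
  · have h2 : Ideal.span {Ideal.Quotient.mk I z} = (Ideal.span {z}).map (Ideal.Quotient.mk I) := by
      rw [Ideal.map_span, Set.image_singleton]
    rw [h2] at h1
    exact .of_ringEquiv (DoubleQuot.quotQuotEquivQuotSup I (Ideal.span {z}))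

/-- In a regular local ring, a prime flag whose span has regular quotient extends to a prime flag
of any larger ideal with regular quotient. -/
theorem IsPrimeFlag.exists_extend [IsRegularLocalRing R] {J : Ideal R} [hJ : IsRegularLocalRing (R ⧸ J)]
    {r : ℕ} (x : Fin r → R) (hx : IsPrimeFlag r x) (hle : Ideal.span (Set.range x) ≤ J)
    (hreg : IsRegularLocalRing (R ⧸ Ideal.span (Set.range x))) :
    ∃ (d : ℕ) (y : Fin d → R), IsPrimeFlag d y ∧ Ideal.span (Set.range y) = J := by
  obtain ⟨I, hI⟩ : ∃ I, Ideal.span (Set.range x) = I := ⟨_, rfl⟩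
  induction I using WellFoundedGT.induction generalizing r with
  | ind I ih =>
    by_cases h : Ideal.span (Set.range x) = J
    · exact ⟨r, x, hx, h⟩
    obtain ⟨z, hzJ, hzI, hz⟩ := exists_isRegularLocalRing_quotient_sup (lt_of_le_of_ne hle h)
    have hspan : Ideal.span (Set.range (Fin.cons z x : Fin (r + 1) → R)) =
        Ideal.span (Set.range x) ⊔ Ideal.span {z} := by
      rw [span_range_eq_tail_sup]; simp
    have hz' : IsRegularLocalRing (R ⧸ Ideal.span (Set.range (Fin.cons z x : Fin (r + 1) → R))) := by
      rw [hspan]; exact hz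
    refine ih _ ?_ (Fin.cons z x) ⟨by simpa using hx, by simpa using hzI, ?_⟩ ?_ hz' rfl
    · rw [← hI, hspan]
      exact lt_of_le_not_ge le_sup_left fun h => hzI (h (Ideal.mem_sup_right (Ideal.mem_span_singleton_self z)))
    · exact (Ideal.Quotient.isDomain_iff_prime _).mp isDomain_of_isRegularLocalRing
    · rw [hspan]
      exact sup_le hle (by simpa [Ideal.span_le] using hzJ)

/-- In a regular local ring, an ideal with regular quotient is generated by a prime flag. -/
theorem exists_isPrimeFlag_span_eq [IsRegularLocalRing R] (J : Ideal R)
    [hJ : IsRegularLocalRing (R ⧸ J)] :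
    ∃ (d : ℕ) (y : Fin d → R), IsPrimeFlag d y ∧ Ideal.span (Set.range y) = J := by
  have hdom := isDomain_of_isRegularLocalRing (R := R)
  refine IsPrimeFlag.exists_extend (fun i : Fin 0 => i.elim0) (Ideal.isPrime_bot (α := R))
    (by simp) ?_
  have : Ideal.span (Set.range (fun i : Fin 0 => (i.elim0 : R))) = ⊥ := by simp
  rw [this]
  exact .of_ringEquiv (RingEquiv.quotientBot R).symm

end Regular
end QDiff

namespace QDiff

/-! ### Quasi-regularity of prime flags -/

section QuasiRegular

open MvPolynomial

variable {R : Type*} [CommRing R]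

lemma finSuccEquiv_rename_succ {r : ℕ} (f : MvPolynomial (Fin r) R) :
    finSuccEquiv R r (rename Fin.succ f) = Polynomial.C f := by
  induction f using MvPolynomial.induction_on with
  | C a => simp [finSuccEquiv_apply]
  | add p q hp hq => simp only [map_add, hp, hq]
  | mul_X p i hp => simp only [map_mul, hp, rename_X, finSuccEquiv_X_succ]

/-- Splitting off the terms of a form that involve the first variable. -/
lemma exists_eq_X_zero_mul_add_rename {r n : ℕ} {H : MvPolynomial (Fin (r + 1)) R}
    (hH : H.IsHomogeneous (n + 1)) :
    ∃ (H₁ : MvPolynomial (Fin (r + 1)) R) (H₀ : MvPolynomial (Fin r) R), H₁.IsHomogeneous n ∧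
      H₀.IsHomogeneous (n + 1) ∧ H = X 0 * H₁ + rename Fin.succ H₀ := by
  set F := finSuccEquiv R r H with hF
  have h0 : (F.coeff 0).IsHomogeneous (n + 1) :=
    hH.finSuccEquiv_coeff_isHomogeneous 0 (n + 1) (by simp)
  have hsum : H = X 0 * (finSuccEquiv R r).symm F.divX + rename Fin.succ (F.coeff 0) := by
    apply (finSuccEquiv R r).injective
    rw [map_add, map_mul, AlgEquiv.apply_symm_apply, finSuccEquiv_X_zero,
      finSuccEquiv_rename_succ, mul_comm]
    exact (Polynomial.divX_mul_X_add F).symm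
  refine ⟨_, F.coeff 0, ?_, h0, hsum⟩
  intro d hd
  have h1 : (X 0 * (finSuccEquiv R r).symm F.divX).IsHomogeneous (n + 1) := by
    rw [eq_sub_iff_add_eq.mpr hsum.symm]
    exact hH.sub (h0.rename_isHomogeneous)
  have h2 := h1 (d := Finsupp.single 0 1 + d) (by rwa [coeff_X_mul])
  rw [map_add] at h2
  simp [Finsupp.weight_apply] at h2 ⊢
  omega

/-- An element of `I ^ (n + 1)` is the value of a form of degree `n` with coefficients in `I`. -/
lemma exists_isHomogeneous_mem_map_C_of_mem_span_pow_succ {ι : Type*} (x : ι → R) {n : ℕ} {y : R}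
    (hy : y ∈ Ideal.span (Set.range x) ^ (n + 1)) :
    ∃ G : MvPolynomial ι R, G.IsHomogeneous n ∧ G ∈ (Ideal.span (Set.range x)).map C ∧
      eval x G = y := by
  rw [pow_succ'] at hy
  induction hy using Submodule.mul_induction_on' with
  | mem_mul_mem a ha b hb =>
    obtain ⟨G, hG, rfl⟩ := (Ideal.mem_span_pow_iff_exists_isHomogeneous x b).mp hb
    refine ⟨C a * G, by simpa using (isHomogeneous_C _ a).mul hG,
      Ideal.mul_mem_right _ _ (Ideal.mem_map_of_mem _ ha), by simp⟩
  | add a _ b _ ha hb =>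
    obtain ⟨G, hG, hGI, rfl⟩ := ha
    obtain ⟨G', hG', hGI', rfl⟩ := hb
    exact ⟨G + G', hG.add hG', add_mem hGI hGI', by simp⟩

/-- If every form of degree `n` vanishing at `x` has coefficients in `(x)`, then so has every
form of degree `n` whose value at `x` lies in `(x) ^ (n + 1)`. -/
lemma mem_map_C_of_eval_mem_pow_succ {ι : Type*} {x : ι → R} {n : ℕ}
    (h0 : ∀ H : MvPolynomial ι R, H.IsHomogeneous n → eval x H = 0 →
      H ∈ (Ideal.span (Set.range x)).map C)
    {F : MvPolynomial ι R} (hF : F.IsHomogeneous n)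
    (hx : eval x F ∈ Ideal.span (Set.range x) ^ (n + 1)) :
    F ∈ (Ideal.span (Set.range x)).map C := by
  obtain ⟨G, hG, hGI, hGe⟩ := exists_isHomogeneous_mem_map_C_of_mem_span_pow_succ x hx
  have := h0 (F - G) (hF.sub hG) (by simp [hGe])
  simpa using add_mem this hGI

lemma eval_mem_mul_pow {ι : Type*} {x : ι → R} {I J : Ideal R} (hx : ∀ i, x i ∈ I)
    {F : MvPolynomial ι R} (hF : F ∈ J.map C) {k : ℕ} (hFk : F.IsHomogeneous k) :
    eval x F ∈ J * I ^ k := by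
  rw [F.as_sum, map_sum]
  refine Submodule.sum_mem _ fun m hm => ?_
  rw [mem_map_C_iff] at hF
  rw [eval_monomial, Finsupp.prod]
  refine Ideal.mul_mem_mul (hF m) ?_
  have hdeg : ∑ i ∈ m.support, m i = k := by
    have := hFk (mem_support_iff.mp hm)
    simpa [Finsupp.weight_apply, Finsupp.sum] using this
  rw [← hdeg, ← Finset.prod_pow_eq_pow_sum]
  exact Ideal.prod_mem_prod fun i _ => Ideal.pow_mem_pow (hx i) _

/-- Quasi-regularity makes powers of the prime ideal `(x)` primary: their symbolic powers are the
ordinary ones. -/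
lemma mem_pow_of_mul_mem_pow_of_quasiRegular {ι : Type*} {x : ι → R}
    (hp : (Ideal.span (Set.range x)).IsPrime)
    (h0 : ∀ n, ∀ H : MvPolynomial ι R, H.IsHomogeneous n → eval x H = 0 →
      H ∈ (Ideal.span (Set.range x)).map C)
    {s f : R} (hs : s ∉ Ideal.span (Set.range x)) {n : ℕ}
    (h : s * f ∈ Ideal.span (Set.range x) ^ n) : f ∈ Ideal.span (Set.range x) ^ n := by
  have key : ∀ k ≤ n, f ∈ Ideal.span (Set.range x) ^ k := by
    intro k hk
    induction k with
    | zero => simp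
    | succ k ih =>
      obtain ⟨G, hG, hGe⟩ := (Ideal.mem_span_pow_iff_exists_isHomogeneous x f).mp (ih (by omega))
      have h1 := mem_map_C_of_eval_mem_pow_succ (h0 k)
        (F := C s * G) (by simpa using (isHomogeneous_C _ s).mul hG)
        (by simpa [hGe] using Ideal.pow_le_pow_right hk h)
      have h2 : G ∈ (Ideal.span (Set.range x)).map C := by
        rw [mem_map_C_iff] at h1 ⊢
        intro m
        exact (hp.mem_or_mem (by simpa using h1 m)).resolve_left hs
      rw [← hGe, pow_succ']
      exact eval_mem_mul_pow (fun i => Ideal.subset_span (Set.mem_range_self i)) h2 hG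
  exact key n le_rfl

/-- A prime flag is a quasi-regular sequence: a form vanishing at `x` has all its coefficients in
`(x)`. The last element `z = x 0` is split off from the form, `H = z H₁ + H₀`; then `H₁` takes a
value in the corresponding power of the smaller ideal, since `z` is a non-zero-divisor modulo
its powers. -/
theorem IsPrimeFlag.mem_map_C_of_eval_eq_zero {r : ℕ} {x : Fin r → R} (hx : IsPrimeFlag r x) (n : ℕ)
    (H : MvPolynomial (Fin r) R) (hH : H.IsHomogeneous n) (h : eval x H = 0) :
    H ∈ (Ideal.span (Set.range x)).map C := by
  induction r generalizing n with
  | zero =>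
    rw [eq_C_of_isEmpty H] at h ⊢
    simp only [eval_C] at h
    simp [h]
  | succ r ihr =>
    obtain ⟨hxt, hz, -⟩ := hx
    have ihr := fun n H => ihr hxt n H
    have hspan := span_range_eq_tail_sup x
    induction n generalizing H with
    | zero =>
      have hC : H = C (coeff 0 H) :=
        totalDegree_eq_zero_iff_eq_C.mp (Nat.le_zero.mp (IsHomogeneous.totalDegree_le hH))
      rw [hC] at h ⊢
      simp only [eval_C] at h
      simp [h]
    | succ n ihn =>
      obtain ⟨H₁, H₀, hH₁, hH₀, rfl⟩ := exists_eq_X_zero_mul_add_rename hH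
      have heval : eval x (rename Fin.succ H₀) = eval (Fin.tail x) H₀ := by
        rw [eval_rename]; rfl
      simp only [map_add, map_mul, eval_X, heval] at h
      have h1 : eval x H₁ ∈ Ideal.span (Set.range (Fin.tail x)) ^ (n + 1) := by
        refine mem_pow_of_mul_mem_pow_of_quasiRegular hxt.isPrime ihr hz ?_
        rw [eq_neg_of_add_eq_zero_left h]
        exact neg_mem ((Ideal.mem_span_pow_iff_exists_isHomogeneous _ _).mpr ⟨H₀, hH₀, rfl⟩)
      obtain ⟨K, hK, hKe⟩ := (Ideal.mem_span_pow_iff_exists_isHomogeneous _ _).mp h1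
      have hle : Ideal.span (Set.range (Fin.tail x)) ≤ Ideal.span (Set.range x) :=
        hspan ▸ le_sup_left
      have hx0 : x 0 ∈ Ideal.span (Set.range x) := Ideal.subset_span ⟨0, rfl⟩
      have h2 : H₀ + C (x 0) * K ∈ (Ideal.span (Set.range (Fin.tail x))).map C :=
        ihr (n + 1) _ (hH₀.add (by simpa using (isHomogeneous_C _ (x 0)).mul hK))
          (by simp only [map_add, map_mul, eval_C, hKe]; rw [add_comm]; exact h)
      have h3 : H₀ ∈ (Ideal.span (Set.range x)).map C := by
        have := sub_mem (Ideal.map_mono hle h2)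
          (Ideal.mul_mem_right K _ (Ideal.mem_map_of_mem C hx0))
        simpa using this
      have h4 : H₁ ∈ (Ideal.span (Set.range x)).map C :=
        mem_map_C_of_eval_mem_pow_succ ihn hH₁ (Ideal.pow_right_mono hle _ h1)
      refine add_mem (Ideal.mul_mem_left _ _ h4) ?_
      have := Ideal.mem_map_of_mem (rename (R := R) (Fin.succ : Fin r → Fin (r + 1))).toRingHom h3
      rw [Ideal.map_map] at this
      have hC : ((rename (R := R) (Fin.succ : Fin r → Fin (r + 1))).toRingHom.comp C) = C := by
        ext
        simp
      rwa [hC] at this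

variable {r : ℕ} {x : Fin r → R}

/-- A prime flag is quasi-regular: `(x) ^ n / (x) ^ (n + 1)` consists of the forms of degree `n`
over `R / (x)`. -/
theorem IsPrimeFlag.mem_map_C_of_eval_mem_pow_succ (hx : IsPrimeFlag r x) {n : ℕ}
    {F : MvPolynomial (Fin r) R} (hF : F.IsHomogeneous n)
    (h : eval x F ∈ Ideal.span (Set.range x) ^ (n + 1)) :
    F ∈ (Ideal.span (Set.range x)).map C :=
  QDiff.mem_map_C_of_eval_mem_pow_succ (hx.mem_map_C_of_eval_eq_zero n) hF h

/-- The powers of a prime ideal generated by a prime flag are primary. -/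
theorem IsPrimeFlag.mem_pow_of_mul_mem_pow (hx : IsPrimeFlag r x) {s f : R}
    (hs : s ∉ Ideal.span (Set.range x)) {n : ℕ}
    (h : s * f ∈ Ideal.span (Set.range x) ^ n) : f ∈ Ideal.span (Set.range x) ^ n :=
  mem_pow_of_mul_mem_pow_of_quasiRegular hx.isPrime hx.mem_map_C_of_eval_eq_zero hs h

end QuasiRegular
end QDiff

namespace QDiff

open IsLocalRing

/-! ### Frobenius bases -/

section FrobSum

variable {R : Type*} [CommRing R] {ι : Type*} [Fintype ι] [DecidableEq ι]

/-- The combination `∑ c_γ ^ q y ^ γ` of the monomials in `y` with all exponents less than `q`,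
with `q`-th powers as coefficients. -/
def frobSum (q : ℕ) (y : ι → R) (c : (ι → Fin q) → R) : R :=
  ∑ γ, c γ ^ q * ∏ i, y i ^ (γ i : ℕ)

/-- The monomials in `y` with exponents less than `q` are independent modulo `I` over the
`q`-th powers. -/
def IsFrobIndep (q : ℕ) (I : Ideal R) (y : ι → R) : Prop :=
  ∀ c, frobSum q y c ∈ I → ∀ γ, c γ ∈ I

/-- The monomials in `y` with exponents less than `q` are a basis of `R` over its subring of
`q`-th powers: every element is `frobSum q y c` for a unique family `c`. For `q = p` this says
that `y` is a `p`-basis. -/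
def IsFrobBasis (q : ℕ) (y : ι → R) : Prop := Function.Bijective (frobSum q y)

lemma frobSum_option (q : ℕ) (z : R) (y : ι → R) (c : (Option ι → Fin q) → R) :
    frobSum q (fun o : Option ι => o.elim z y) c =
      ∑ j : Fin q, z ^ (j : ℕ) *
        frobSum q y (fun γ => c ((Equiv.piOptionEquivProd (β := fun _ => Fin q)).symm (j, γ))) := by
  rw [frobSum, ← (Equiv.piOptionEquivProd (β := fun _ : Option ι => Fin q)).symm.sum_comp,
    Fintype.sum_prod_type]
  refine Finset.sum_congr rfl fun j _ => ?_
  rw [frobSum, Finset.mul_sum]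
  refine Finset.sum_congr rfl fun γ _ => ?_
  rw [Fintype.prod_option]
  simp [Equiv.piOptionEquivProd]
  ring

lemma frobSum_reindex {κ : Type*} [Fintype κ] [DecidableEq κ] (q : ℕ) (σ : κ ≃ ι) (y : ι → R)
    (c : (ι → Fin q) → R) :
    frobSum q (y ∘ σ) (fun γ => c (γ ∘ σ.symm)) = frobSum q y c := by
  rw [frobSum, frobSum]
  refine Fintype.sum_equiv (σ.arrowCongr (Equiv.refl _)) _ _ fun γ => ?_
  rw [← σ.prod_comp]
  simp [Equiv.arrowCongr, Function.comp_def]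

lemma IsFrobIndep.of_reindex {κ : Type*} [Fintype κ] [DecidableEq κ] {q : ℕ} {I : Ideal R}
    {y : ι → R} (σ : κ ≃ ι) (h : IsFrobIndep q I (y ∘ σ)) : IsFrobIndep q I y := by
  intro c hc γ
  rw [← frobSum_reindex q σ] at hc
  have := h _ hc (γ ∘ σ)
  simpa [Function.comp_def] using this

lemma frobSum_mul (q : ℕ) (a : R) (y : ι → R) (c : (ι → Fin q) → R) :
    frobSum q y (fun γ => a * c γ) = a ^ q * frobSum q y c := by
  simp only [frobSum, mul_pow, Finset.mul_sum, mul_assoc]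

/-- Krull's intersection theorem modulo `I`. -/
lemma mem_of_forall_mem_sup_span_pow [IsNoetherianRing R] [IsLocalRing R] {I : Ideal R} {z : R}
    (hz : z ∈ maximalIdeal R) {c : R} (h : ∀ n : ℕ, c ∈ I ⊔ Ideal.span {z ^ n}) : c ∈ I := by
  have hne : Ideal.span {z} ≠ ⊤ := fun htop =>
    (maximalIdeal.isMaximal R).ne_top (top_le_iff.mp (htop ▸ by simpa [Ideal.span_le] using hz))
  have hk := Ideal.iInf_pow_smul_eq_bot_of_isLocalRing (M := R ⧸ I) (Ideal.span {z}) hne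
  rw [← Ideal.Quotient.eq_zero_iff_mem, ← Submodule.mem_bot (R := R), ← hk, Submodule.mem_iInf]
  intro n
  obtain ⟨i, hi, w, hw, rfl⟩ := Submodule.mem_sup.mp (h n)
  obtain ⟨w, rfl⟩ := Ideal.mem_span_singleton.mp hw
  have : Ideal.Quotient.mk I (i + z ^ n * w) = (z ^ n) • Ideal.Quotient.mk I w := by
    rw [map_add, Ideal.Quotient.eq_zero_iff_mem.mpr hi, zero_add, map_mul]
    rfl
  rw [this]
  exact Submodule.smul_mem_smul (Ideal.pow_mem_pow (Ideal.mem_span_singleton_self z) n) trivial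

variable {p : ℕ} [Fact p.Prime] (e : ℕ)

lemma frobSum_zero (y : ι → R) : frobSum (p ^ e) y 0 = 0 := by
  have : p ^ e ≠ 0 := pow_ne_zero _ (Fact.out : p.Prime).ne_zero
  simp [frobSum, zero_pow this]

lemma frobSum_single (y : ι → R) (γ : ι → Fin (p ^ e)) (a : R) :
    frobSum (p ^ e) y (Pi.single γ a) = a ^ (p ^ e) * ∏ i, y i ^ (γ i : ℕ) := by
  have : p ^ e ≠ 0 := pow_ne_zero _ (Fact.out : p.Prime).ne_zero
  rw [frobSum, Finset.sum_eq_single γ]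
  · simp
  · intro b _ hb
    simp [Pi.single_eq_of_ne hb, zero_pow this]
  · simp

/-- The monomials with arbitrary exponents are combinations of those with exponents less than `q`,
by division with remainder. -/
lemma exists_frobSum_eq_pow_mul_prod (y : ι → R) (γ : ι → ℕ) (a : R) :
    ∃ c, frobSum (p ^ e) y c = a ^ p ^ e * ∏ i, y i ^ γ i := by
  have hpos : 0 < p ^ e := pow_pos (Fact.out : p.Prime).pos _
  refine ⟨Pi.single (fun i => ⟨γ i % p ^ e, Nat.mod_lt _ hpos⟩) (a * ∏ i, y i ^ (γ i / p ^ e)), ?_⟩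
  rw [frobSum_single, mul_pow, ← Finset.prod_pow, mul_assoc, ← Finset.prod_mul_distrib]
  congr 1
  refine Finset.prod_congr rfl fun i _ => ?_
  rw [← pow_mul, ← pow_add, mul_comm, Nat.div_add_mod]

variable [CharP R p]

lemma frobSum_sub (y : ι → R) (c c' : (ι → Fin (p ^ e)) → R) :
    frobSum (p ^ e) y (c - c') = frobSum (p ^ e) y c - frobSum (p ^ e) y c' := by
  simp only [frobSum, Pi.sub_apply, sub_pow_char_pow, sub_mul, Finset.sum_sub_distrib]

lemma frobSum_add (y : ι → R) (c c' : (ι → Fin (p ^ e)) → R) :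
    frobSum (p ^ e) y (c + c') = frobSum (p ^ e) y c + frobSum (p ^ e) y c' := by
  simp only [frobSum, Pi.add_apply, add_pow_char_pow, add_mul, Finset.sum_add_distrib]

lemma IsFrobIndep.injective {e : ℕ} {y : ι → R} (h : IsFrobIndep (p ^ e) ⊥ y) :
    Function.Injective (frobSum (p ^ e) y) := by
  intro c c' hc
  have := h (c - c') (by rw [frobSum_sub, hc, sub_self]; exact zero_mem _)
  funext γ
  exact sub_eq_zero.mp (this γ)

lemma pow_mem_sup_span_pow {I : Ideal R} {z c : R} (h : c ∈ I ⊔ Ideal.span {z}) :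
    c ^ p ^ e ∈ I ⊔ Ideal.span {z ^ p ^ e} := by
  obtain ⟨i, hi, w, hw, rfl⟩ := Submodule.mem_sup.mp h
  obtain ⟨w, rfl⟩ := Ideal.mem_span_singleton.mp hw
  rw [add_pow_char_pow, mul_pow]
  refine Submodule.mem_sup.mpr ⟨_, Ideal.pow_mem_of_mem _ hi _
    (pow_pos (Fact.out : p.Prime).pos _), _, ?_, rfl⟩
  exact Ideal.mul_mem_right _ _ (Ideal.mem_span_singleton_self _)

/-- A relation `∑ z ^ j A_j ∈ I` with `A_j` combinations of the monomials in `y` forces the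
coefficients of `A_0, A_1, …` one after the other into `I + (z)`. -/
lemma IsFrobIndep.mem_sup_of_frobSum_option_mem {I : Ideal R} (hI : I.IsPrime) {z : R} (hzI : z ∉ I)
    {y : ι → R} (hy : IsFrobIndep (p ^ e) (I ⊔ Ideal.span {z}) y)
    (c : Fin (p ^ e) → (ι → Fin (p ^ e)) → R)
    (hc : ∑ j : Fin (p ^ e), z ^ (j : ℕ) * frobSum (p ^ e) y (c j) ∈ I) (j γ) :
    c j γ ∈ I ⊔ Ideal.span {z} := by
  obtain ⟨j, hj⟩ := j
  induction j using Nat.strong_induction_on generalizing γ with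
  | _ j ih =>
    refine hy _ ?_ γ
    have h1 : z ^ j * frobSum (p ^ e) y (c ⟨j, hj⟩) ∈ I ⊔ Ideal.span {z ^ (j + 1)} := by
      have h2 : ∀ j' ∈ Finset.univ.erase (⟨j, hj⟩ : Fin (p ^ e)),
          z ^ (j' : ℕ) * frobSum (p ^ e) y (c j') ∈ I ⊔ Ideal.span {z ^ (j + 1)} := by
        intro j' hj'
        rcases lt_or_gt_of_ne (Fin.val_ne_of_ne (Finset.ne_of_mem_erase hj')) with h | h
        · refine Ideal.mul_mem_left _ _ (Submodule.sum_mem _ fun γ' _ => Ideal.mul_mem_right _ _ ?_)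
          have h3 := pow_mem_sup_span_pow e (ih _ h γ' j'.2)
          refine sup_le_sup_left ?_ I h3
          rw [Ideal.span_singleton_le_span_singleton]
          exact pow_dvd_pow z hj
        · refine Ideal.mul_mem_right _ _ (Ideal.mem_sup_right ?_)
          rw [Ideal.mem_span_singleton]
          exact pow_dvd_pow z h
      rw [← Finset.add_sum_erase _ _ (Finset.mem_univ (⟨j, hj⟩ : Fin (p ^ e)))] at hc
      have := sub_mem (Ideal.mem_sup_left hc) (Submodule.sum_mem _ h2)
      simpa using this
    obtain ⟨i, hi, w, hw, hiw⟩ := Submodule.mem_sup.mp h1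
    obtain ⟨w, rfl⟩ := Ideal.mem_span_singleton.mp hw
    have h4 : z ^ j * (frobSum (p ^ e) y (c ⟨j, hj⟩) - z * w) ∈ I := by
      have : z ^ j * (frobSum (p ^ e) y (c ⟨j, hj⟩) - z * w) = i := by
        rw [mul_sub, ← hiw]; ring
      rwa [this]
    have h5 := (hI.mem_or_mem h4).resolve_left fun h => hzI (hI.mem_of_pow_mem _ h)
    have := add_mem (Ideal.mem_sup_left h5) (Ideal.mem_sup_right
      (Ideal.mul_mem_right w _ (Ideal.mem_span_singleton_self z)))
    simpa using this

/-- Independence modulo `I + (z)` of the monomials in `y` gives independence modulo `I` of the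
monomials in `z, y`: a relation has coefficients in `I + (z)`, and dividing it by `z ^ q` shows
inductively that they lie in `I + (z ^ n)` for all `n`. -/
theorem IsFrobIndep.option [IsNoetherianRing R] [IsLocalRing R] {I : Ideal R} (hI : I.IsPrime)
    {z : R} (hz : z ∈ maximalIdeal R) (hzI : z ∉ I) {y : ι → R}
    (hy : IsFrobIndep (p ^ e) (I ⊔ Ideal.span {z}) y) :
    IsFrobIndep (p ^ e) I (fun o : Option ι => o.elim z y) := by
  have key : ∀ n : ℕ, ∀ c : Fin (p ^ e) → (ι → Fin (p ^ e)) → R,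
      ∑ j : Fin (p ^ e), z ^ (j : ℕ) * frobSum (p ^ e) y (c j) ∈ I →
      ∀ j γ, c j γ ∈ I ⊔ Ideal.span {z ^ n} := by
    intro n
    induction n with
    | zero => simp
    | succ n ih =>
      intro c hc
      have h1 := hy.mem_sup_of_frobSum_option_mem e hI hzI c hc
      have h2 : ∀ j γ, ∃ i ∈ I, ∃ w, c j γ = i + z * w := by
        intro j γ
        obtain ⟨i, hi, w, hw, hiw⟩ := Submodule.mem_sup.mp (h1 j γ)
        obtain ⟨w, rfl⟩ := Ideal.mem_span_singleton.mp hw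
        exact ⟨i, hi, w, hiw.symm⟩
      choose i hi w hw using h2
      have h3 : z ^ p ^ e * ∑ j : Fin (p ^ e), z ^ (j : ℕ) * frobSum (p ^ e) y (w j) ∈ I := by
        have hsum : ∑ j : Fin (p ^ e), z ^ (j : ℕ) * frobSum (p ^ e) y (c j) =
            ∑ j : Fin (p ^ e), z ^ (j : ℕ) * frobSum (p ^ e) y (i j) +
            z ^ p ^ e * ∑ j : Fin (p ^ e), z ^ (j : ℕ) * frobSum (p ^ e) y (w j) := by
          rw [Finset.mul_sum, ← Finset.sum_add_distrib]
          refine Finset.sum_congr rfl fun j _ => ?_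
          have : c j = i j + fun γ => z * w j γ := by
            funext γ; exact hw j γ
          rw [this, frobSum_add, frobSum_mul]
          ring
        rw [hsum] at hc
        refine (Ideal.add_mem_iff_right I ?_).mp hc
        exact Submodule.sum_mem _ fun j _ => Ideal.mul_mem_left _ _ (Submodule.sum_mem _ fun γ _ =>
          Ideal.mul_mem_right _ _ (Ideal.pow_mem_of_mem _ (hi j γ) _
            (pow_pos (Fact.out : p.Prime).pos _)))
      have h4 := ih w ((hI.mem_or_mem h3).resolve_left fun h => hzI (hI.mem_of_pow_mem _ h))
      intro j γ
      obtain ⟨i', hi', w', hw', hiw'⟩ := Submodule.mem_sup.mp (h4 j γ)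
      obtain ⟨w', rfl⟩ := Ideal.mem_span_singleton.mp hw'
      rw [hw j γ, ← hiw', mul_add, ← add_assoc]
      refine Submodule.mem_sup.mpr ⟨_, add_mem (hi j γ) (Ideal.mul_mem_left _ z hi'), _, ?_, rfl⟩
      rw [Ideal.mem_span_singleton]
      exact ⟨w', by ring⟩
  intro c hc γ
  rw [frobSum_option] at hc
  have := mem_of_forall_mem_sup_span_pow hz fun n => key n _ hc (γ none) (fun i => γ (some i))
  convert this
  exact ((Equiv.piOptionEquivProd (β := fun _ => Fin (p ^ e))).symm_apply_apply γ).symm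

/-- The equivalence moving the first of `r + 1` variables into the second summand. -/
def finSuccSumEquiv (r : ℕ) (κ : Type*) : Fin r ⊕ Option κ ≃ Fin (r + 1) ⊕ κ :=
  (Equiv.sumCongr (Equiv.refl _) ((Equiv.optionEquivSumPUnit.{0} κ).trans (Equiv.sumComm _ _))).trans <|
    (Equiv.sumAssoc _ _ _).symm.trans <|
      Equiv.sumCongr ((Equiv.optionEquivSumPUnit.{0} _).symm.trans (finSuccEquiv r).symm) (Equiv.refl _)

/-- Independence modulo `(x)` lifts: a prime flag `x` and a family that is independent modulo `(x)` are
independent together. -/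
theorem IsFrobIndep.sumElim [IsNoetherianRing R] [IsLocalRing R] {r : ℕ} {x : Fin r → R}
    (hx : IsPrimeFlag r x) (hxm : Ideal.span (Set.range x) ≤ maximalIdeal R) {y : ι → R}
    (hy : IsFrobIndep (p ^ e) (Ideal.span (Set.range x)) y) :
    IsFrobIndep (p ^ e) ⊥ (Sum.elim x y) := by
  induction r generalizing ι with
  | zero =>
    refine IsFrobIndep.of_reindex (Equiv.emptySum (Fin 0) ι).symm ?_
    simp only [Set.range_eq_empty, Ideal.span_empty] at hy
    exact hy
  | succ r ih =>
    rw [span_range_eq_tail_sup] at hy hxm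
    have h1 := hy.option e hx.1.isPrime
      (hxm (Ideal.mem_sup_right (Ideal.mem_span_singleton_self _))) hx.2.1
    have h2 := ih hx.1 (le_sup_left.trans hxm) h1
    refine IsFrobIndep.of_reindex (finSuccSumEquiv r ι) ?_
    convert h2 using 1
    funext o
    rcases o with i | _ | i <;> rfl

lemma exists_frobSum_eq_sum {α : Type*} (y : ι → R) (s : Finset α) (f : α → R)
    (h : ∀ a ∈ s, ∃ c, frobSum (p ^ e) y c = f a) : ∃ c, frobSum (p ^ e) y c = ∑ a ∈ s, f a := by
  induction s using Finset.cons_induction with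
  | empty => exact ⟨0, by simp [frobSum_zero]⟩
  | cons a s ha ih =>
    obtain ⟨c, hc⟩ := h a (by simp)
    obtain ⟨c', hc'⟩ := ih fun b hb => h b (by simp [hb])
    exact ⟨c + c', by rw [frobSum_add, hc, hc', Finset.sum_cons]⟩

lemma frobSum_surjective {y : ι → R}
    (h : Subring.closure (Set.range (fun r : R => r ^ p ^ e) ∪ Set.range y) = ⊤) :
    Function.Surjective (frobSum (p ^ e) y) := by
  intro f
  have hf : f ∈ Subring.closure (Set.range (fun r : R => r ^ p ^ e) ∪ Set.range y) := h ▸ trivial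
  induction hf using Subring.closure_induction with
  | mem f hf =>
    rcases hf with ⟨r, rfl⟩ | ⟨i, rfl⟩
    · obtain ⟨c, hc⟩ := exists_frobSum_eq_pow_mul_prod (p := p) e y 0 r
      exact ⟨c, by simpa using hc⟩
    · obtain ⟨c, hc⟩ := exists_frobSum_eq_pow_mul_prod (p := p) e y (Pi.single i 1) 1
      refine ⟨c, ?_⟩
      rw [hc, one_pow, one_mul, Finset.prod_eq_single i]
      · simp
      · intro j _ hj
        simp [Pi.single_eq_of_ne hj]
      · simp
  | zero => exact ⟨0, frobSum_zero (p := p) e y⟩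
  | one =>
    obtain ⟨c, hc⟩ := exists_frobSum_eq_pow_mul_prod (p := p) e y 0 1
    exact ⟨c, by simpa using hc⟩
  | add f g _ _ hf hg =>
    obtain ⟨c, rfl⟩ := hf
    obtain ⟨c', rfl⟩ := hg
    exact ⟨c + c', frobSum_add e y c c'⟩
  | neg f _ hf =>
    obtain ⟨c, rfl⟩ := hf
    exact ⟨0 - c, by rw [frobSum_sub, frobSum_zero, zero_sub]⟩
  | mul f g _ _ hf hg =>
    obtain ⟨c, rfl⟩ := hf
    obtain ⟨c', rfl⟩ := hg
    rw [frobSum, frobSum, Finset.sum_mul_sum]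
    refine exists_frobSum_eq_sum e y _ _ fun γ _ => exists_frobSum_eq_sum e y _ _ fun γ' _ => ?_
    obtain ⟨d, hd⟩ := exists_frobSum_eq_pow_mul_prod (p := p) e y (fun i => γ i + γ' i) (c γ * c' γ')
    refine ⟨d, hd.trans ?_⟩
    simp only [pow_add, Finset.prod_mul_distrib, mul_pow]
    ring

/-- A `p`-basis also gives a basis over the `p ^ e`-th powers, by writing exponents in base `p`. -/
theorem IsFrobBasis.pow {y : ι → R} (h : IsFrobBasis p y) : IsFrobBasis (p ^ e) y := by
  induction e with
  | zero =>
    have h1 : ∀ c, frobSum (p ^ 0) y c = c (fun _ => ⟨0, by simp⟩) := by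
      intro c
      have : Unique (ι → Fin (p ^ 0)) := inferInstanceAs (Unique (ι → Fin 1))
      rw [frobSum, Fintype.sum_unique, Unique.eq_default (fun _ : ι => (⟨0, by simp⟩ : Fin (p ^ 0)))]
      simp
    refine ⟨fun c c' hc => ?_, fun f => ⟨fun _ => f, h1 _⟩⟩
    rw [h1, h1] at hc
    funext γ
    convert hc using 2 <;> exact funext fun i => Fin.ext (by have := (γ i).2; simpa using this)
  | succ e ih =>
    let σ : (ι → Fin (p ^ e)) × (ι → Fin p) ≃ (ι → Fin (p ^ (e + 1))) :=
      (Equiv.arrowProdEquivProdArrow ι (fun _ => Fin (p ^ e)) (fun _ => Fin p)).symm.trans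
        ((Equiv.refl ι).arrowCongr finProdFinEquiv)
    let T : ((ι → Fin (p ^ (e + 1))) → R) ≃ ((ι → Fin p) → (ι → Fin (p ^ e)) → R) :=
      { toFun := fun c γ' γ => c (σ (γ, γ'))
        invFun := fun d γ => d (σ.symm γ).2 (σ.symm γ).1
        left_inv := fun c => by funext γ; simp
        right_inv := fun d => by funext γ' γ; simp }
    have hcomp : frobSum (p ^ (e + 1)) y =
        frobSum p y ∘ (fun d γ' => frobSum (p ^ e) y (d γ')) ∘ T := by
      funext c
      simp only [Function.comp_apply]
      rw [frobSum, frobSum, ← σ.sum_comp, Fintype.sum_prod_type_right]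
      refine Finset.sum_congr rfl fun γ' _ => ?_
      rw [frobSum, sum_pow_char, Finset.sum_mul]
      refine Finset.sum_congr rfl fun γ _ => ?_
      rw [mul_pow, ← pow_mul, ← pow_succ, mul_assoc, ← Finset.prod_pow, ← Finset.prod_mul_distrib]
      congr 1
      refine Finset.prod_congr rfl fun i _ => ?_
      have : ((σ (γ, γ') i : Fin (p ^ (e + 1))) : ℕ) = γ' i + p * γ i := rfl
      rw [this, ← pow_mul, ← pow_add]
      congr 1
      ring
    rw [IsFrobBasis, hcomp]
    exact h.comp ((Function.Bijective.piMap fun _ => ih).comp T.bijective)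

end FrobSum
end QDiff

namespace QDiff

open IsLocalRing

section FrobBasis

/-! ### Bases of `F`-finite fields -/

/-- If `v` is not in the subfield `F` generated by the `p`-th powers and `y`, then `X ^ p - v ^ p` is
irreducible over `F`, so `1, v, …, v ^ (p - 1)` are linearly independent over `F`. -/
lemma IsFrobIndep.option_of_notMem_closure {k : Type*} [Field k] {p : ℕ} [Fact p.Prime] [CharP k p]
    {ι : Type*} [Fintype ι] [DecidableEq ι] {y : ι → k} (hy : IsFrobIndep p ⊥ y) {v : k}
    (hv : v ∉ Subring.closure (Set.range (fun r : k => r ^ p) ∪ Set.range y)) :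
    IsFrobIndep p ⊥ (fun o : Option ι => o.elim v y) := by
  have hp : p.Prime := Fact.out
  set S := Subring.closure (Set.range (fun r : k => r ^ p) ∪ Set.range y) with hS
  have hpow : ∀ r : k, r ^ p ∈ S := fun r => Subring.subset_closure (Or.inl ⟨r, rfl⟩)
  let F : Subfield k :=
    { S with
      inv_mem' := fun a ha => by
        change a⁻¹ ∈ S
        by_cases h0 : a = 0
        · simp only [h0, inv_zero]; exact zero_mem S
        have : a⁻¹ = a ^ (p - 1) * (a⁻¹) ^ p := by
          obtain ⟨m, rfl⟩ := Nat.exists_eq_succ_of_ne_zero hp.ne_zero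
          simp only [Nat.succ_eq_add_one, Nat.add_sub_cancel]
          rw [pow_succ, ← mul_assoc, ← mul_pow, mul_inv_cancel₀ h0, one_pow, one_mul]
        rw [this]
        exact mul_mem (pow_mem ha _) (hpow _) }
  have hvF : v ∉ F := hv
  have hirr : Irreducible (Polynomial.X ^ p - Polynomial.C (⟨v ^ p, hpow v⟩ : F)) := by
    refine X_pow_sub_C_irreducible_of_prime hp fun b hb => hvF ?_
    have h1 : (b : k) ^ p = v ^ p := congrArg Subtype.val hb
    have : (b : k) = v := frobenius_inj k p h1
    exact this ▸ b.2
  have hmin : minpoly F v = Polynomial.X ^ p - Polynomial.C (⟨v ^ p, hpow v⟩ : F) := by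
    refine (minpoly.eq_of_irreducible_of_monic hirr ?_
      (Polynomial.monic_X_pow_sub_C _ hp.ne_zero)).symm
    simp only [map_sub, map_pow, Polynomial.aeval_X, Polynomial.aeval_C]
    exact sub_self _
  have hli : ∀ n, n = (minpoly F v).natDegree →
      LinearIndependent F (fun i : Fin n => v ^ (i : ℕ)) := by
    rintro _ rfl
    exact linearIndependent_pow v
  have hli := hli p (by rw [hmin, Polynomial.natDegree_X_pow_sub_C])
  rw [Fintype.linearIndependent_iff] at hli
  have hmem : ∀ c, frobSum p y c ∈ F := fun c => by
    refine Subring.sum_mem S fun γ _ => mul_mem (hpow _) (prod_mem fun i _ => pow_mem ?_ _)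
    exact Subring.subset_closure (Or.inr ⟨i, rfl⟩)
  intro c hc γ
  rw [frobSum_option, Ideal.mem_bot] at hc
  have h1 := hli (fun j => ⟨_, hmem (fun γ =>
    c ((Equiv.piOptionEquivProd (β := fun _ => Fin p)).symm (j, γ)))⟩)
    (by rw [← hc]; exact Finset.sum_congr rfl fun j _ => mul_comm _ _) (γ none)
  have h2 := hy _ (by rw [Ideal.mem_bot]; exact congrArg Subtype.val h1) (fun i => γ (some i))
  convert h2
  exact ((Equiv.piOptionEquivProd (β := fun _ => Fin p)).symm_apply_apply γ).symm

lemma exists_isFrobIndep_of_field {k : Type*} [Field k] {p : ℕ} [Fact p.Prime] [CharP k p]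
    (s : Finset k) : ∃ (κ : Type) (_ : Fintype κ) (_ : DecidableEq κ) (y : κ → k),
      IsFrobIndep p ⊥ y ∧
        ∀ g ∈ s, g ∈ Subring.closure (Set.range (fun r : k => r ^ p) ∪ Set.range y) := by
  induction s using Finset.cons_induction with
  | empty =>
    refine ⟨Empty, inferInstance, inferInstance, Empty.elim, fun c hc γ => ?_, by simp⟩
    rw [frobSum, Fintype.sum_unique, Ideal.mem_bot] at hc
    rw [Ideal.mem_bot, Subsingleton.elim γ default]
    rw [Fintype.prod_empty, mul_one] at hc
    convert pow_eq_zero_iff (Fact.out : p.Prime).ne_zero |>.mp hc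
  | cons v s hv ih =>
    obtain ⟨κ, _, _, y, hy, hs⟩ := ih
    by_cases h : v ∈ Subring.closure (Set.range (fun r : k => r ^ p) ∪ Set.range y)
    · exact ⟨κ, _, _, y, hy, by simpa [h] using hs⟩
    · refine ⟨Option κ, inferInstance, inferInstance, _, hy.option_of_notMem_closure h, ?_⟩
      intro g hg
      rcases Finset.mem_cons.mp hg with rfl | hg
      · exact Subring.subset_closure (Or.inr ⟨none, rfl⟩)
      · refine Subring.closure_mono (Set.union_subset_union_right _ ?_) (hs g hg)
        rintro _ ⟨i, rfl⟩
        exact ⟨some i, rfl⟩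

/-- An `F`-finite field has a finite `p`-basis. -/
lemma exists_isFrobIndep_closure_eq_top_of_field {k : Type*} [Field k] {p : ℕ} [Fact p.Prime]
    [CharP k p] (hk : IsFFiniteRing p k) :
    ∃ (κ : Type) (_ : Fintype κ) (_ : DecidableEq κ) (y : κ → k), IsFrobIndep p ⊥ y ∧
      Subring.closure (Set.range (fun r : k => r ^ p) ∪ Set.range y) = ⊤ := by
  obtain ⟨s, hs⟩ := hk
  obtain ⟨κ, _, _, y, hy, hsy⟩ := exists_isFrobIndep_of_field (p := p) s
  refine ⟨κ, _, _, y, hy, ?_⟩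
  rw [eq_top_iff]
  intro f _
  obtain ⟨c, rfl⟩ := hs f
  exact sum_mem fun g hg => mul_mem (Subring.subset_closure (Or.inl ⟨c g, rfl⟩)) (hsy g hg)

/-! ### Bases of `F`-finite regular local rings -/

/-- `F`-finiteness passes to quotients and to localizations: both are generated, up to `p`-th
powers, by the image of the original ring. -/
lemma IsFFiniteRing.of_forall_exists {p : ℕ} [Fact p.Prime] {R S : Type*} [CommRing R] [CommRing S]
    [CharP S p] (φ : R →+* S) (hφ : ∀ b, ∃ (f : R) (d : S), b = d ^ p * φ f)
    (h : IsFFiniteRing p R) : IsFFiniteRing p S := by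
  classical
  obtain ⟨s, hs⟩ := h
  refine ⟨s.image φ, fun b => ?_⟩
  obtain ⟨f, d, rfl⟩ := hφ b
  obtain ⟨c, hc⟩ := hs f
  refine ⟨fun h => ∑ g ∈ s with φ g = h, d * φ (c g), ?_⟩
  rw [hc, map_sum, Finset.mul_sum,
    ← Finset.sum_fiberwise_of_maps_to (g := φ) (fun g hg => Finset.mem_image_of_mem φ hg)]
  refine Finset.sum_congr rfl fun h _ => ?_
  rw [sum_pow_char, Finset.sum_mul]
  refine Finset.sum_congr rfl fun g hg => ?_
  rw [map_mul, map_pow, mul_pow, (Finset.mem_filter.mp hg).2, mul_assoc]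

/-- Nakayama's lemma for subrings along a finite ring homomorphism out of a local ring. -/
lemma subring_eq_top_of_finite {R S : Type*} [CommRing R] [CommRing S] [IsLocalRing R] (φ : R →+* S)
    (hφ : φ.Finite) (S₀ : Subring S) (hS₀ : ∀ r, φ r ∈ S₀)
    (h : ∀ s, ∃ n ∈ S₀, s - n ∈ (maximalIdeal R).map φ) : S₀ = ⊤ := by
  algebraize [φ]
  let N : Submodule R S :=
    { S₀ with
      smul_mem' := fun r s hs => by
        rw [Algebra.smul_def]
        exact mul_mem (hS₀ r) hs }
  have : N = ⊤ := by
    rw [eq_top_iff]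
    refine Submodule.le_of_le_smul_of_le_jacobson_bot (I := maximalIdeal R) Module.Finite.fg_top
      (maximalIdeal_le_jacobson _) fun s _ => ?_
    obtain ⟨n, hn, hs⟩ := h s
    refine Submodule.mem_sup.mpr ⟨n, hn, s - n, ?_, by ring⟩
    rw [Ideal.smul_top_eq_map]
    exact hs
  rw [eq_top_iff]
  intro s _
  exact (this ▸ trivial : s ∈ N)

lemma ringHom_finite_of_forall_exists {R S : Type*} [CommRing R] [CommRing S] (φ : R →+* S)
    (s : Finset S) (hs : ∀ f : S, ∃ c : S → R, f = ∑ g ∈ s, φ (c g) * g) : φ.Finite := by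
  algebraize [φ]
  refine ⟨⟨s, ?_⟩⟩
  rw [eq_top_iff]
  intro f _
  obtain ⟨c, rfl⟩ := hs f
  exact Submodule.sum_mem _ fun g hg => Submodule.smul_mem _ (c g) (Submodule.subset_span hg)

lemma IsFFiniteRing.frobenius_finite {p : ℕ} {R : Type*} [CommRing R] [ExpChar R p]
    (h : IsFFiniteRing p R) : (frobenius R p).Finite := by
  obtain ⟨s, hs⟩ := h
  exact ringHom_finite_of_forall_exists _ s hs

/-- Parameters together with lifts of ring generators of the residue field generate an `F`-finite
local ring over its `p`-th powers. -/
lemma closure_sumElim_eq_top {p : ℕ} [Fact p.Prime] {R : Type*} [CommRing R] [CharP R p]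
    [IsLocalRing R] [IsNoetherianRing R] (hF : IsFFiniteRing p R) {r : ℕ} {x : Fin r → R}
    (hx : Ideal.span (Set.range x) = maximalIdeal R) {κ : Type*} (u : κ → R)
    (hu : Subring.closure (Set.range (fun r : ResidueField R => r ^ p) ∪
      Set.range (fun i => residue R (u i))) = ⊤) :
    Subring.closure (Set.range (fun r : R => r ^ p) ∪ Set.range (Sum.elim x u)) = ⊤ := by
  set S₀ := Subring.closure (Set.range (fun r : R => r ^ p) ∪ Set.range (Sum.elim x u)) with hS₀
  have hpow : ∀ r : R, r ^ p ∈ S₀ := fun r => Subring.subset_closure (Or.inl ⟨r, rfl⟩)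
  have hxS : ∀ i, x i ∈ S₀ := fun i => Subring.subset_closure (Or.inr ⟨Sum.inl i, rfl⟩)
  have h1 : ∀ f, ∃ n ∈ S₀, f - n ∈ maximalIdeal R := by
    intro f
    have hle : Subring.closure (Set.range (fun r : ResidueField R => r ^ p) ∪
        Set.range (fun i => residue R (u i))) ≤ S₀.map (residue R) := by
      rw [Subring.closure_le]
      rintro _ (⟨r, rfl⟩ | ⟨i, rfl⟩)
      · obtain ⟨r, rfl⟩ := residue_surjective r
        exact ⟨r ^ p, hpow r, map_pow _ _ _⟩
      · exact ⟨u i, Subring.subset_closure (Or.inr ⟨Sum.inr i, rfl⟩), rfl⟩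
    obtain ⟨n, hn, hnf⟩ := hle (hu ▸ trivial : residue R f ∈ _)
    refine ⟨n, hn, ?_⟩
    rw [← residue_eq_zero_iff, map_sub, hnf, sub_self]
  have h2 : ∀ L : ℕ, ∀ f, ∃ n ∈ S₀, f - n ∈ maximalIdeal R ^ L := by
    intro L
    induction L with
    | zero => exact fun f => ⟨0, zero_mem _, by simp⟩
    | succ L ih =>
      intro f
      obtain ⟨n, hn, hf⟩ := ih f
      rw [← hx, Ideal.mem_span_pow_iff_exists_isHomogeneous] at hf
      obtain ⟨G, hG, hGe⟩ := hf
      choose a ha ha' using fun m => h1 (G.coeff m)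
      refine ⟨n + ∑ m ∈ G.support, a m * ∏ i, x i ^ m i, add_mem hn (sum_mem fun m _ =>
        mul_mem (ha m) (prod_mem fun i _ => pow_mem (hxS i) _)), ?_⟩
      rw [← sub_sub, ← hGe, MvPolynomial.eval_eq', ← Finset.sum_sub_distrib]
      refine Submodule.sum_mem _ fun m hm => ?_
      rw [← sub_mul, pow_succ']
      refine Ideal.mul_mem_mul (ha' m) ?_
      have hdeg : ∑ i, m i = L := by
        have := hG (MvPolynomial.mem_support_iff.mp hm)
        rw [← this, Finsupp.weight_apply, Finsupp.sum_fintype _ _ (by simp)]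
        simp
      rw [← hdeg, ← Finset.prod_pow_eq_pow_sum]
      exact Ideal.prod_mem_prod fun i _ =>
        Ideal.pow_mem_pow (hx ▸ Ideal.subset_span (Set.mem_range_self i)) _
  refine subring_eq_top_of_finite (frobenius R p) hF.frobenius_finite S₀ hpow fun f => ?_
  obtain ⟨L, hL⟩ := Ideal.exists_pow_le_of_le_radical_of_fg
    (I := maximalIdeal R) (J := (maximalIdeal R).map (frobenius R p)) (fun z hz =>
      ⟨p, Ideal.mem_map_of_mem (frobenius R p) hz⟩) (maximalIdeal R).fg_of_isNoetherianRing
  obtain ⟨n, hn, hf⟩ := h2 L f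
  exact ⟨n, hn, hL hf⟩

/-- A regular local `F`-finite ring has a `p`-basis (hence a basis over its `p ^ e`-th powers)
that extends a regular system of parameters forming a prime flag. -/
theorem exists_isFrobBasis {p : ℕ} [Fact p.Prime] {R : Type*} [CommRing R] [CharP R p]
    [IsRegularLocalRing R] (hF : IsFFiniteRing p R) (e : ℕ) :
    ∃ (d : ℕ) (x : Fin d → R) (κ : Type) (_ : Fintype κ) (_ : DecidableEq κ) (u : κ → R),
      IsPrimeFlag d x ∧ Ideal.span (Set.range x) = maximalIdeal R ∧
        IsFrobBasis (p ^ e) (Sum.elim x u) := by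
  have : IsRegularLocalRing (R ⧸ maximalIdeal R) :=
    inferInstanceAs (IsRegularLocalRing (ResidueField R))
  obtain ⟨d, x, hx, hxm⟩ := exists_isPrimeFlag_span_eq (maximalIdeal R)
  have : CharP (ResidueField R) p := (CharP.charP_iff_prime_eq_zero Fact.out).mpr (by
    rw [← map_natCast (residue R), CharP.cast_eq_zero, map_zero])
  obtain ⟨κ, _, _, ubar, hind, hcl⟩ := exists_isFrobIndep_closure_eq_top_of_field
    (hF.of_forall_exists (residue R) fun b =>
      ⟨_, 1, by rw [one_pow, one_mul]; exact (residue_surjective b).choose_spec.symm⟩)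
  choose u hu using fun i => residue_surjective (R := R) (ubar i)
  refine ⟨d, x, κ, _, _, u, hx, hxm, IsFrobBasis.pow e ⟨?_, ?_⟩⟩
  · have h1 : IsFrobIndep (p ^ 1) (Ideal.span (Set.range x)) u := by
      rw [hxm, pow_one]
      intro c hc γ
      rw [← residue_eq_zero_iff] at hc ⊢
      refine hind (fun γ => residue R (c γ)) ?_ γ
      rw [Ideal.mem_bot, ← hc]
      simp only [frobSum, map_sum, map_mul, map_pow, map_prod, hu]
    have := (h1.sumElim 1 hx hxm.le).injective
    rwa [pow_one] at this
  · have h1 := closure_sumElim_eq_top hF hxm u (by simpa only [hu] using hcl)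
    have := frobSum_surjective (p := p) (y := Sum.elim x u) 1 (by rwa [pow_one])
    rwa [pow_one] at this

end FrobBasis
end QDiff

namespace QDiff

/-! ### Differential operators -/

section LeftExtension

variable {R : Type*} [CommRing R]

lemma leftExtension_tmul (D : R →ₗ[ℤ] R) (a b : R) : leftExtension D (a ⊗ₜ b) = a * D b := by
  simp [leftExtension]

lemma leftExtension_tmul_one_mul (D : R →ₗ[ℤ] R) (a : R) (t : R ⊗[ℤ] R) :
    leftExtension D (a ⊗ₜ 1 * t) = a * leftExtension D t := by
  induction t with
  | zero => simp
  | tmul b c => simp [leftExtension_tmul, mul_assoc]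
  | add t t' h h' => simp only [mul_add, map_add, h, h']

lemma one_tmul_sub_tmul_one_mem (r : R) :
    (1 : R) ⊗ₜ[ℤ] r - r ⊗ₜ[ℤ] (1 : R) ∈ KaehlerDifferential.ideal ℤ R :=
  KaehlerDifferential.one_smul_sub_smul_one_mem_ideal ℤ r

lemma IsDiffOp.mono {i j : ℕ} (hij : i ≤ j) {D : R →ₗ[ℤ] R} (h : IsDiffOp i D) : IsDiffOp j D :=
  fun t ht => h t (Ideal.pow_le_pow_right (by omega) ht)

lemma leftExtension_mul_one_tmul_sub_tmul_one (D : R →ₗ[ℤ] R) (t : R ⊗[ℤ] R) (r : R) :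
    leftExtension D (t * (1 ⊗ₜ r - r ⊗ₜ 1)) =
      leftExtension (D ∘ₗ LinearMap.mulLeft ℤ r - LinearMap.mulLeft ℤ r ∘ₗ D) t := by
  induction t with
  | zero => simp
  | tmul b c =>
    rw [mul_sub, map_sub, Algebra.TensorProduct.tmul_mul_tmul, Algebra.TensorProduct.tmul_mul_tmul]
    simp only [leftExtension_tmul, LinearMap.sub_apply, LinearMap.comp_apply,
      LinearMap.mulLeft_apply, mul_one]
    rw [mul_comm c r]
    ring
  | add t t' h h' => simp only [add_mul, map_add, h, h']

variable {B : Type*} [CommRing B] [Algebra R B]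

/-- The left linear extension `R ⊗ R → B`, `r₁ ⊗ r₂ ↦ r₁ D(r₂)` of an additive map from `R` to an
`R`-algebra `B`. -/
noncomputable def leftExtensionTo (D : R →ₗ[ℤ] B) : R ⊗[ℤ] R →ₗ[ℤ] B :=
  LinearMap.mul' ℤ B ∘ₗ TensorProduct.map (algebraMap R B).toIntAlgHom.toLinearMap D

lemma leftExtensionTo_tmul (D : R →ₗ[ℤ] B) (a b : R) :
    leftExtensionTo D (a ⊗ₜ b) = algebraMap R B a * D b := rfl

lemma leftExtensionTo_tmul_one_mul (D : R →ₗ[ℤ] B) (a : R) (t : R ⊗[ℤ] R) :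
    leftExtensionTo D (a ⊗ₜ 1 * t) = algebraMap R B a * leftExtensionTo D t := by
  induction t with
  | zero => simp
  | tmul b c => simp [leftExtensionTo_tmul, mul_assoc]
  | add t t' h h' => simp only [mul_add, map_add, h, h']

/-- A differential operator `E` of `B` restricts along `R → B`, after multiplication by `g`, to a map
`f ↦ E (g f)` whose left extension kills the same power of the diagonal ideal of `R`. -/
lemma leftExtensionTo_comp_mulLeft_eq_zero {j : ℕ} {E : B →ₗ[ℤ] B} (hE : IsDiffOp j E) (g : B)
    {t : R ⊗[ℤ] R} (ht : t ∈ KaehlerDifferential.ideal ℤ R ^ (j + 1)) :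
    leftExtensionTo (E ∘ₗ LinearMap.mulLeft ℤ g ∘ₗ (algebraMap R B).toIntAlgHom.toLinearMap) t = 0 := by
  set φ : R ⊗[ℤ] R →ₐ[ℤ] B ⊗[ℤ] B :=
    Algebra.TensorProduct.map (algebraMap R B).toIntAlgHom (algebraMap R B).toIntAlgHom with hφ
  have h1 : ∀ t : R ⊗[ℤ] R,
      leftExtensionTo (E ∘ₗ LinearMap.mulLeft ℤ g ∘ₗ (algebraMap R B).toIntAlgHom.toLinearMap) t =
        leftExtension E (1 ⊗ₜ g * φ t) := by
    intro t
    induction t with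
    | zero => simp
    | tmul b c => simp [leftExtensionTo_tmul, leftExtension_tmul, hφ]
    | add t t' h h' => simp only [mul_add, map_add, h, h']
  have h2 : KaehlerDifferential.ideal ℤ R ≤ (KaehlerDifferential.ideal ℤ B).comap φ := by
    rw [← KaehlerDifferential.span_range_eq_ideal, Ideal.span_le]
    rintro _ ⟨r, rfl⟩
    have : φ (1 ⊗ₜ r - r ⊗ₜ 1) = 1 ⊗ₜ algebraMap R B r - algebraMap R B r ⊗ₜ 1 := by
      simp [hφ, map_sub]
    have hmem := one_tmul_sub_tmul_one_mem (algebraMap R B r)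
    rw [← this] at hmem
    exact hmem
  rw [h1]
  refine hE _ (Ideal.mul_mem_left _ _ ?_)
  exact Ideal.le_comap_pow φ _ (Ideal.pow_right_mono h2 _ ht)

/-- Differential operators of order less than `q` are linear over `q`-th powers, since
`1 ⊗ a ^ q - a ^ q ⊗ 1 = (1 ⊗ a - a ⊗ 1) ^ q`. -/
lemma IsDiffOp.map_pow_mul {p : ℕ} [Fact p.Prime] [CharP B p] {e j : ℕ} (hj : j < p ^ e)
    {E : B →ₗ[ℤ] B} (hE : IsDiffOp j E) (a f : B) : E (a ^ p ^ e * f) = a ^ p ^ e * E f := by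
  have : Nontrivial B := CharP.nontrivial_of_char_ne_one (v := p) (Fact.out : p.Prime).ne_one
  have : Nontrivial (B ⊗[ℤ] B) := (Algebra.TensorProduct.lmul' ℤ (S := B)).toRingHom.domain_nontrivial
  have : CharP (B ⊗[ℤ] B) p := (CharP.charP_iff_prime_eq_zero Fact.out).mpr (by
    rw [← map_natCast (Algebra.TensorProduct.includeLeft : B →ₐ[ℤ] B ⊗[ℤ] B), CharP.cast_eq_zero,
      map_zero])
  have h := hE (1 ⊗ₜ f * (1 ⊗ₜ (a ^ p ^ e) - (a ^ p ^ e) ⊗ₜ 1)) (by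
    refine Ideal.mul_mem_left _ _ ?_
    have h1 : (1 : B) ⊗ₜ[ℤ] (a ^ p ^ e) - (a ^ p ^ e) ⊗ₜ[ℤ] (1 : B) =
        (1 ⊗ₜ a - a ⊗ₜ 1) ^ p ^ e := by
      rw [sub_pow_char_pow, Algebra.TensorProduct.tmul_pow, Algebra.TensorProduct.tmul_pow, one_pow]
    rw [h1]
    exact Ideal.pow_le_pow_right hj (Ideal.pow_mem_pow (one_tmul_sub_tmul_one_mem a) _))
  rw [leftExtension_mul_one_tmul_sub_tmul_one, leftExtension_tmul, one_mul] at h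
  exact sub_eq_zero.mp h

end LeftExtension

section Hasse

variable {R : Type*} [CommRing R] {ι : Type*} [Fintype ι] [DecidableEq ι]

/-- The product of the divided-power derivatives `(γ i choose β i) y i ^ (γ i - β i)` of the
powers `y i ^ γ i`. -/
def monomialDeriv (y : ι → R) (β γ : ι → ℕ) : R :=
  ∏ i, (((γ i).choose (β i) : ℕ) : R) * y i ^ (γ i - β i)

/-- Taylor's formula for a monomial: expand `1 ⊗ y i = y i ⊗ 1 + (1 ⊗ y i - y i ⊗ 1)`. -/
lemma one_tmul_prod_pow (y : ι → R) (γ : ι → ℕ) (N : ι → ℕ) (hN : ∀ i, γ i < N i) :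
    (1 : R) ⊗ₜ[ℤ] (∏ i, y i ^ γ i) = ∑ β ∈ Fintype.piFinset (fun i => Finset.range (N i)),
      monomialDeriv y β γ ⊗ₜ[ℤ] (1 : R) * ∏ i, (1 ⊗ₜ y i - y i ⊗ₜ 1) ^ β i := by
  have h1 : ∀ i, (1 : R) ⊗ₜ[ℤ] (y i ^ γ i) = ∑ b ∈ Finset.range (N i),
      ((((γ i).choose b : ℕ) : R) * y i ^ (γ i - b)) ⊗ₜ[ℤ] (1 : R) *
        (1 ⊗ₜ y i - y i ⊗ₜ 1) ^ b := by
    intro i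
    have h2 : (1 : R) ⊗ₜ[ℤ] (y i ^ γ i) = ((1 ⊗ₜ y i - y i ⊗ₜ 1) + y i ⊗ₜ 1) ^ γ i := by
      rw [sub_add_cancel, Algebra.TensorProduct.tmul_pow, one_pow]
    rw [h2, add_pow]
    refine Finset.sum_subset_zero_on_sdiff (Finset.range_mono (hN i)) ?_ ?_
    · intro b hb
      have : (γ i).choose b = 0 := Nat.choose_eq_zero_of_lt (by simpa using (Finset.mem_sdiff.mp hb).2)
      simp [this]
    · intro b _
      have h3 : ((((γ i).choose b : ℕ) : R) * y i ^ (γ i - b)) ⊗ₜ[ℤ] (1 : R) =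
          (((γ i).choose b : ℕ) : R ⊗[ℤ] R) * (y i ⊗ₜ[ℤ] (1 : R)) ^ (γ i - b) := by
        rw [Algebra.TensorProduct.tmul_pow, one_pow,
          ← map_natCast (Algebra.TensorProduct.includeLeft : R →ₐ[ℤ] R ⊗[ℤ] R),
          Algebra.TensorProduct.includeLeft_apply, Algebra.TensorProduct.tmul_mul_tmul, one_mul]
      rw [h3]
      ring
  have h4 : (1 : R) ⊗ₜ[ℤ] (∏ i, y i ^ γ i) = ∏ i, (1 : R) ⊗ₜ[ℤ] (y i ^ γ i) :=
    map_prod (Algebra.TensorProduct.includeRight : R →ₐ[ℤ] R ⊗[ℤ] R) _ _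
  rw [h4, Finset.prod_congr rfl fun i _ => h1 i, Finset.prod_univ_sum]
  refine Finset.sum_congr rfl fun β _ => ?_
  rw [Finset.prod_mul_distrib]
  congr 1
  exact (map_prod (Algebra.TensorProduct.includeLeft : R →ₐ[ℤ] R ⊗[ℤ] R) _ _).symm

/-- The coefficients of an element in a Frobenius basis (without the `q`-th power). -/
noncomputable def IsFrobBasis.coord {q : ℕ} {y : ι → R} (h : IsFrobBasis q y) (f : R) : (ι → Fin q) → R :=
  (Equiv.ofBijective _ h).symm f

lemma IsFrobBasis.frobSum_coord {q : ℕ} {y : ι → R} (h : IsFrobBasis q y) (f : R) :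
    frobSum q y (h.coord f) = f :=
  (Equiv.ofBijective _ h).apply_symm_apply f

lemma IsFrobBasis.coord_frobSum {q : ℕ} {y : ι → R} (h : IsFrobBasis q y) (c) :
    h.coord (frobSum q y c) = c :=
  (Equiv.ofBijective _ h).symm_apply_apply c

/-- Two maps that are linear over `q`-th powers agree if they agree on the monomials in a
Frobenius basis. -/
lemma IsFrobBasis.ext_of_prod_pow {B : Type*} [CommRing B] (φ : R →+* B)
    {q : ℕ} {y : ι → R}
    (h : IsFrobBasis q y) {D D' : R →+ B}
    (hD : ∀ a f, D (a ^ q * f) = φ a ^ q * D f)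
    (hD' : ∀ a f, D' (a ^ q * f) = φ a ^ q * D' f)
    (hy : ∀ γ : ι → Fin q, D (∏ i, y i ^ (γ i : ℕ)) = D' (∏ i, y i ^ (γ i : ℕ))) : D = D' := by
  ext f
  rw [← h.frobSum_coord f, frobSum, map_sum, map_sum]
  exact Finset.sum_congr rfl fun γ _ => by rw [hD, hD', hy]

variable {p : ℕ} [hp : Fact p.Prime] [CharP R p] {e : ℕ} {y : ι → R}

/-- The Hasse derivative of multi-index `β` with respect to a Frobenius basis `y`: it is linear over
the `q`-th powers and takes `y ^ γ` to `(γ choose β) y ^ (γ - β)`. -/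
noncomputable def IsFrobBasis.hasse (h : IsFrobBasis (p ^ e) y) (β : ι → ℕ) : R →ₗ[ℤ] R :=
  AddMonoidHom.toIntLinearMap
    { toFun := fun f => ∑ γ, h.coord f γ ^ p ^ e * monomialDeriv y β (fun i => γ i)
      map_zero' := by
        have h0 : h.coord 0 = 0 := by
          rw [← h.coord_frobSum 0, frobSum_zero]
        have : p ^ e ≠ 0 := pow_ne_zero _ hp.out.ne_zero
        simp [h0, zero_pow this]
      map_add' := fun f g => by
        have h0 : h.coord (f + g) = h.coord f + h.coord g := by
          rw [← h.coord_frobSum (h.coord f + h.coord g), frobSum_add, h.frobSum_coord,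
            h.frobSum_coord]
        simp only [h0, Pi.add_apply, add_pow_char_pow, add_mul, Finset.sum_add_distrib] }

lemma IsFrobBasis.hasse_apply (h : IsFrobBasis (p ^ e) y) (β : ι → ℕ) (f : R) :
    h.hasse β f = ∑ γ, h.coord f γ ^ p ^ e * monomialDeriv y β (fun i => γ i) := rfl

lemma IsFrobBasis.hasse_pow_mul (h : IsFrobBasis (p ^ e) y) (β : ι → ℕ) (a f : R) :
    h.hasse β (a ^ p ^ e * f) = a ^ p ^ e * h.hasse β f := by
  have h0 : h.coord (a ^ p ^ e * f) = fun γ => a * h.coord f γ := by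
    rw [← h.coord_frobSum (fun γ => a * h.coord f γ), frobSum_mul, h.frobSum_coord]
  simp only [h.hasse_apply, h0, mul_pow, Finset.mul_sum, mul_assoc]

/-- Binomial coefficients modulo `p` are periodic of period `p ^ e` in the upper entry, as long as
the lower entry is less than `p ^ e`. -/
lemma cast_choose_add_mul {b : ℕ} (hb : b < p ^ e) (n m : ℕ) :
    (((n + p ^ e * m).choose b : ℕ) : R) = ((n.choose b : ℕ) : R) := by
  induction m with
  | zero => simp
  | succ m ih =>
    rw [← ih, mul_add, mul_one, ← add_assoc, Nat.add_choose_eq, Nat.cast_sum,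
      Finset.sum_eq_single (b, 0)]
    · simp
    · rintro ⟨i, j⟩ hij hne
      rw [Finset.HasAntidiagonal.mem_antidiagonal] at hij
      have hj : j ≠ 0 := by rintro rfl; exact hne (by simpa using hij)
      have : p ∣ (p ^ e).choose j := hp.out.dvd_choose_pow hj (by simp at hij; omega)
      simp only
      rw [Nat.cast_mul, (CharP.cast_eq_zero_iff R p _).mpr this, mul_zero]
    · simp

lemma monomialDeriv_eq_mul_pow {β : ι → ℕ} (hβ : ∀ i, β i < p ^ e) (γ : ι → ℕ) :
    monomialDeriv y β γ = (∏ i, y i ^ (γ i / p ^ e)) ^ p ^ e *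
      monomialDeriv y β (fun i => γ i % p ^ e) := by
  rw [monomialDeriv, monomialDeriv, ← Finset.prod_pow, ← Finset.prod_mul_distrib]
  refine Finset.prod_congr rfl fun i _ => ?_
  have h1 := cast_choose_add_mul (R := R) (hβ i) (γ i % p ^ e) (γ i / p ^ e)
  rw [Nat.mod_add_div] at h1
  rw [h1]
  rcases lt_or_ge (γ i % p ^ e) (β i) with h | h
  · simp [Nat.choose_eq_zero_of_lt h]
  · have : γ i - β i = γ i / p ^ e * p ^ e + (γ i % p ^ e - β i) := by
      have := Nat.div_add_mod' (γ i) (p ^ e)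
      omega
    rw [this, pow_add, pow_mul]
    ring

lemma IsFrobBasis.hasse_prod_pow (h : IsFrobBasis (p ^ e) y) {β : ι → ℕ} (hβ : ∀ i, β i < p ^ e)
    (γ : ι → ℕ) : h.hasse β (∏ i, y i ^ γ i) = monomialDeriv y β γ := by
  have hpos : 0 < p ^ e := pow_pos hp.out.pos _
  have h1 : ∀ γ : ι → Fin (p ^ e), h.hasse β (∏ i, y i ^ (γ i : ℕ)) =
      monomialDeriv y β (fun i => γ i) := by
    intro γ
    have h2 : h.coord (∏ i, y i ^ (γ i : ℕ)) = Pi.single γ 1 := by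
      rw [← h.coord_frobSum (Pi.single γ 1), frobSum_single, one_pow, one_mul]
    rw [h.hasse_apply, h2, Finset.sum_eq_single γ]
    · simp
    · intro b _ hb
      simp [Pi.single_eq_of_ne hb, zero_pow hpos.ne']
    · simp
  have h3 : ∏ i, y i ^ γ i = (∏ i, y i ^ (γ i / p ^ e)) ^ p ^ e *
      ∏ i, y i ^ ((⟨γ i % p ^ e, Nat.mod_lt _ hpos⟩ : Fin (p ^ e)) : ℕ) := by
    rw [← Finset.prod_pow, ← Finset.prod_mul_distrib]
    refine Finset.prod_congr rfl fun i _ => ?_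
    rw [← pow_mul, ← pow_add, Nat.div_add_mod']
  rw [h3, h.hasse_pow_mul, h1, monomialDeriv_eq_mul_pow hβ γ]

lemma IsFrobBasis.hasse_zero (h : IsFrobBasis (p ^ e) y) (f : R) : h.hasse 0 f = f := by
  have hpos : 0 < p ^ e := pow_pos hp.out.pos _
  have := h.ext_of_prod_pow (RingHom.id R) (D := (h.hasse 0).toAddMonoidHom)
    (D' := AddMonoidHom.id R) (fun a f => h.hasse_pow_mul 0 a f) (fun _ _ => rfl) (fun γ => by
      change h.hasse 0 _ = _
      rw [h.hasse_prod_pow (β := 0) (fun _ => hpos)]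
      simp [monomialDeriv])
  exact DFunLike.congr_fun this f

/-- The commutator of a Hasse derivative with multiplication by `y i` lowers the `i`-th index by
one (Pascal's rule). -/
lemma IsFrobBasis.hasse_mul_sub (h : IsFrobBasis (p ^ e) y) {β : ι → ℕ} (hβ : ∀ i, β i < p ^ e)
    (i : ι) (f : R) : h.hasse β (y i * f) - y i * h.hasse β f =
      if β i = 0 then 0 else h.hasse (Function.update β i (β i - 1)) f := by
  have hβ' : ∀ j, Function.update β i (β i - 1) j < p ^ e := by
    intro j
    rcases eq_or_ne j i with rfl | hj
    · rw [Function.update_self]; have := hβ j; omega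
    · rw [Function.update_of_ne hj]; exact hβ j
  have := h.ext_of_prod_pow (RingHom.id R)
    (D := (h.hasse β ∘ₗ LinearMap.mulLeft ℤ (y i) -
      LinearMap.mulLeft ℤ (y i) ∘ₗ h.hasse β).toAddMonoidHom)
    (D' := (if β i = 0 then 0 else h.hasse (Function.update β i (β i - 1))).toAddMonoidHom)
    (fun a f => by
      change h.hasse β (y i * (a ^ p ^ e * f)) - y i * h.hasse β (a ^ p ^ e * f) =
        a ^ p ^ e * (h.hasse β (y i * f) - y i * h.hasse β f)
      rw [mul_left_comm, h.hasse_pow_mul, h.hasse_pow_mul]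
      ring)
    (fun a f => by
      split_ifs
      · simp
      · exact h.hasse_pow_mul _ a f)
    (fun γ => by
      change h.hasse β (y i * _) - y i * h.hasse β _ =
        (if β i = 0 then 0 else h.hasse (Function.update β i (β i - 1))) _
      have h1 : y i * ∏ j, y j ^ (γ j : ℕ) =
          ∏ j, y j ^ (Function.update (fun j => (γ j : ℕ)) i (γ i + 1) j) := by
        rw [← Finset.mul_prod_erase _ _ (Finset.mem_univ i), ← mul_assoc, ← pow_succ',
          ← Finset.mul_prod_erase _ (fun j => y j ^ (Function.update (fun j => (γ j : ℕ)) i (γ i + 1) j))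
            (Finset.mem_univ i), Function.update_self]
        congr 1
        exact Finset.prod_congr rfl fun j hj => by
          rw [Function.update_of_ne (Finset.ne_of_mem_erase hj)]
      have h2 : ∀ β γ : ι → ℕ, monomialDeriv y β γ =
          ((((γ i).choose (β i) : ℕ) : R) * y i ^ (γ i - β i)) *
            ∏ j ∈ Finset.univ.erase i, (((γ j).choose (β j) : ℕ) : R) * y j ^ (γ j - β j) :=
        fun β γ => (Finset.mul_prod_erase _ _ (Finset.mem_univ i)).symm
      have h3 : ∀ (β γ β' γ' : ι → ℕ), (∀ j ≠ i, β j = β' j) → (∀ j ≠ i, γ j = γ' j) →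
          ∏ j ∈ Finset.univ.erase i, (((γ j).choose (β j) : ℕ) : R) * y j ^ (γ j - β j) =
            ∏ j ∈ Finset.univ.erase i, (((γ' j).choose (β' j) : ℕ) : R) * y j ^ (γ' j - β' j) :=
        fun β γ β' γ' hb hc => Finset.prod_congr rfl fun j hj => by
          rw [hb j (Finset.ne_of_mem_erase hj), hc j (Finset.ne_of_mem_erase hj)]
      rw [h1, h.hasse_prod_pow hβ, h.hasse_prod_pow hβ, h2 β, h2 β,
        h3 β (Function.update (fun j => (γ j : ℕ)) i (γ i + 1)) β (fun j => γ j) (fun _ _ => rfl)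
          (fun j hj => Function.update_of_ne hj _ _), Function.update_self]
      split_ifs with h0
      · simp only [h0, Nat.choose_zero_right, LinearMap.zero_apply]
        simp only [Nat.sub_zero, pow_succ]
        ring
      · rw [h.hasse_prod_pow hβ', h2 (Function.update β i (β i - 1)),
          h3 (Function.update β i (β i - 1)) _ β (fun j => γ j)
            (fun j hj => Function.update_of_ne hj _ _) (fun _ _ => rfl), Function.update_self]
        rw [← mul_assoc, ← sub_mul]
        congr 1
        obtain ⟨b, hb⟩ := Nat.exists_eq_succ_of_ne_zero h0
        rw [hb, Nat.succ_eq_add_one, Nat.add_sub_cancel, Nat.choose_succ_succ, Nat.cast_add,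
          Nat.add_sub_add_right]
        rcases lt_or_ge (γ i : ℕ) (b + 1) with hlt | hge
        · simp [Nat.choose_eq_zero_of_lt hlt]
        · have : (γ i : ℕ) - b = (γ i - (b + 1)) + 1 := by omega
          rw [this, pow_succ]
          ring)
  have := DFunLike.congr_fun this f
  change h.hasse β (y i * f) - y i * h.hasse β f =
    (if β i = 0 then 0 else h.hasse (Function.update β i (β i - 1))) f at this
  rw [this]
  split_ifs <;> rfl

end Hasse
end QDiff

namespace QDiff

open IsLocalRing

/-! ### Hasse derivatives as differential operators -/

section HasseOrder

variable {R : Type*} [CommRing R] {ι : Type*} [Fintype ι] [DecidableEq ι]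
  {p : ℕ} [hp : Fact p.Prime] [CharP R p] {e : ℕ} {y : ι → R}

lemma leftExtension_zero (t : R ⊗[ℤ] R) : leftExtension (0 : R →ₗ[ℤ] R) t = 0 := by
  induction t with
  | zero => simp
  | tmul b c => simp [leftExtension_tmul]
  | add t t' h h' => simp only [map_add, h, h', add_zero]

lemma IsFrobBasis.leftExtension_hasse_mul (h : IsFrobBasis (p ^ e) y) {β : ι → ℕ}
    (hβ : ∀ i, β i < p ^ e) (i : ι) (t : R ⊗[ℤ] R) :
    leftExtension (h.hasse β) (t * (1 ⊗ₜ y i - y i ⊗ₜ 1)) =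
      if β i = 0 then 0 else leftExtension (h.hasse (Function.update β i (β i - 1))) t := by
  rw [leftExtension_mul_one_tmul_sub_tmul_one]
  have : h.hasse β ∘ₗ LinearMap.mulLeft ℤ (y i) - LinearMap.mulLeft ℤ (y i) ∘ₗ h.hasse β =
      if β i = 0 then 0 else h.hasse (Function.update β i (β i - 1)) := by
    ext f
    have h1 := h.hasse_mul_sub hβ i f
    split_ifs with h0
    · simpa [h0] using h1
    · simpa [h0] using h1
  rw [this]
  split_ifs
  · exact leftExtension_zero t
  · rfl

/-- The Hasse derivative of multi-index `β` has order at most `|β|`. The diagonal ideal is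
generated by the elements `1 ⊗ r - r ⊗ 1` with `r` a `q`-th power or an element of the basis; the
Hasse derivative commutes with the former, and commuting it with the latter lowers `|β|`. -/
theorem IsFrobBasis.isDiffOp_hasse (h : IsFrobBasis (p ^ e) y) {β : ι → ℕ}
    (hβ : ∀ i, β i < p ^ e) : IsDiffOp (∑ i, β i) (h.hasse β) := by
  have key : ∀ n, ∀ β : ι → ℕ, (∀ i, β i < p ^ e) → ∑ i, β i < n →
      ∀ t ∈ KaehlerDifferential.ideal ℤ R ^ n, leftExtension (h.hasse β) t = 0 := by
    intro n
    induction n with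
    | zero => simp
    | succ n ih =>
      intro β hβ hn t ht
      have hr : ∀ r : R, ∀ t ∈ KaehlerDifferential.ideal ℤ R ^ n,
          leftExtension (h.hasse β) (t * (1 ⊗ₜ r - r ⊗ₜ 1)) = 0 := by
        have hmul : ∀ r s : R, (∀ t ∈ KaehlerDifferential.ideal ℤ R ^ n,
              leftExtension (h.hasse β) (t * (1 ⊗ₜ r - r ⊗ₜ 1)) = 0) →
            (∀ t ∈ KaehlerDifferential.ideal ℤ R ^ n,
              leftExtension (h.hasse β) (t * (1 ⊗ₜ s - s ⊗ₜ 1)) = 0) →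
            ∀ t ∈ KaehlerDifferential.ideal ℤ R ^ n,
              leftExtension (h.hasse β) (t * (1 ⊗ₜ (r * s) - (r * s) ⊗ₜ 1)) = 0 := by
          intro r s hr hs t ht
          have h1 : t * ((1 : R) ⊗ₜ[ℤ] (r * s) - (r * s) ⊗ₜ[ℤ] (1 : R)) =
              (1 ⊗ₜ s * t) * (1 ⊗ₜ r - r ⊗ₜ 1) + (r ⊗ₜ 1 * t) * (1 ⊗ₜ s - s ⊗ₜ 1) := by
            have h2 : (1 : R) ⊗ₜ[ℤ] (r * s) = 1 ⊗ₜ r * 1 ⊗ₜ s := by simp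
            have h3 : (r * s) ⊗ₜ[ℤ] (1 : R) = r ⊗ₜ 1 * s ⊗ₜ 1 := by simp
            rw [h2, h3]
            ring
          rw [h1, map_add, hr _ (Ideal.mul_mem_left _ _ ht), hs _ (Ideal.mul_mem_left _ _ ht),
            add_zero]
        intro r
        rw [← h.frobSum_coord r, frobSum]
        refine Finset.sum_induction _ (fun r => ∀ t ∈ KaehlerDifferential.ideal ℤ R ^ n,
          leftExtension (h.hasse β) (t * (1 ⊗ₜ r - r ⊗ₜ 1)) = 0) ?_ ?_ ?_
        · intro r s hr hs t ht
          have h1 : t * ((1 : R) ⊗ₜ[ℤ] (r + s) - (r + s) ⊗ₜ[ℤ] (1 : R)) =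
              t * (1 ⊗ₜ r - r ⊗ₜ 1) + t * (1 ⊗ₜ s - s ⊗ₜ 1) := by
            rw [TensorProduct.tmul_add, TensorProduct.add_tmul]
            ring
          rw [h1, map_add, hr t ht, hs t ht, add_zero]
        · intro t _
          simp
        · intro γ _
          refine hmul _ _ ?_ ?_
          · intro t _
            rw [leftExtension_mul_one_tmul_sub_tmul_one]
            have : h.hasse β ∘ₗ LinearMap.mulLeft ℤ (h.coord r γ ^ p ^ e) -
                LinearMap.mulLeft ℤ (h.coord r γ ^ p ^ e) ∘ₗ h.hasse β = 0 := by
              ext f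
              exact sub_eq_zero.mpr (h.hasse_pow_mul β _ f)
            rw [this, leftExtension_zero]
          · refine Finset.prod_induction _ (fun r => ∀ t ∈ KaehlerDifferential.ideal ℤ R ^ n,
              leftExtension (h.hasse β) (t * (1 ⊗ₜ r - r ⊗ₜ 1)) = 0) hmul (by simp) ?_
            intro i _
            have hpow : ∀ m : ℕ, ∀ t ∈ KaehlerDifferential.ideal ℤ R ^ n,
                leftExtension (h.hasse β) (t * (1 ⊗ₜ (y i ^ m) - (y i ^ m) ⊗ₜ 1)) = 0 := by
              intro m
              induction m with
              | zero => simp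
              | succ m ihm =>
                rw [pow_succ]
                refine hmul _ _ ihm ?_
                intro t ht
                rw [h.leftExtension_hasse_mul hβ]
                split_ifs with h0
                · rfl
                · refine ih _ ?_ ?_ t ht
                  · intro j
                    rcases eq_or_ne j i with rfl | hj
                    · rw [Function.update_self]; have := hβ j; omega
                    · rw [Function.update_of_ne hj]; exact hβ j
                  · rw [Finset.sum_update_of_mem (Finset.mem_univ i)]
                    have := Finset.add_sum_erase Finset.univ β (Finset.mem_univ i)
                    rw [← Finset.sdiff_singleton_eq_erase] at this
                    omega
            exact hpow _
      rw [pow_succ] at ht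
      induction ht using Submodule.mul_induction_on' with
      | mem_mul_mem a ha b hb =>
        rw [← KaehlerDifferential.span_range_eq_ideal] at hb
        induction hb using Submodule.span_induction generalizing a with
        | mem b hb =>
          obtain ⟨r, rfl⟩ := hb
          exact hr r a ha
        | zero => simp
        | add b b' _ _ hb hb' => rw [mul_add, map_add, hb a ha, hb' a ha, add_zero]
        | smul c b _ hb =>
          rw [smul_eq_mul, ← mul_assoc]
          exact hb _ (Ideal.mul_mem_right _ _ ha)
      | add a _ b _ ha hb => rw [map_add, ha, hb, add_zero]
  exact key _ β hβ (Nat.lt_succ_self _)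

/-- Taylor's formula: a map to an `R`-algebra that is linear over `q`-th powers is a combination
of Hasse derivatives. -/
theorem IsFrobBasis.apply_eq_sum_hasse (h : IsFrobBasis (p ^ e) y) {B : Type*} [CommRing B]
    [Algebra R B] (D : R →ₗ[ℤ] B)
    (hD : ∀ a f, D (a ^ p ^ e * f) = algebraMap R B a ^ p ^ e * D f) (f : R) :
    D f = ∑ β ∈ Fintype.piFinset (fun _ : ι => Finset.range (p ^ e)),
      algebraMap R B (h.hasse β f) * leftExtensionTo D (∏ i, (1 ⊗ₜ y i - y i ⊗ₜ 1) ^ β i) := by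
  have := h.ext_of_prod_pow (algebraMap R B) (D := D.toAddMonoidHom)
    (D' := ∑ β ∈ Fintype.piFinset (fun _ : ι => Finset.range (p ^ e)),
      (AddMonoidHom.mulRight (leftExtensionTo D (∏ i, (1 ⊗ₜ y i - y i ⊗ₜ 1) ^ β i))).comp
        ((algebraMap R B).toAddMonoidHom.comp (h.hasse β).toAddMonoidHom)) hD
    (fun a f => by
      simp only [AddMonoidHom.finsetSum_apply, Finset.mul_sum]
      refine Finset.sum_congr rfl fun β _ => ?_
      change algebraMap R B (h.hasse β (a ^ p ^ e * f)) * _ =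
        algebraMap R B a ^ p ^ e * (algebraMap R B (h.hasse β f) * _)
      rw [h.hasse_pow_mul, map_mul, map_pow, mul_assoc])
    (fun γ => by
      simp only [AddMonoidHom.finsetSum_apply]
      have h1 : D (∏ i, y i ^ (γ i : ℕ)) = leftExtensionTo D (1 ⊗ₜ ∏ i, y i ^ (γ i : ℕ)) := by
        rw [leftExtensionTo_tmul, map_one, one_mul]
      change D (∏ i, y i ^ (γ i : ℕ)) = _
      rw [h1, one_tmul_prod_pow y (fun i => (γ i : ℕ)) (fun _ => p ^ e) (fun i => (γ i).2), map_sum]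
      refine Finset.sum_congr rfl fun β hβ => ?_
      have hβ' : ∀ i, β i < p ^ e := fun i => by simpa using Fintype.mem_piFinset.mp hβ i
      rw [leftExtensionTo_tmul_one_mul]
      change _ = algebraMap R B (h.hasse β (∏ i, y i ^ (γ i : ℕ))) * _
      rw [h.hasse_prod_pow hβ'])
  have := DFunLike.congr_fun this f
  simp only [AddMonoidHom.finsetSum_apply] at this
  exact this

/-- Differential operators of order `j < q` on an `R`-algebra `B` map `I B` into `Diff ^ j (I) B`: by
Taylor's formula their restrictions to `R` are combinations of the Hasse derivatives of `R`, and
those of order more than `j` do not occur. -/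
theorem IsFrobBasis.diffIdeal_map_le (h : IsFrobBasis (p ^ e) y) {B : Type*} [CommRing B]
    [Algebra R B] [CharP B p] {j : ℕ} (hj : j < p ^ e) (I : Ideal R) :
    diffIdeal ℤ j (I.map (algebraMap R B)) ≤ (diffIdeal ℤ j I).map (algebraMap R B) := by
  rw [diffIdeal, Ideal.span_le]
  rintro _ ⟨E, hE, f, hf, rfl⟩
  rw [SetLike.mem_coe]
  rw [Ideal.map, Ideal.span] at hf
  have hmem : ∀ g : B, ∀ f ∈ I, E (g * algebraMap R B f) ∈ (diffIdeal ℤ j I).map (algebraMap R B) := by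
    intro g f hf
    set D : R →ₗ[ℤ] B :=
      E ∘ₗ LinearMap.mulLeft ℤ g ∘ₗ (algebraMap R B).toIntAlgHom.toLinearMap with hDdef
    have hD := h.apply_eq_sum_hasse D (fun a f => by
      change E (g * algebraMap R B (a ^ p ^ e * f)) = algebraMap R B a ^ p ^ e *
        E (g * algebraMap R B f)
      rw [RingHom.map_mul, RingHom.map_pow, mul_left_comm, hE.map_pow_mul hj]) f
    change D f ∈ _
    rw [hD]
    refine Submodule.sum_mem _ fun β hβ => ?_
    have hβ' : ∀ i, β i < p ^ e := fun i => by simpa using Fintype.mem_piFinset.mp hβ i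
    rcases lt_or_ge j (∑ i, β i) with hlt | hle
    · have h0 : leftExtensionTo D (∏ i, (1 ⊗ₜ y i - y i ⊗ₜ 1) ^ β i) = 0 := by
        refine leftExtensionTo_comp_mulLeft_eq_zero hE g (Ideal.pow_le_pow_right hlt ?_)
        have h1 := Finset.prod_pow_eq_pow_sum Finset.univ β (KaehlerDifferential.ideal ℤ R)
        rw [← h1]
        exact Ideal.prod_mem_prod fun i _ => Ideal.pow_mem_pow (one_tmul_sub_tmul_one_mem _) _
      rw [h0, mul_zero]
      exact zero_mem _
    · exact Ideal.mul_mem_right _ _ (Ideal.mem_map_of_mem _ (Ideal.subset_span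
        ⟨h.hasse β, (h.isDiffOp_hasse hβ').mono hle, f, hf, rfl⟩))
  induction hf using Submodule.span_induction with
  | mem f hf =>
    obtain ⟨f, hf, rfl⟩ := hf
    simpa using hmem 1 f hf
  | zero => simp
  | add a b _ _ ha hb => rw [map_add]; exact add_mem ha hb
  | smul c f hf _ =>
    clear * - hmem hf
    induction hf using Submodule.span_induction generalizing c with
    | mem f hf =>
      obtain ⟨f, hf, rfl⟩ := hf
      exact hmem c f hf
    | zero => simp
    | add a b _ _ ha hb => rw [smul_add, map_add]; exact add_mem (ha c) (hb c)
    | smul d f _ hf => rw [smul_smul]; exact hf (c * d)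

lemma IsFrobBasis.leftExtension_hasse_mul_pow_eq_zero (h : IsFrobBasis (p ^ e) y) {β : ι → ℕ}
    (hβ : ∀ i, β i < p ^ e) (i : ι) {k : ℕ} (hk : β i < k) (t : R ⊗[ℤ] R) :
    leftExtension (h.hasse β) (t * (1 ⊗ₜ y i - y i ⊗ₜ 1) ^ k) = 0 := by
  induction k generalizing β with
  | zero => omega
  | succ k ih =>
    rw [pow_succ, ← mul_assoc, h.leftExtension_hasse_mul hβ]
    split_ifs with h0
    · rfl
    · refine ih (fun j => ?_) ?_
      · rcases eq_or_ne j i with rfl | hj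
        · rw [Function.update_self]; have := hβ j; omega
        · rw [Function.update_of_ne hj]; exact hβ j
      · rw [Function.update_self]; omega

lemma IsFrobBasis.leftExtension_hasse_mul_pow_self (h : IsFrobBasis (p ^ e) y) {β : ι → ℕ}
    (hβ : ∀ i, β i < p ^ e) (i : ι) (t : R ⊗[ℤ] R) :
    leftExtension (h.hasse β) (t * (1 ⊗ₜ y i - y i ⊗ₜ 1) ^ β i) =
      leftExtension (h.hasse (Function.update β i 0)) t := by
  obtain ⟨k, hk⟩ : ∃ k, β i = k := ⟨_, rfl⟩
  induction k generalizing β with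
  | zero => rw [hk, pow_zero, mul_one, ← hk, Function.update_eq_self]
  | succ k ih =>
    rw [hk, pow_succ, ← mul_assoc, h.leftExtension_hasse_mul hβ, if_neg (by omega), hk,
      Nat.add_sub_cancel]
    have := ih (β := Function.update β i k) (fun j => by
      rcases eq_or_ne j i with rfl | hj
      · rw [Function.update_self]; have := hβ j; omega
      · rw [Function.update_of_ne hj]; exact hβ j) (by rw [Function.update_self])
    rwa [Function.update_self, Function.update_idem] at this

lemma IsFrobBasis.leftExtension_hasse_mul_prod_pow_self (h : IsFrobBasis (p ^ e) y) {β : ι → ℕ}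
    (hβ : ∀ i, β i < p ^ e) (t : R ⊗[ℤ] R) :
    leftExtension (h.hasse β) (t * ∏ i, (1 ⊗ₜ y i - y i ⊗ₜ 1) ^ β i) = leftExtension (h.hasse 0) t := by
  have key : ∀ s : Finset ι, ∀ t, leftExtension (h.hasse β) (t * ∏ i ∈ s, (1 ⊗ₜ y i - y i ⊗ₜ 1) ^ β i) =
      leftExtension (h.hasse (fun i => if i ∈ s then 0 else β i)) t := by
    intro s
    induction s using Finset.induction_on with
    | empty => simp
    | insert i s hi ih =>
      intro t
      have hb : ∀ j, (fun i => if i ∈ s then 0 else β i) j < p ^ e := by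
        intro j
        have := hβ j
        simp only
        split_ifs <;> omega
      rw [Finset.prod_insert hi, ← mul_assoc, ih]
      have := h.leftExtension_hasse_mul_pow_self hb i t
      simp only [hi, if_false] at this
      rw [this]
      congr 2
      congr 1
      funext j
      rcases eq_or_ne j i with rfl | hj
      · simp
      · simp [hj]
  rw [key]
  simp only [Finset.mem_univ, if_true]
  rfl

/-- Up to higher order terms, a Hasse derivative treats the coefficient of a monomial in
elements of an ideal `J` as a constant. -/
lemma IsFrobBasis.hasse_mul_prod_pow_sub_mem (h : IsFrobBasis (p ^ e) y) {β : ι → ℕ}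
    (hβ : ∀ i, β i < p ^ e) {J : Ideal R} {γ : ι → ℕ} (hγ : ∀ i, γ i ≠ 0 → y i ∈ J)
    (hle : ∑ i, β i ≤ ∑ i, γ i) (a : R) :
    h.hasse β (a * ∏ i, y i ^ γ i) - a * monomialDeriv y β γ ∈
      J ^ (∑ i, γ i - ∑ i, β i + 1) := by
  have h1 : h.hasse β (a * ∏ i, y i ^ γ i) =
      ∑ β' ∈ Fintype.piFinset (fun i => Finset.range (γ i + β i + 1)), monomialDeriv y β' γ *
        leftExtension (h.hasse β) (1 ⊗ₜ a * ∏ i, (1 ⊗ₜ y i - y i ⊗ₜ 1) ^ β' i) := by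
    have h2 : h.hasse β (a * ∏ i, y i ^ γ i) =
        leftExtension (h.hasse β) (1 ⊗ₜ a * (1 ⊗ₜ ∏ i, y i ^ γ i)) := by
      rw [Algebra.TensorProduct.tmul_mul_tmul, leftExtension_tmul, one_mul, one_mul]
    rw [h2, one_tmul_prod_pow y γ (fun i => γ i + β i + 1) (fun i => by omega), Finset.mul_sum, map_sum]
    refine Finset.sum_congr rfl fun β' _ => ?_
    rw [mul_left_comm, leftExtension_tmul_one_mul]
  have hβmem : β ∈ Fintype.piFinset (fun i => Finset.range (γ i + β i + 1)) :=
    Fintype.mem_piFinset.mpr fun i => Finset.mem_range.mpr (by omega)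
  rw [h1, ← Finset.add_sum_erase _ _ hβmem, h.leftExtension_hasse_mul_prod_pow_self hβ,
    leftExtension_tmul, one_mul, h.hasse_zero, mul_comm (monomialDeriv y β γ), add_sub_cancel_left]
  refine Submodule.sum_mem _ fun β' hβ' => ?_
  have hne := Finset.ne_of_mem_erase hβ'
  by_cases hi : ∃ i, β i < β' i
  · obtain ⟨i, hi⟩ := hi
    rw [← Finset.prod_erase_mul _ _ (Finset.mem_univ i), ← mul_assoc,
      h.leftExtension_hasse_mul_pow_eq_zero hβ i hi, mul_zero]
    exact zero_mem _
  · push Not at hi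
    refine Ideal.mul_mem_right _ _ ?_
    obtain ⟨i₀, hi₀⟩ : ∃ i, β' i < β i := by
      by_contra! hc
      exact hne (funext fun i => le_antisymm (hi i) (hc i))
    have hlt : ∑ i, β' i < ∑ i, β i := Finset.sum_lt_sum (fun i _ => hi i) ⟨i₀, Finset.mem_univ _, hi₀⟩
    by_cases hch : ∃ i, γ i < β' i
    · obtain ⟨i, hi⟩ := hch
      rw [monomialDeriv, Finset.prod_eq_zero (Finset.mem_univ i)]
      · exact zero_mem _
      · simp [Nat.choose_eq_zero_of_lt hi]
    push Not at hch
    have hsum : ∑ i, (γ i - β' i) = ∑ i, γ i - ∑ i, β' i := Finset.sum_tsub_distrib _ fun i _ => hch i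
    refine Ideal.pow_le_pow_right (show _ ≤ ∑ i, (γ i - β' i) by omega) ?_
    rw [monomialDeriv, Finset.prod_mul_distrib, ← Finset.prod_pow_eq_pow_sum]
    refine Ideal.mul_mem_left _ _ (Ideal.prod_mem_prod fun i _ => ?_)
    by_cases h0 : γ i = 0
    · simp [h0]
    · exact Ideal.pow_mem_pow (hγ i h0) _

end HasseOrder
end QDiff

namespace QDiff

open IsLocalRing

/-! ### Lowering the order of an element by a differential operator -/

section OrderDrop

lemma exists_sum_eq_not_dvd_choose {p : ℕ} {ι : Type*} (γ : ι → ℕ) (s : Finset ι)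
    {c : ℕ} (h : ¬ p ∣ (∑ i ∈ s, γ i).choose c) :
    ∃ β : ι → ℕ, ∑ i ∈ s, β i = c ∧ ∀ i ∈ s, ¬ p ∣ (γ i).choose (β i) := by
  classical
  induction s using Finset.induction_on generalizing c with
  | empty =>
    refine ⟨0, ?_, by simp⟩
    rcases Nat.eq_zero_or_pos c with rfl | hc
    · simp
    · simp [Nat.choose_eq_zero_of_lt hc] at h
  | insert i s hi ih =>
    rw [Finset.sum_insert hi, Nat.add_choose_eq] at h
    obtain ⟨⟨k, l⟩, hkl, hnd⟩ : ∃ kl ∈ Finset.HasAntidiagonal.antidiagonal c,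
        ¬ p ∣ (γ i).choose kl.1 * (∑ i ∈ s, γ i).choose kl.2 := by
      by_contra! hc
      exact h (Finset.dvd_sum hc)
    obtain ⟨β, hβ, hβ'⟩ := ih fun hd => hnd (Dvd.dvd.mul_left hd _)
    have hne : ∀ j ∈ s, j ≠ i := fun j hj => by rintro rfl; exact hi hj
    refine ⟨Function.update β i k, ?_, ?_⟩
    · rw [Finset.sum_insert hi, Function.update_self,
        Finset.sum_congr rfl fun j hj => Function.update_of_ne (hne j hj) _ _, hβ]
      simpa using hkl
    · intro j hj
      rcases Finset.mem_insert.mp hj with rfl | hj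
      · rw [Function.update_self]
        exact fun hd => hnd (Dvd.dvd.mul_right hd _)
      · rw [Function.update_of_ne (hne j hj)]
        exact hβ' j hj

variable {R : Type*} [CommRing R] {p : ℕ} [hp : Fact p.Prime] [CharP R p] {e : ℕ}

lemma isUnit_natCast_of_not_dvd {n : ℕ} (h : ¬ p ∣ n) : IsUnit (n : R) := by
  have h1 : n.Coprime p := (Nat.coprime_comm.mp ((Nat.Prime.coprime_iff_not_dvd hp.out).mpr h))
  have h2 := Int.gcd_eq_gcd_ab n p
  have h3 := congrArg (Int.cast : ℤ → R) h2
  simp only [Int.cast_natCast, Int.cast_add, Int.cast_mul, CharP.cast_eq_zero, zero_mul, add_zero,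
    Int.gcd_natCast_natCast, h1.gcd_eq_one] at h3
  exact IsUnit.of_mul_eq_one _ (h3.symm.trans Nat.cast_one)

/-- An element of order exactly `a q + c` with `c < q` is taken to an element of order `a q` by some
differential operator of order `c`. Some monomial `x ^ γ` of degree `a q + c` has unit coefficient, and
`(a q + c choose c)` is prime to `p`; hence Vandermonde's identity provides `β ≤ γ` with `|β| = c` and
`(γ choose β)` prime to `p`, and the Hasse derivative of multi-index `β` will do. -/
theorem exists_isDiffOp_notMem_pow [IsLocalRing R] {d : ℕ} {x : Fin d → R} (hx : IsPrimeFlag d x)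
    (hxm : Ideal.span (Set.range x) = maximalIdeal R) {κ : Type*} [Fintype κ] [DecidableEq κ]
    {u : κ → R} (h : IsFrobBasis (p ^ e) (Sum.elim x u)) {a c : ℕ} (hc : c < p ^ e) {f : R}
    (hf : f ∈ maximalIdeal R ^ (a * p ^ e + c)) (hf' : f ∉ maximalIdeal R ^ (a * p ^ e + c + 1)) :
    ∃ D : R →ₗ[ℤ] R, IsDiffOp c D ∧ D f ∉ maximalIdeal R ^ (a * p ^ e + 1) := by
  have hxmem : ∀ i, x i ∈ maximalIdeal R := fun i => hxm ▸ Ideal.subset_span (Set.mem_range_self i)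
  obtain ⟨G, hG, rfl⟩ := (Ideal.mem_span_pow_iff_exists_isHomogeneous x f).mp (hxm ▸ hf)
  obtain ⟨γ₀, hγ₀⟩ : ∃ γ, G.coeff γ ∉ maximalIdeal R := by
    by_contra! hco
    refine hf' ?_
    rw [pow_succ']
    exact eval_mem_mul_pow hxmem (MvPolynomial.mem_map_C_iff.mpr hco) hG
  have hdeg : ∀ γ ∈ G.support, ∑ i, γ i = a * p ^ e + c := by
    intro γ hγ
    have := hG (MvPolynomial.mem_support_iff.mp hγ)
    rw [← this, Finsupp.weight_apply, Finsupp.sum_fintype _ _ (by simp)]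
    simp
  have hγ₀' : γ₀ ∈ G.support := by
    rw [MvPolynomial.mem_support_iff]
    intro h0
    exact hγ₀ (h0 ▸ zero_mem _)
  obtain ⟨β, hβ, hβ'⟩ := exists_sum_eq_not_dvd_choose γ₀ Finset.univ (c := c) (by
    rw [hdeg γ₀ hγ₀', ← CharP.cast_eq_zero_iff R p, add_comm, mul_comm, cast_choose_add_mul hc]
    simp)
  have hle : ∀ i, β i ≤ γ₀ i := by
    intro i
    by_contra! hlt
    exact hβ' i (Finset.mem_univ i) (by simp [Nat.choose_eq_zero_of_lt hlt])
  set β' : Fin d ⊕ κ → ℕ := Sum.elim β 0 with hβ'def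
  have hsum : ∑ i, β' i = c := by simp [hβ'def, Fintype.sum_sum_type, hβ]
  have hlt : ∀ i, β' i < p ^ e := fun i =>
    (Finset.single_le_sum (fun _ _ => Nat.zero_le _) (Finset.mem_univ i)).trans_lt (hsum ▸ hc)
  refine ⟨h.hasse β', hsum ▸ h.isDiffOp_hasse hlt, fun hmem => hγ₀ ?_⟩
  -- the initial form of the derivative
  set βf : Fin d →₀ ℕ := Finsupp.equivFunOnFinite.symm β with hβf
  set H : MvPolynomial (Fin d) R := ∑ γ ∈ G.support with βf ≤ γ,
    MvPolynomial.monomial (γ - βf) (G.coeff γ * ((∏ i, (γ i).choose (β i) : ℕ) : R)) with hH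
  have hHhom : H.IsHomogeneous (a * p ^ e) := by
    refine MvPolynomial.IsHomogeneous.sum _ _ _ fun γ hγ => ?_
    obtain ⟨hγ, hle⟩ := Finset.mem_filter.mp hγ
    refine MvPolynomial.isHomogeneous_monomial _ ?_
    have h1 := hdeg γ hγ
    rw [Finsupp.degree_eq_sum]
    have h2 : ∑ i, (γ i - β i) = ∑ i, γ i - ∑ i, β i := Finset.sum_tsub_distrib _ fun i _ => hle i
    change ∑ i, (γ i - β i) = _
    omega
  have hev : MvPolynomial.eval x H ∈ Ideal.span (Set.range x) ^ (a * p ^ e + 1) := by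
    rw [hxm]
    refine (Submodule.sub_mem_iff_right _ hmem).mp ?_
    have h1 : MvPolynomial.eval x H =
        ∑ γ ∈ G.support, G.coeff γ * monomialDeriv (Sum.elim x u) β' (Sum.elim γ 0) := by
      rw [hH, map_sum, Finset.sum_filter]
      refine Finset.sum_congr rfl fun γ hγ => ?_
      rw [monomialDeriv, Fintype.prod_sum_type]
      split_ifs with hle
      · rw [MvPolynomial.eval_monomial, Finsupp.prod_fintype _ _ (by simp)]
        simp [hβ'def, Finset.prod_mul_distrib, mul_assoc, hβf]
      · obtain ⟨i, hi⟩ : ∃ i, γ i < β i := by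
          by_contra! hc
          exact hle hc
        rw [Finset.prod_eq_zero (Finset.mem_univ i), zero_mul, mul_zero]
        simp [hβ'def, Nat.choose_eq_zero_of_lt hi]
    have h2 : h.hasse β' (MvPolynomial.eval x G) =
        ∑ γ ∈ G.support, h.hasse β' (G.coeff γ * ∏ i, Sum.elim x u i ^ (Sum.elim γ 0 i)) := by
      rw [MvPolynomial.eval_eq', map_sum]
      refine Finset.sum_congr rfl fun γ _ => ?_
      simp [Fintype.prod_sum_type]
    rw [h1, h2, ← Finset.sum_sub_distrib]
    refine Submodule.sum_mem _ fun γ hγ => ?_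
    have hs : ∑ i, (Sum.elim γ 0 : Fin d ⊕ κ → ℕ) i = a * p ^ e + c := by
      simp [Fintype.sum_sum_type, hdeg γ hγ]
    have := h.hasse_mul_prod_pow_sub_mem hlt (J := maximalIdeal R)
      (γ := Sum.elim γ 0) (by
        rintro (i | i) hi
        · exact hxmem i
        · simp at hi) (by omega) (G.coeff γ)
    rwa [hs, hsum, Nat.add_sub_cancel] at this
  have hco := hx.mem_map_C_of_eval_mem_pow_succ hHhom hev
  rw [MvPolynomial.mem_map_C_iff, hxm] at hco
  have h3 := hco (γ₀ - βf)
  rw [hH, MvPolynomial.coeff_sum, Finset.sum_eq_single γ₀, MvPolynomial.coeff_monomial,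
    if_pos rfl] at h3
  · refine (Ideal.IsPrime.mem_or_mem inferInstance h3).resolve_right fun h4 => ?_
    rw [Nat.cast_prod] at h4
    refine (mem_maximalIdeal _).mp h4 ?_
    rw [IsUnit.prod_univ_iff]
    exact fun i => isUnit_natCast_of_not_dvd (p := p) (hβ' i (Finset.mem_univ i))
  · intro γ hγ hne
    rw [MvPolynomial.coeff_monomial, if_neg]
    intro heq
    refine hne ?_
    have h1 := (Finset.mem_filter.mp hγ).2
    rw [← tsub_add_cancel_of_le h1, heq, tsub_add_cancel_of_le (show βf ≤ γ₀ from hle)]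
  · intro hn
    exact absurd (Finset.mem_filter.mpr ⟨hγ₀', (show βf ≤ γ₀ from hle)⟩) hn

end OrderDrop
end QDiff

namespace QDiff

open IsLocalRing

/-! ### Charts of the blowup of a regular local ring -/

section Homogenization

open MvPolynomial

variable {R : Type*} [CommRing R] {ι : Type*}

/-- The form of degree `N` obtained from a polynomial `F` of degree at most `N` by multiplying its
monomials with powers of the variable `X i₀` (which may already occur in `F`). -/
noncomputable def homogenizeAt (i₀ : ι) (N : ℕ) (F : MvPolynomial ι R) : MvPolynomial ι R :=
  ∑ γ ∈ F.support, monomial (γ + Finsupp.single i₀ (N - γ.degree)) (F.coeff γ)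

lemma degree_le_of_mem_support {N : ℕ} {F : MvPolynomial ι R} (hF : F.totalDegree ≤ N)
    {γ : ι →₀ ℕ} (hγ : γ ∈ F.support) : γ.degree ≤ N :=
  (le_totalDegree hγ).trans hF

lemma isHomogeneous_homogenizeAt (i₀ : ι) {N : ℕ} {F : MvPolynomial ι R}
    (hF : F.totalDegree ≤ N) : (homogenizeAt i₀ N F).IsHomogeneous N := by
  refine IsHomogeneous.sum _ _ _ fun γ hγ => isHomogeneous_monomial _ ?_
  have := degree_le_of_mem_support hF hγ
  rw [map_add, Finsupp.degree_single]
  omega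

lemma eval₂_homogenizeAt {B : Type*} [CommRing B] (ψ : R →+* B) {i₀ : ι} {b : ι → B}
    (hb : b i₀ = 1) (s : B) {N : ℕ} {F : MvPolynomial ι R} (hF : F.totalDegree ≤ N) :
    eval₂ ψ (fun i => s * b i) (homogenizeAt i₀ N F) = s ^ N * eval₂ ψ b F := by
  rw [homogenizeAt, eval₂_sum, eval₂_eq, Finset.mul_sum]
  refine Finset.sum_congr rfl fun γ hγ => ?_
  have hle := degree_le_of_mem_support hF hγ
  rw [eval₂_monomial, Finsupp.prod_add_index' (by simp) (fun i m n => pow_add _ _ _),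
    Finsupp.prod_single_index (by simp), hb, mul_one, Finsupp.prod]
  simp only [mul_pow]
  rw [Finset.prod_mul_distrib, Finset.prod_pow_eq_pow_sum]
  change ψ (F.coeff γ) * (s ^ γ.degree * _ * _) = _
  have : s ^ N = s ^ γ.degree * s ^ (N - γ.degree) := by rw [← pow_add]; congr 1; omega
  rw [this]
  ring

lemma IsHomogeneous.eval₂_mul_left {B : Type*} [CommRing B] (ψ : R →+* B) (b : ι → B) (s : B) {n : ℕ}
    {F : MvPolynomial ι R} (hF : F.IsHomogeneous n) :
    eval₂ ψ (fun i => s * b i) F = s ^ n * eval₂ ψ b F := by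
  rw [eval₂_eq, eval₂_eq, Finset.mul_sum]
  refine Finset.sum_congr rfl fun γ hγ => ?_
  have hdeg : ∑ i ∈ γ.support, γ i = n := by
    have := hF (mem_support_iff.mp hγ)
    simpa [Finsupp.weight_apply, Finsupp.sum] using this
  simp only [mul_pow]
  rw [Finset.prod_mul_distrib, Finset.prod_pow_eq_pow_sum, hdeg]
  ring

lemma eval₂_eq_zero_of_mem_map_C {B : Type*} [CommRing B] (ψ : R →+* B) (b : ι → B) {J : Ideal R}
    (hJ : ∀ a ∈ J, ψ a = 0) {F : MvPolynomial ι R} (hF : F ∈ J.map C) : eval₂ ψ b F = 0 := by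
  rw [mem_map_C_iff] at hF
  rw [eval₂_eq]
  exact Finset.sum_eq_zero fun γ _ => by rw [hJ _ (hF γ), zero_mul]

/-- A polynomial of degree at most `n` that vanishes to order more than `n` at some point is zero. -/
lemma eq_zero_of_lt_order_eval₂ {K : Type*} [CommRing K] (τ : ι → K) {n : ℕ} {F : MvPolynomial ι K}
    (hF : F.totalDegree ≤ n)
    (h : ((n + 1 : ℕ) : ℕ∞) ≤
      (eval₂ MvPowerSeries.C (fun i => MvPowerSeries.C (τ i) + MvPowerSeries.X i) F).order) :
    F = 0 := by
  set F' : MvPolynomial ι K := eval₂ C (fun i => C (τ i) + X i) F with hF'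
  have hcoe : (F' : MvPowerSeries ι K) =
      eval₂ MvPowerSeries.C (fun i => MvPowerSeries.C (τ i) + MvPowerSeries.X i) F := by
    have := eval₂_comp_left (coeToMvPowerSeries.ringHom (σ := ι) (R := K)) C
      (fun i => C (τ i) + X i) F
    rw [← hF'] at this
    change coeToMvPowerSeries.ringHom F' = _
    rw [this]
    congr 1
    · ext1 a
      simp
    · funext i
      simp
  have hdeg : F'.totalDegree ≤ n := by
    rw [hF', eval₂_eq]
    refine totalDegree_finsetSum_le fun γ hγ => ?_
    refine (totalDegree_mul _ _).trans ?_
    rw [totalDegree_C, zero_add]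
    refine (totalDegree_finsetProd _ _).trans ?_
    refine (Finset.sum_le_sum fun i _ => ?_).trans (degree_le_of_mem_support hF hγ)
    refine (totalDegree_pow _ _).trans ?_
    have h1 : (C (τ i) + X i : MvPolynomial ι K).totalDegree ≤ 1 := by
      refine (totalDegree_add _ _).trans ?_
      rw [totalDegree_C]
      exact max_le (Nat.zero_le _) (by
        rcases subsingleton_or_nontrivial K with h | h
        · simp [Subsingleton.elim (X i : MvPolynomial ι K) 0]
        · rw [totalDegree_X])
    exact (Nat.mul_le_mul_left _ h1).trans (by simp)
  have h0 : F' = 0 := by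
    ext γ
    rw [coeff_zero]
    rcases le_or_gt γ.degree n with hle | hlt
    · rw [← coeff_coe, hcoe]
      refine MvPowerSeries.coeff_of_lt_order (lt_of_lt_of_le ?_ h)
      exact_mod_cast Nat.lt_succ_of_le hle
    · exact coeff_eq_zero_of_totalDegree_lt (lt_of_le_of_lt hdeg hlt)
  have h1 := eval₂_comp_left (eval₂Hom (C : K →+* MvPolynomial ι K) (fun i => X i - C (τ i))) C
    (fun i => C (τ i) + X i) F
  rw [← hF', h0, map_zero] at h1
  rw [h1]
  have h2 : (eval₂Hom (C : K →+* MvPolynomial ι K) (fun i => X i - C (τ i))).comp C = C := by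
    ext1 a
    simp
  have h3 : (eval₂Hom (C : K →+* MvPolynomial ι K) (fun i => X i - C (τ i))) ∘
      (fun i => C (τ i) + X i) = X := by
    funext i
    simp
  rw [h2, h3, eval₂_eta]

lemma le_order_of_mem_pow {W : Type*} [CommRing W] {K : Type*} [CommRing K]
    (χ : W →+* MvPowerSeries ι K) {I : Ideal W} (hI : ∀ a ∈ I, (χ a).constantCoeff = 0) {k : ℕ}
    {a : W} (ha : a ∈ I ^ k) : (k : ℕ∞) ≤ (χ a).order := by
  induction k generalizing a with
  | zero => simp
  | succ k ih =>
    rw [pow_succ] at ha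
    induction ha using Submodule.mul_induction_on' with
    | mem_mul_mem a ha b hb =>
      rw [map_mul]
      refine le_trans ?_ MvPowerSeries.le_order_mul
      push_cast
      exact add_le_add (ih ha) (MvPowerSeries.one_le_order_iff_constCoeff_eq_zero.mpr (hI b hb))
    | add a _ b _ ha hb =>
      rw [map_add]
      exact (le_min ha hb).trans MvPowerSeries.min_order_le_add

end Homogenization

section Chart

open MvPolynomial

variable {R : Type u} [CommRing R] [IsDomain R]

/-- A polynomial relation between the quotients `x i / x i₀` becomes a relation between the `x i` after
homogenization. -/
lemma eval_homogenizeAt_eq_zero {r : ℕ} {x : Fin r → R} {i₀ : Fin r}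
    (hi₀ : x i₀ ≠ 0) {N : ℕ} {F : MvPolynomial (Fin r) R} (hN : F.totalDegree ≤ N)
    (hF : eval₂ (algebraMap R (FractionRing R))
      (fun i => algebraMap R _ (x i) / algebraMap R _ (x i₀)) F = 0) :
    eval x (homogenizeAt i₀ N F) = 0 := by
  have hne : algebraMap R (FractionRing R) (x i₀) ≠ 0 := by
    rwa [Ne, FaithfulSMul.algebraMap_eq_zero_iff]
  have h1 := eval₂_homogenizeAt (algebraMap R (FractionRing R)) (i₀ := i₀)
    (b := fun i => algebraMap R _ (x i) / algebraMap R _ (x i₀)) (div_self hne)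
    (algebraMap R _ (x i₀)) hN
  rw [hF, mul_zero] at h1
  simp only [mul_div_cancel₀ _ hne] at h1
  have h2 := eval₂_comp_left (algebraMap R (FractionRing R)) (RingHom.id R) x (homogenizeAt i₀ N F)
  rw [RingHom.comp_id] at h2
  have h3 : algebraMap R (FractionRing R) (eval x (homogenizeAt i₀ N F)) = 0 := by
    rw [← h1]
    exact h2
  rwa [FaithfulSMul.algebraMap_eq_zero_iff] at h3

/-- Let `P = (x)` be a prime of `R` generated by a prime flag, and `R → R₁` a local homomorphism to a
local ring in which `P` becomes invertible. Then `R → R₁` factors through a local ring `W` of the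
blowup of `R` along `P`, the localization of `R[x i / x i₀]` at the preimage of the maximal ideal of
`R₁`. If `f ∈ P ^ n` is `w ^ n * g` in `W`, where `P W = (w)`, then the order of `g` exceeds `n` only
if that of `f` does: writing `f` as a form `G` in `x`, the map from `W` to power series over the
residue field `K` of `R₁` that sends `x i / x i₀` to `(τ i + S i) / (τ i₀ + S i₀)`, where `τ i ∈ K` is the
residue of `x i / x i₀`, takes `g` to a unit multiple of `G (τ + S)`. -/
theorem IsPrimeFlag.exists_chart [IsLocalRing R] {r : ℕ} {x : Fin r → R} (hx : IsPrimeFlag r x)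
    {R₁ : Type u} [CommRing R₁] [IsLocalRing R₁] (φ : R →+* R₁) [IsLocalHom φ] {t : R₁}
    (ht : t ∈ nonZeroDivisors R₁) (hP : (Ideal.span (Set.range x)).map φ = Ideal.span {t}) :
    ∃ (W : Type u) (_ : CommRing W) (_ : IsLocalRing W) (α : R →+* W) (β : W →+* R₁),
      IsLocalHom β ∧ β.comp α = φ ∧
      ∃ w ∈ nonZeroDivisors W, (Ideal.span (Set.range x)).map α = Ideal.span {w} ∧
        ∀ (n : ℕ) (f : R) (g : W), f ∈ Ideal.span (Set.range x) ^ n → α f = w ^ n * g →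
          g ∈ maximalIdeal W ^ (n + 1) → f ∈ maximalIdeal R ^ (n + 1) := by
  classical
  have hPm : Ideal.span (Set.range x) ≤ maximalIdeal R := le_maximalIdeal hx.isPrime.ne_top
  have hτ : ∀ i, ∃ τ, φ (x i) = t * τ := fun i => Ideal.mem_span_singleton.mp
    (hP ▸ Ideal.mem_map_of_mem φ (Ideal.subset_span (Set.mem_range_self i)))
  choose τ' hτ' using hτ
  -- one of the `x i` generates `P R₁`
  obtain ⟨i₀, hi₀⟩ : ∃ i, IsUnit (τ' i) := by
    by_contra! hc
    have h1 : (Ideal.span (Set.range x)).map φ ≤ Ideal.span {t} * maximalIdeal R₁ := by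
      rw [Ideal.map_span, Ideal.span_le]
      rintro _ ⟨_, ⟨i, rfl⟩, rfl⟩
      rw [hτ' i]
      exact Ideal.mul_mem_mul (Ideal.mem_span_singleton_self t) ((mem_maximalIdeal _).mpr (hc i))
    rw [hP] at h1
    obtain ⟨z, hz, hz'⟩ := Ideal.mem_span_singleton_mul.mp (h1 (Ideal.mem_span_singleton_self t))
    have h2 : z = 1 := by
      have : t * (z - 1) = 0 := by rw [mul_sub, hz', mul_one, sub_self]
      exact sub_eq_zero.mp ((mem_nonZeroDivisors_iff.mp ht).1 _ this)
    exact (Ideal.ne_top_iff_one _).mp (Ideal.IsPrime.ne_top inferInstance) (h2 ▸ hz)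
  obtain ⟨v₀, hv₀⟩ := hi₀
  set τ : Fin r → R₁ := fun i => τ' i * ↑v₀⁻¹ with hτdef
  have hτ₀ : τ i₀ = 1 := by simp [hτdef, ← hv₀]
  have hφx : ∀ i, φ (x i) = φ (x i₀) * τ i := by
    intro i
    rw [hτ' i, hτ' i₀, hτdef, ← hv₀]
    simp only
    rw [mul_assoc, mul_left_comm (v₀ : R₁), Units.mul_inv, mul_one]
  have ht₀ : φ (x i₀) ∈ nonZeroDivisors R₁ := by
    rw [hτ' i₀, ← hv₀]
    exact mul_mem ht v₀.isUnit.mem_nonZeroDivisors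
  have hx₀ : x i₀ ≠ 0 := by
    intro h0
    rw [h0, map_zero] at ht₀
    exact zero_notMem_nonZeroDivisors ht₀
  -- the ring `A = R[x i / x i₀]` and its map to `R₁`
  set ρ : MvPolynomial (Fin r) R →+* FractionRing R := eval₂Hom (algebraMap R (FractionRing R))
      (fun i => algebraMap R _ (x i) / algebraMap R _ (x i₀)) with hρ
  have hρ₁ : ∀ F ∈ RingHom.ker ρ, eval₂Hom φ τ F = 0 := by
    intro F hF
    have h1 := eval₂_homogenizeAt φ (i₀ := i₀) hτ₀ (φ (x i₀)) (F := F) le_rfl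
    have h2 := eval₂_comp_left φ (RingHom.id R) x (homogenizeAt i₀ F.totalDegree F)
    simp only [← hφx] at h1
    rw [RingHom.comp_id] at h2
    have h3 : eval₂ (RingHom.id R) x (homogenizeAt i₀ F.totalDegree F) = 0 :=
      eval_homogenizeAt_eq_zero hx₀ le_rfl hF
    have h4 : φ (x i₀) ^ F.totalDegree * eval₂ φ τ F = 0 := by
      rw [← h1]
      exact h2.symm.trans (by rw [h3, map_zero])
    exact (mem_nonZeroDivisors_iff.mp (pow_mem ht₀ _)).1 _ h4
  have hρprime : (RingHom.ker ρ).IsPrime := RingHom.ker_isPrime ρ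
  set toR₁ : MvPolynomial (Fin r) R ⧸ RingHom.ker ρ →+* R₁ := Ideal.Quotient.lift _ _ hρ₁ with htoR₁
  set 𝔮 : Ideal (MvPolynomial (Fin r) R ⧸ RingHom.ker ρ) := (maximalIdeal R₁).comap toR₁ with h𝔮
  have h𝔮prime : 𝔮.IsPrime := Ideal.comap_isPrime _ _
  have hunit : ∀ a ∈ 𝔮.primeCompl, IsUnit (toR₁ a) := by
    intro a ha
    by_contra hc
    exact ha ((mem_maximalIdeal _).mpr hc)
  set β : Localization.AtPrime 𝔮 →+* R₁ :=
    IsLocalization.lift (M := 𝔮.primeCompl) (g := toR₁) fun y => hunit y y.2 with hβ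
  have hβalg : ∀ a, β (algebraMap _ _ a) = toR₁ a := fun a => IsLocalization.lift_eq _ a
  have hβloc : IsLocalHom β := by
    refine ⟨fun w hw => ?_⟩
    obtain ⟨⟨a, s⟩, has⟩ := IsLocalization.surj 𝔮.primeCompl w
    have h1 := congrArg β has
    rw [map_mul, hβalg, hβalg] at h1
    have h2 : IsUnit (toR₁ a) := h1 ▸ hw.mul (hunit s s.2)
    have h3 : a ∈ 𝔮.primeCompl := fun h => (mem_maximalIdeal _).mp h h2
    have h4 := IsLocalization.map_units (Localization.AtPrime 𝔮) (⟨a, h3⟩ : 𝔮.primeCompl)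
    exact isUnit_of_mul_isUnit_left (has ▸ h4)
  set α₀ : MvPolynomial (Fin r) R →+* Localization.AtPrime 𝔮 :=
    (algebraMap _ _).comp (Ideal.Quotient.mk (RingHom.ker ρ)) with hα₀
  have hβα₀ : ∀ F, β (α₀ F) = eval₂ φ τ F := fun F => hβalg _
  have hαx : ∀ i, α₀ (C (x i)) = α₀ (C (x i₀)) * α₀ (X i) := by
    intro i
    rw [← map_mul, hα₀, RingHom.comp_apply, RingHom.comp_apply]
    congr 1
    rw [Ideal.Quotient.mk_eq_mk_iff_sub_mem, RingHom.mem_ker, hρ]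
    have hne : algebraMap R (FractionRing R) (x i₀) ≠ 0 := by
      rwa [Ne, FaithfulSMul.algebraMap_eq_zero_iff]
    simp [mul_div_cancel₀ _ hne]
  have hw : α₀ (C (x i₀)) ∈ nonZeroDivisors (Localization.AtPrime 𝔮) := by
    have : IsDomain (Localization.AtPrime 𝔮) :=
      IsLocalization.isDomain_localization 𝔮.primeCompl_le_nonZeroDivisors
    refine mem_nonZeroDivisors_of_ne_zero fun h0 => ?_
    have h1 := congrArg β h0
    rw [hβα₀, map_zero, eval₂_C] at h1
    rw [h1] at ht₀
    exact zero_notMem_nonZeroDivisors ht₀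
  have hspan : (Ideal.span (Set.range x)).map (α₀.comp C) = Ideal.span {α₀ (C (x i₀))} := by
    rw [Ideal.map_span]
    refine le_antisymm (Ideal.span_le.mpr ?_) (Ideal.span_le.mpr ?_)
    · rintro _ ⟨_, ⟨i, rfl⟩, rfl⟩
      exact Ideal.mem_span_singleton.mpr ⟨_, hαx i⟩
    · rintro _ rfl
      exact Ideal.subset_span ⟨_, ⟨i₀, rfl⟩, rfl⟩
  refine ⟨Localization.AtPrime 𝔮, inferInstance, inferInstance, α₀.comp C, β, hβloc, ?_,
    _, hw, hspan, ?_⟩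
  · ext1 a
    change β (α₀ (C a)) = φ a
    rw [hβα₀, eval₂_C]
  -- the map to power series
  set K := ResidueField R₁
  set ψ : R →+* K := (residue R₁).comp φ with hψ
  have hψm : ∀ a ∈ maximalIdeal R, ψ a = 0 := by
    intro a ha
    rw [hψ, RingHom.comp_apply, residue_eq_zero_iff, mem_maximalIdeal, mem_nonunits_iff,
      isUnit_map_iff]
    exact ha
  set v : Fin r → MvPowerSeries (Fin r) K := fun i =>
    MvPowerSeries.C (residue R₁ (τ i)) + MvPowerSeries.X i with hv
  have hvc : ∀ i, (v i).constantCoeff = residue R₁ (τ i) := by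
    intro i
    simp [hv]
  obtain ⟨u, hu⟩ : IsUnit (v i₀) := by
    rw [MvPowerSeries.isUnit_iff_constantCoeff, hvc, hτ₀, map_one]
    exact isUnit_one
  set b : Fin r → MvPowerSeries (Fin r) K := fun i => v i * ↑u⁻¹ with hb
  have hb₀ : b i₀ = 1 := by rw [hb]; simp only; rw [← hu, Units.mul_inv]
  have hvb : ∀ i, v i₀ * b i = v i := by
    intro i
    rw [hb]
    simp only
    rw [← hu, mul_left_comm, Units.mul_inv, mul_one]
  have hbc : ∀ i, (b i).constantCoeff = residue R₁ (τ i) := by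
    intro i
    have h1 := congrArg MvPowerSeries.constantCoeff (hvb i)
    rwa [map_mul, hvc, hvc, hτ₀, map_one, one_mul] at h1
  set ψC : R →+* MvPowerSeries (Fin r) K := MvPowerSeries.C.comp ψ with hψC
  have hρ₂ : ∀ F ∈ RingHom.ker ρ, eval₂Hom ψC b F = 0 := by
    intro F hF
    have h1 := eval₂_homogenizeAt ψC (i₀ := i₀) hb₀ (v i₀) (F := F) le_rfl
    have h3 : homogenizeAt i₀ F.totalDegree F ∈ (Ideal.span (Set.range x)).map C :=
      hx.mem_map_C_of_eval_eq_zero _ _ (isHomogeneous_homogenizeAt i₀ le_rfl)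
        (eval_homogenizeAt_eq_zero hx₀ le_rfl hF)
    rw [eval₂_eq_zero_of_mem_map_C ψC _ (fun a ha => by
      rw [hψC, RingHom.comp_apply, hψm a (hPm ha), map_zero]) h3] at h1
    exact ((u.isUnit.pow F.totalDegree).mul_right_eq_zero).mp (hu ▸ h1.symm)
  set toC : MvPolynomial (Fin r) R ⧸ RingHom.ker ρ →+* MvPowerSeries (Fin r) K :=
    Ideal.Quotient.lift _ _ hρ₂ with htoC
  have hconst : MvPowerSeries.constantCoeff.comp toC = (residue R₁).comp toR₁ := by
    refine Ideal.Quotient.ringHom_ext (MvPolynomial.ringHom_ext (fun a => ?_) fun i => ?_)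
    · simp [htoC, htoR₁, hψC, hψ]
    · simp [htoC, htoR₁, hbc]
  have hunitC : ∀ a ∈ 𝔮.primeCompl, IsUnit (toC a) := by
    intro a ha
    rw [MvPowerSeries.isUnit_iff_constantCoeff]
    have := RingHom.congr_fun hconst a
    simp only [RingHom.comp_apply] at this
    rw [this]
    exact (hunit a ha).map _
  set χ : Localization.AtPrime 𝔮 →+* MvPowerSeries (Fin r) K :=
    IsLocalization.lift (M := 𝔮.primeCompl) (g := toC) fun y => hunitC y y.2 with hχ
  have hχalg : ∀ a, χ (algebraMap _ _ a) = toC a := fun a => IsLocalization.lift_eq _ a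
  have hχα₀ : ∀ F, χ (α₀ F) = eval₂ ψC b F := fun F => hχalg _
  have hχβ : ∀ w, (χ w).constantCoeff = residue R₁ (β w) := by
    have : MvPowerSeries.constantCoeff.comp χ = (residue R₁).comp β := by
      refine IsLocalization.ringHom_ext 𝔮.primeCompl ?_
      refine RingHom.ext fun a => ?_
      rw [RingHom.comp_apply, RingHom.comp_apply, RingHom.comp_apply, RingHom.comp_apply, hχalg, hβalg]
      exact RingHom.congr_fun hconst a
    exact RingHom.congr_fun this
  intro n f g hf hfg hg
  obtain ⟨G, hG, rfl⟩ := (Ideal.mem_span_pow_iff_exists_isHomogeneous x f).mp hf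
  have h1 : α₀ G = g := by
    have h2 : (α₀.comp C) (eval x G) = α₀ (C (x i₀)) ^ n * α₀ G := by
      have h3 := IsHomogeneous.eval₂_mul_left (α₀.comp C) (fun i => α₀ (X i)) (α₀ (C (x i₀))) hG
      simp only [← hαx] at h3
      have h4 := eval₂_comp_left (α₀.comp C) (RingHom.id R) x G
      rw [RingHom.comp_id] at h4
      have h5 := eval₂_comp_left α₀ C X G
      rw [eval₂_eta] at h5
      rw [h5]
      exact h4.trans h3
    have h3 : α₀ (C (x i₀)) ^ n * (α₀ G - g) = 0 := by
      rw [mul_sub, ← h2, hfg, sub_self]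
    exact sub_eq_zero.mp ((mem_nonZeroDivisors_iff.mp (pow_mem hw n)).1 _ h3)
  have h2 : ((n + 1 : ℕ) : ℕ∞) ≤ (eval₂ ψC v G).order := by
    have h3 := IsHomogeneous.eval₂_mul_left ψC b (v i₀) hG
    simp only [hvb] at h3
    rw [h3, ← hχα₀, h1]
    refine le_trans ?_ MvPowerSeries.le_order_mul
    refine le_add_of_nonneg_of_le zero_le (le_order_of_mem_pow χ (fun a ha => ?_) hg)
    rw [hχβ, residue_eq_zero_iff, mem_maximalIdeal, mem_nonunits_iff, isUnit_map_iff]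
    exact ha
  have h3 : eval₂ ψC v G = eval₂ MvPowerSeries.C v (map ψ G) := by
    rw [eval₂_map]
  rw [h3] at h2
  have h4 := eq_zero_of_lt_order_eval₂ (fun i => residue R₁ (τ i))
    (hG.map ψ).totalDegree_le h2
  have h5 : G ∈ (maximalIdeal R).map C := by
    rw [mem_map_C_iff]
    intro γ
    have h6 := congrArg (coeff γ) h4
    rw [coeff_map, coeff_zero, hψ, RingHom.comp_apply, residue_eq_zero_iff, mem_maximalIdeal,
      mem_nonunits_iff, isUnit_map_iff] at h6
    exact h6
  rw [pow_succ']
  exact eval_mem_mul_pow (fun i => hPm (Ideal.subset_span (Set.mem_range_self i))) h5 hG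

end Chart
end QDiff

namespace QDiff

/-! ### Stalks and inverse images of ideal sheaves -/

section Stalk

variable {X Y : Scheme.{u}}

lemma exists_affineOpens_mem (x : X) : ∃ U : X.affineOpens, x ∈ U.1 := by
  obtain ⟨_, ⟨U, hU, rfl⟩, hxU, -⟩ :=
    X.isBasis_affineOpens.exists_subset_of_mem_open (Set.mem_univ x) isOpen_univ
  exact ⟨⟨U, hU⟩, hxU⟩

/-- The stalk of an ideal sheaf can be computed on any affine open neighbourhood. -/
lemma stalkIdeal_eq_map_germ (I : X.IdealSheafData) {x : X} (U : X.affineOpens) (hx : x ∈ U.1) :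
    stalkIdeal I x = (I.ideal U).map (X.presheaf.germ U.1 x hx).hom := by
  refine le_antisymm (iSup₂_le fun V hxV => ?_)
    (le_iSup₂ (f := fun (U : X.affineOpens) (hx : x ∈ U.1) =>
      (I.ideal U).map (X.presheaf.germ U.1 x hx).hom) U hx)
  obtain ⟨_, ⟨W, hW, rfl⟩, hxW, hle⟩ :=
    X.isBasis_affineOpens.exists_subset_of_mem_open (show x ∈ U.1 ⊓ V.1 from ⟨hx, hxV⟩)
      (U.1 ⊓ V.1).isOpen
  have key : ∀ T : X.affineOpens, ∀ hT : x ∈ T.1, ∀ h : W ≤ T.1,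
      (I.ideal T).map (X.presheaf.germ T.1 x hT).hom =
        (I.ideal ⟨W, hW⟩).map (X.presheaf.germ W x hxW).hom := by
    intro T hT h
    rw [← I.map_ideal (U := ⟨W, hW⟩) (V := T) h, Ideal.map_map, ← CommRingCat.hom_comp]
    have e := X.presheaf.germ_res (homOfLE h) x hxW
    rw [← e]
    rfl
  rw [key U hx fun y hy => (hle hy).1, key V hxV fun y hy => (hle hy).2]

/-- The ideal of `R` defined by the inverse image of an ideal sheaf under a morphism from
`Spec R`. -/
noncomputable def specIdeal (I : X.IdealSheafData) {R : CommRingCat.{u}} (g : Spec R ⟶ X) : Ideal R :=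
  ((I.comap g).ideal ⟨⊤, isAffineOpen_top _⟩).map (Scheme.ΓSpecIso R).hom.hom

lemma ideal_comap_of_isAffine [IsAffine X] [IsAffine Y] (f : X ⟶ Y) (J : Y.IdealSheafData) :
    (J.comap f).ideal ⟨⊤, isAffineOpen_top X⟩ =
      (J.ideal ⟨⊤, isAffineOpen_top Y⟩).map f.appTop.hom := by
  have hmap : ∀ K : X.IdealSheafData, (K.map f).ideal ⟨⊤, isAffineOpen_top Y⟩ =
      (K.ideal ⟨⊤, isAffineOpen_top X⟩).comap f.appTop.hom := fun K =>
    Scheme.IdealSheafData.ideal_map_of_isAffineHom K f ⟨⊤, isAffineOpen_top Y⟩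
  refine le_antisymm ?_ ?_
  · have h1 : J.comap f ≤ Scheme.IdealSheafData.ofIdealTop
        ((J.ideal ⟨⊤, isAffineOpen_top Y⟩).map f.appTop.hom) := by
      rw [← Scheme.IdealSheafData.le_map_iff_comap_le]
      refine Scheme.IdealSheafData.le_of_isAffine ?_
      rw [hmap]
      refine Ideal.le_comap_map.trans (Ideal.comap_mono ?_)
      exact ((Scheme.IdealSheafData.equivOfIsAffine (X := X)).right_inv _).ge
    exact (h1 _).trans ((Scheme.IdealSheafData.equivOfIsAffine (X := X)).right_inv _).le
  · rw [Ideal.map_le_iff_le_comap, ← hmap]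
    exact J.le_map_comap f _

lemma specIdeal_map_comp (I : X.IdealSheafData) {R S : CommRingCat.{u}} (φ : R ⟶ S)
    (g : Spec R ⟶ X) : specIdeal I (Spec.map φ ≫ g) = (specIdeal I g).map φ.hom := by
  rw [specIdeal, specIdeal, Scheme.IdealSheafData.comap_comp, ideal_comap_of_isAffine,
    Ideal.map_map, Ideal.map_map, ← CommRingCat.hom_comp, ← CommRingCat.hom_comp,
    Scheme.ΓSpecIso_naturality]

lemma specIdeal_comap (f : X ⟶ Y) (I : Y.IdealSheafData) {R : CommRingCat.{u}} (g : Spec R ⟶ X) :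
    specIdeal (I.comap f) g = specIdeal I (g ≫ f) := by
  rw [specIdeal, specIdeal, Scheme.IdealSheafData.comap_comp]

lemma specIdeal_fromSpec (I : X.IdealSheafData) {U : X.Opens} (hU : IsAffineOpen U) :
    specIdeal I hU.fromSpec = I.ideal ⟨U, hU⟩ := by
  have hUU : hU.fromSpec ''ᵁ ⊤ = U := by
    rw [Scheme.Hom.image_top_eq_opensRange, hU.opensRange_fromSpec]
  have h0 := I.ideal_comap_of_isOpenImmersion hU.fromSpec ⟨⊤, isAffineOpen_top _⟩
  have h1 : ∀ J : Ideal Γ(X, hU.fromSpec ''ᵁ ⊤), J.comap (hU.fromSpec.appIso ⊤).inv.hom =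
      J.map (hU.fromSpec.appIso ⊤).hom.hom := fun J =>
    Ideal.comap_symm (I := J) (hU.fromSpec.appIso ⊤).commRingCatIsoToRingEquiv
  have h2 := I.map_ideal (U := ⟨hU.fromSpec ''ᵁ ⊤, (isAffineOpen_top _).image_of_isOpenImmersion _⟩)
    (V := ⟨U, hU⟩) hUU.le
  have h3 : X.presheaf.map (homOfLE hUU.le).op ≫ (hU.fromSpec.appIso ⊤).hom ≫
      (Scheme.ΓSpecIso Γ(X, U)).hom = 𝟙 _ := by
    rw [Scheme.Hom.appIso_hom, ← Category.assoc, ← Category.assoc, Scheme.Hom.naturality,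
      hU.fromSpec_app_self]
    simp only [Category.assoc, ← Functor.map_comp_assoc]
    rw [Iso.inv_comp_eq, Category.comp_id]
    convert Category.id_comp _
    exact CategoryTheory.Functor.map_id _ _
  have h4 : specIdeal I hU.fromSpec = (I.ideal ⟨U, hU⟩).map (X.presheaf.map (homOfLE hUU.le).op ≫
      (hU.fromSpec.appIso ⊤).hom ≫ (Scheme.ΓSpecIso Γ(X, U)).hom).hom := by
    refine (congrArg (Ideal.map _) (h0.trans (h1 _))).trans ?_
    refine (congrArg (fun J => Ideal.map _ (Ideal.map _ J)) h2.symm).trans ?_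
    rw [Ideal.map_map, Ideal.map_map]
    rfl
  rw [h4, h3]
  exact Ideal.map_id _

lemma specIdeal_fromSpecStalk (I : X.IdealSheafData) (x : X) :
    specIdeal I (X.fromSpecStalk x) = stalkIdeal I x := by
  obtain ⟨⟨U, hU⟩, hx⟩ := exists_affineOpens_mem x
  have hU : IsAffineOpen U := hU
  have h : hU.fromSpecStalk hx = Spec.map (X.presheaf.germ U x hx) ≫ hU.fromSpec := rfl
  rw [← hU.fromSpecStalk_eq_fromSpecStalk hx, h, specIdeal_map_comp,
    specIdeal_fromSpec, stalkIdeal_eq_map_germ I ⟨U, hU⟩ hx]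

lemma stalkIdeal_comap (f : X ⟶ Y) (I : Y.IdealSheafData) (x : X) :
    stalkIdeal (I.comap f) x = (stalkIdeal I (f x)).map (f.stalkMap x).hom := by
  rw [← specIdeal_fromSpecStalk, specIdeal_comap, ← Scheme.SpecMap_stalkMap_fromSpecStalk,
    specIdeal_map_comp, specIdeal_fromSpecStalk]

/-- A morphism from the spectrum of a local ring is induced by a local homomorphism from the local ring
of the image of the closed point. -/
lemma exists_specMap_fromSpecStalk {W : CommRingCat.{u}} [IsLocalRing W] (g : Spec W ⟶ X) {x : X}
    (hx : g (IsLocalRing.closedPoint W) = x) :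
    ∃ ψ : X.presheaf.stalk x ⟶ W, IsLocalHom ψ.hom ∧ Spec.map ψ ≫ X.fromSpecStalk x = g := by
  subst hx
  exact ⟨Scheme.stalkClosedPointTo g, inferInstance, Scheme.Spec_stalkClosedPointTo_fromSpecStalk g⟩

lemma mem_support_iff_stalkIdeal_le (I : X.IdealSheafData) (x : X) :
    x ∈ I.support ↔ stalkIdeal I x ≤ IsLocalRing.maximalIdeal (X.presheaf.stalk x) := by
  obtain ⟨U, hx⟩ := exists_affineOpens_mem x
  rw [Scheme.IdealSheafData.mem_support_iff_of_mem hx, stalkIdeal_eq_map_germ I U hx,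
    Ideal.map_le_iff_le_comap, Scheme.mem_zeroLocus_iff]
  refine forall₂_congr fun f _ => ?_
  rw [Ideal.mem_comap, IsLocalRing.mem_maximalIdeal, mem_nonunits_iff, Scheme.mem_basicOpen _ _ _ hx]

lemma isInvertible_of_specIdeal {R : CommRingCat.{u}} (J : (Spec R).IdealSheafData) {w : R}
    (hw : w ∈ nonZeroDivisors R) (h : specIdeal J (𝟙 _) = Ideal.span {w}) : IsInvertible J := by
  intro x
  refine ⟨⟨⊤, isAffineOpen_top _⟩, trivial, (Scheme.ΓSpecIso R).inv.hom w, ?_, ?_⟩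
  · exact (MulEquivClass.map_nonZeroDivisors
      (Scheme.ΓSpecIso R).commRingCatIsoToRingEquiv.symm).le ⟨w, hw, rfl⟩
  · rw [specIdeal, Scheme.IdealSheafData.comap_id] at h
    have := congrArg (Ideal.map (Scheme.ΓSpecIso R).inv.hom) h
    rw [Ideal.map_map, ← CommRingCat.hom_comp, Iso.hom_inv_id, Ideal.map_span, Set.image_singleton] at this
    rw [← this]
    exact (Ideal.map_id _).symm

end Stalk
end QDiff

namespace QDiff

/-! ### Local rings of regular, `F`-finite and blown up schemes -/

section LocalRings

variable {X Y : Scheme.{u}}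

/-- The local rings of a closed subscheme are the quotients of those of the ambient scheme by the
stalks of its ideal sheaf. -/
lemma isRegularLocalRing_quotient_stalkIdeal {Z : X.IdealSheafData}
    (hZ : IsRegularScheme Z.subscheme) {x : X} (hx : x ∈ Z.support) :
    IsRegularLocalRing (X.presheaf.stalk x ⧸ stalkIdeal Z x) := by
  obtain ⟨z, rfl⟩ : x ∈ Set.range Z.subschemeι := by
    rw [Z.range_subschemeι]
    exact hx
  have hreg := hZ.isRegularLocalRing z
  have hsurj : Function.Surjective (Z.subschemeι.stalkMap z).hom :=
    Z.subschemeι.stalkMap_surjective z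
  have hker : RingHom.ker (Z.subschemeι.stalkMap z).hom = stalkIdeal Z (Z.subschemeι z) := by
    obtain ⟨U, hxU⟩ := exists_affineOpens_mem (Z.subschemeι z)
    rw [stalkIdeal_eq_map_germ Z U hxU]
    refine le_antisymm (fun f hf => ?_) ?_
    · let := TopCat.Presheaf.algebra_section_stalk X.presheaf (⟨_, hxU⟩ : U.1)
      have hloc := IsAffineOpen.isLocalization_stalk U.2 ⟨_, hxU⟩
      obtain ⟨⟨a, s⟩, has⟩ := IsLocalization.surj
        (IsAffineOpen.primeIdealOf U.2 ⟨_, hxU⟩).asIdeal.primeCompl f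
      have hs := IsLocalization.map_units (X.presheaf.stalk (Z.subschemeι z)) s
      change f * (X.presheaf.germ U.1 _ hxU).hom s = (X.presheaf.germ U.1 _ hxU).hom a at has
      change IsUnit ((X.presheaf.germ U.1 _ hxU).hom s) at hs
      have hV : IsAffineOpen (Z.subschemeι ⁻¹ᵁ U.1) := U.2.preimage Z.subschemeι
      have hgerm : ∀ a, (Z.subschemeι.stalkMap z).hom ((X.presheaf.germ U.1 _ hxU).hom a) =
          (Z.subscheme.presheaf.germ (Z.subschemeι ⁻¹ᵁ U.1) z hxU).hom
            ((Z.subschemeι.app U.1).hom a) := fun a =>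
        Scheme.Hom.germ_stalkMap_apply Z.subschemeι U.1 z hxU a
      let := TopCat.Presheaf.algebra_section_stalk Z.subscheme.presheaf
        (⟨z, hxU⟩ : Z.subschemeι ⁻¹ᵁ U.1)
      have hlocZ := IsAffineOpen.isLocalization_stalk hV ⟨z, hxU⟩
      have h0 : (Z.subscheme.presheaf.germ (Z.subschemeι ⁻¹ᵁ U.1) z hxU).hom
            ((Z.subschemeι.app U.1).hom a) = 0 := by
        rw [← hgerm, ← has, map_mul, RingHom.mem_ker.mp hf, zero_mul]
      obtain ⟨g, hg⟩ := (IsLocalization.map_eq_zero_iff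
        (hV.primeIdealOf ⟨z, hxU⟩).asIdeal.primeCompl (Z.subscheme.presheaf.stalk z) _).mp h0
      have hgu := IsLocalization.map_units (Z.subscheme.presheaf.stalk z) g
      change IsUnit ((Z.subscheme.presheaf.germ (Z.subschemeι ⁻¹ᵁ U.1) z hxU).hom g) at hgu
      obtain ⟨g', hg'⟩ := Z.subschemeι_app_surjective U g
      change (Z.subschemeι.app U.1).hom g' = g at hg'
      rw [← hg', ← hgerm, isUnit_map_iff] at hgu
      rw [← hg', ← map_mul, ← RingHom.mem_ker, Z.ker_subschemeι_app U] at hg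
      have h1 := Ideal.mem_map_of_mem (X.presheaf.germ U.1 _ hxU).hom hg
      rw [map_mul, ← has, Ideal.unit_mul_mem_iff_mem _ hgu, Ideal.mul_unit_mem_iff_mem _ hs] at h1
      exact h1
    · rw [Ideal.map_le_iff_le_comap]
      intro s hs
      rw [Ideal.mem_comap, RingHom.mem_ker]
      rw [← Z.ker_subschemeι_app U, RingHom.mem_ker] at hs
      have := Scheme.Hom.germ_stalkMap_apply Z.subschemeι U.1 z hxU s
      refine this.trans ?_
      refine (congrArg _ hs).trans (map_zero _)
  rw [← hker]
  exact IsRegularLocalRing.of_ringEquiv (RingHom.quotientKerEquivOfSurjective hsurj).symm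

lemma charP_stalk {p : ℕ} (hp : p.Prime) (hchar : (p : Γ(X, ⊤)) = 0) (x : X) :
    CharP (X.presheaf.stalk x) p := by
  refine (CharP.charP_iff_prime_eq_zero hp).mpr ?_
  have := congrArg (X.presheaf.germ ⊤ x trivial).hom hchar
  rwa [map_natCast, map_zero] at this

lemma isFFiniteRing_stalk {p : ℕ} [Fact p.Prime] (hF : IsFFinite p X) (x : X)
    [CharP (X.presheaf.stalk x) p] : IsFFiniteRing p (X.presheaf.stalk x) := by
  obtain ⟨U, hx⟩ := exists_affineOpens_mem x
  refine IsFFiniteRing.of_forall_exists (X.presheaf.germ U.1 x hx).hom (fun b => ?_) (hF U)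
  let := TopCat.Presheaf.algebra_section_stalk X.presheaf (⟨x, hx⟩ : U.1)
  have hloc := IsAffineOpen.isLocalization_stalk U.2 ⟨x, hx⟩
  obtain ⟨⟨f, s⟩, hs⟩ := IsLocalization.surj
    (IsAffineOpen.primeIdealOf U.2 ⟨x, hx⟩).asIdeal.primeCompl b
  obtain ⟨u, hu⟩ := IsLocalization.map_units (X.presheaf.stalk x) s
  change b * (X.presheaf.germ U.1 x hx).hom s = (X.presheaf.germ U.1 x hx).hom f at hs
  change (u : X.presheaf.stalk x) = (X.presheaf.germ U.1 x hx).hom s at hu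
  refine ⟨f * s ^ (p - 1), ↑u⁻¹, ?_⟩
  have hp : p = (p - 1) + 1 := (Nat.succ_pred_prime Fact.out).symm
  rw [map_mul, map_pow, ← hs, ← hu]
  have h1 : (u⁻¹ : (X.presheaf.stalk x)ˣ).val ^ p * (u : X.presheaf.stalk x) ^ p = 1 := by
    rw [← mul_pow, Units.inv_mul, one_pow]
  calc b = b * ((u⁻¹ : (X.presheaf.stalk x)ˣ).val ^ p * (u : X.presheaf.stalk x) ^ p) := by
        rw [h1, mul_one]
    _ = _ := by
        conv_lhs => rw [hp, pow_succ (u : X.presheaf.stalk x), ← hp]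
        ring

/-- If `W → 𝒪_{X₁, x₁}` is a local homomorphism over `𝒪_{X, x}`, where `x₁` is a point over `x` of the
blowup `X₁` of `X`, and if the center becomes invertible in `W`, then the universal property of the
blowup provides a local homomorphism `𝒪_{X₁, x₁} → W` over `𝒪_{X, x}`: the closed point of `Spec W`
goes to `x₁`, since by uniqueness `Spec 𝒪_{X₁, x₁} → Spec W → X₁` is the canonical morphism. -/
theorem IsBlowup.exists_stalk_hom {X₁ : Scheme.{u}} {π : X₁ ⟶ X} {Z : X.IdealSheafData}
    (hπ : IsBlowup π Z) (x₁ : X₁) {W : Type u} [CommRing W] [IsLocalRing W]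
    (α : X.presheaf.stalk (π x₁) →+* W) (β : W →+* X₁.presheaf.stalk x₁) [IsLocalHom β]
    (hαβ : β.comp α = (π.stalkMap x₁).hom) {w : W} (hw : w ∈ nonZeroDivisors W)
    (hZw : (stalkIdeal Z (π x₁)).map α = Ideal.span {w}) {t : X₁.presheaf.stalk x₁}
    (ht : t ∈ nonZeroDivisors (X₁.presheaf.stalk x₁)) (hZt : stalkIdeal (Z.comap π) x₁ = Ideal.span {t}) :
    ∃ ψ : X₁.presheaf.stalk x₁ →+* W, IsLocalHom ψ ∧ ψ.comp (π.stalkMap x₁).hom = α := by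
  let A : X.presheaf.stalk (π x₁) ⟶ CommRingCat.of W := CommRingCat.ofHom α
  let B : CommRingCat.of W ⟶ X₁.presheaf.stalk x₁ := CommRingCat.ofHom β
  have hAB : A ≫ B = π.stalkMap x₁ := by
    ext1
    exact hαβ
  obtain ⟨g, hg, -⟩ := hπ.existsUnique_lift _ (Spec.map A ≫ X.fromSpecStalk (π x₁)) (by
    refine isInvertible_of_specIdeal _ hw ?_
    rw [specIdeal_comap, Category.id_comp, specIdeal_map_comp, specIdeal_fromSpecStalk]
    exact hZw)
  have h1 : Spec.map B ≫ g = X₁.fromSpecStalk x₁ := by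
    obtain ⟨g', -, hg'⟩ := hπ.existsUnique_lift _ (X₁.fromSpecStalk x₁ ≫ π) (by
      refine isInvertible_of_specIdeal _ ht ?_
      rw [specIdeal_comap, Category.id_comp, ← specIdeal_comap, specIdeal_fromSpecStalk]
      exact hZt)
    rw [hg' (X₁.fromSpecStalk x₁) rfl, hg' (Spec.map B ≫ g) (by
      simp only [Category.assoc]
      rw [hg, ← Spec.map_comp_assoc, hAB, Scheme.SpecMap_stalkMap_fromSpecStalk])]
  have h2 : g (IsLocalRing.closedPoint W) = x₁ := by
    have h3 : Spec.map B (IsLocalRing.closedPoint (X₁.presheaf.stalk x₁)) =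
        IsLocalRing.closedPoint W := by
      have : IsLocalHom B.hom := ‹IsLocalHom β›
      exact Spec_closedPoint
    have h4 := congrArg (fun f => f (IsLocalRing.closedPoint (X₁.presheaf.stalk x₁))) h1
    exact (congrArg g h3).symm.trans (h4.trans Scheme.fromSpecStalk_closedPoint)
  obtain ⟨ψ, hψ, hψg⟩ := exists_specMap_fromSpecStalk (W := CommRingCat.of W) g h2
  refine ⟨ψ.hom, hψ, ?_⟩
  have h4 : Spec.map (π.stalkMap x₁ ≫ ψ) = Spec.map A := by
    rw [← cancel_mono (X.fromSpecStalk (π x₁)), ← hg, ← hψg, Spec.map_comp, Category.assoc,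
      Category.assoc, Scheme.SpecMap_stalkMap_fromSpecStalk]
  have h5 := Spec.map_injective h4
  exact congrArg CommRingCat.Hom.hom h5

end LocalRings
end QDiff

namespace QDiff

/-! ### Orders of ideal sheaves -/

section Order

variable {X : Scheme.{u}}

lemma le_order_iff (I : X.IdealSheafData) (x : X) (n : ℕ) :
    (n : ℕ∞) ≤ order I x ↔
      stalkIdeal I x ≤ IsLocalRing.maximalIdeal (X.presheaf.stalk x) ^ n := by
  refine ⟨fun h => ?_, fun h => le_iSup₂ (f := fun (n : ℕ)
    (_ : stalkIdeal I x ≤ IsLocalRing.maximalIdeal (X.presheaf.stalk x) ^ n) => (n : ℕ∞)) n h⟩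
  rcases n with _ | n
  · simp
  by_contra hn
  refine absurd (h.trans (iSup₂_le (a := (n : ℕ∞)) fun k hk => ?_)) (by
    rw [not_le]
    exact_mod_cast Nat.lt_succ_self n)
  by_contra! hlt
  exact hn (hk.trans (Ideal.pow_le_pow_right (by exact_mod_cast hlt)))

/-- A homomorphism `α` from `𝒪_{X, x}` to a local ring `W` factors through the local ring of a
generization `ξ` of `x`, the image of the closed point of `Spec W`; the last statement describes the
compatibility of the two homomorphisms on ideal sheaves only. -/
lemma exists_stalk_hom_of_hom {x : X} {W : Type u} [CommRing W] [IsLocalRing W]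
    (α : X.presheaf.stalk x →+* W) :
    ∃ (ξ : X) (ψ : X.presheaf.stalk ξ →+* W), IsLocalHom ψ ∧
      ∀ J : X.IdealSheafData, (stalkIdeal J ξ).map ψ = (stalkIdeal J x).map α := by
  let A : X.presheaf.stalk x ⟶ CommRingCat.of W := CommRingCat.ofHom α
  obtain ⟨ψ, hψ, hψg⟩ := exists_specMap_fromSpecStalk (W := CommRingCat.of W)
    (Spec.map A ≫ X.fromSpecStalk x) rfl
  refine ⟨_, ψ.hom, hψ, fun J => ?_⟩
  have h1 := congrArg (specIdeal J) hψg
  rw [specIdeal_map_comp, specIdeal_map_comp, specIdeal_fromSpecStalk, specIdeal_fromSpecStalk] at h1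
  exact h1

/-- An ideal sheaf that has order at least `n` along a closed subscheme `Z` is contained, locally, in
the `n`-th power of the ideal `P` of `Z`, if `P` is generated by a prime flag: this follows at the
generic point of `Z`, as the symbolic powers of `P` are the ordinary ones. -/
lemma IsPrimeFlag.stalkIdeal_le_pow {I Z : X.IdealSheafData} {x : X} {r : ℕ}
    {y : Fin r → X.presheaf.stalk x} (hy : IsPrimeFlag r y)
    (hZ : Ideal.span (Set.range y) = stalkIdeal Z x) {n : ℕ}
    (h : ∀ ξ ∈ Z.support, stalkIdeal I ξ ≤ IsLocalRing.maximalIdeal (X.presheaf.stalk ξ) ^ n) :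
    stalkIdeal I x ≤ stalkIdeal Z x ^ n := by
  have hP : (stalkIdeal Z x).IsPrime := hZ ▸ hy.isPrime
  obtain ⟨ξ, ψ, hψ, hmap⟩ := exists_stalk_hom_of_hom (x := x)
    (algebraMap (X.presheaf.stalk x) (Localization.AtPrime (stalkIdeal Z x)))
  have hψm : (IsLocalRing.maximalIdeal (X.presheaf.stalk ξ)).map ψ ≤
      IsLocalRing.maximalIdeal (Localization.AtPrime (stalkIdeal Z x)) :=
    ((IsLocalRing.local_hom_TFAE ψ).out 0 2).mp hψ
  have hξ : ξ ∈ Z.support := by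
    rw [mem_support_iff_stalkIdeal_le]
    intro f hf
    have h1 := Ideal.mem_map_of_mem ψ hf
    rw [hmap, Localization.AtPrime.map_eq_maximalIdeal] at h1
    rw [IsLocalRing.mem_maximalIdeal, mem_nonunits_iff]
    exact fun hu => (IsLocalRing.mem_maximalIdeal _).mp h1 (hu.map ψ)
  have hI : (stalkIdeal I x).map (algebraMap (X.presheaf.stalk x) (Localization.AtPrime (stalkIdeal Z x))) ≤
      (stalkIdeal Z x ^ n).map (algebraMap (X.presheaf.stalk x) (Localization.AtPrime (stalkIdeal Z x))) := by
    rw [← hmap, Ideal.map_pow, Localization.AtPrime.map_eq_maximalIdeal]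
    refine (Ideal.map_mono (h ξ hξ)).trans ?_
    rw [Ideal.map_pow]
    exact Ideal.pow_right_mono hψm n
  intro f hf
  obtain ⟨s, hs, hsf⟩ := (IsLocalization.algebraMap_mem_map_algebraMap_iff
    (stalkIdeal Z x).primeCompl _ _ _).mp (hI (Ideal.mem_map_of_mem _ hf))
  rw [← hZ] at hsf ⊢
  exact hy.mem_pow_of_mul_mem_pow (hZ ▸ hs) hsf

end Order

/-! ### Conductors -/

section Colon

lemma mem_map_colon_of_forall_mul_mem {A S : Type*} [CommRing A] [CommRing S] [Algebra A S]
    (M : Submonoid A) [IsLocalization M S] {I J : Ideal A} (hJ : J.FG) {g : S}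
    (h : ∀ j ∈ J, algebraMap A S j * g ∈ I.map (algebraMap A S)) :
    g ∈ (I.colon (J : Set A)).map (algebraMap A S) := by
  obtain ⟨⟨a, s⟩, has⟩ := IsLocalization.surj M g
  obtain ⟨T, rfl⟩ := hJ
  have h1 : ∀ j ∈ T, ∃ c ∈ M, c * (j * a) ∈ I := by
    intro j hj
    refine (IsLocalization.algebraMap_mem_map_algebraMap_iff M S _ _).mp ?_
    rw [map_mul, ← has, ← mul_assoc]
    exact Ideal.mul_mem_right _ _ (h j (Ideal.subset_span hj))
  choose! c hcM hc using h1
  have h2 : (∏ j ∈ T, c j) * a ∈ I.colon (Ideal.span (T : Set A) : Set A) := by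
    rw [Submodule.mem_colon]
    intro j hj
    rw [SetLike.mem_coe] at hj
    induction hj using Submodule.span_induction with
    | mem j hj =>
      obtain ⟨d, hd⟩ := Finset.dvd_prod_of_mem c hj
      have : (∏ j ∈ T, c j) * a * j = d * (c j * (j * a)) := by rw [hd]; ring
      rw [smul_eq_mul, this]
      exact Ideal.mul_mem_left _ _ (hc j hj)
    | zero => simp
    | add j j' _ _ hj hj' => rw [smul_add]; exact add_mem hj hj'
    | smul b j _ hj => rw [smul_comm]; exact Ideal.mul_mem_left _ _ hj
  have h3 := Ideal.mem_map_of_mem (algebraMap A S) h2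
  rw [map_mul, ← has, mul_comm, mul_assoc] at h3
  have hu : IsUnit (algebraMap A S s * algebraMap A S (∏ j ∈ T, c j)) :=
    (IsLocalization.map_units S s).mul
      (IsLocalization.map_units S (⟨_, prod_mem hcM⟩ : M))
  exact (Ideal.mul_unit_mem_iff_mem _ hu).mp h3

lemma mul_mem_map_of_mem_map_colon {A S : Type*} [CommRing A] [CommRing S] (φ : A →+* S)
    {I J : Ideal A} {g : S} (hg : g ∈ (I.colon (J : Set A)).map φ) {t : S} (ht : t ∈ J.map φ) :
    t * g ∈ I.map φ := by
  have : J.map φ * (I.colon (J : Set A)).map φ ≤ I.map φ := by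
    rw [← Ideal.map_mul]
    refine Ideal.map_mono (Ideal.mul_le.mpr fun j hj a ha => ?_)
    rw [mul_comm]
    exact Submodule.mem_colon.mp ha j hj
  exact this (Ideal.mul_mem_mul ht hg)

/-- Formation of the quotient by a finitely generated ideal commutes with localization. -/
lemma map_colon_eq {A S : Type*} [CommRing A] [CommRing S] [Algebra A S] (M : Submonoid A)
    [IsLocalization M S] {I J : Ideal A} (hJ : J.FG) :
    (I.colon (J : Set A)).map (algebraMap A S) =
      (I.map (algebraMap A S)).colon (J.map (algebraMap A S) : Set S) := by
  refine le_antisymm (fun g hg => Submodule.mem_colon.mpr fun j hj => ?_) fun g hg => ?_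
  · rw [smul_eq_mul, mul_comm]
    exact mul_mem_map_of_mem_map_colon _ hg hj
  · refine mem_map_colon_of_forall_mul_mem M hJ fun j hj => ?_
    rw [mul_comm]
    exact Submodule.mem_colon.mp hg _ (Ideal.mem_map_of_mem _ hj)

lemma fg_map_algebraMap_of_isLocalization {A S S' : Type*} [CommRing A] [CommRing S] [CommRing S']
    [Algebra A S] [Algebra A S'] (M : Submonoid A) [IsLocalization M S] [IsLocalization M S']
    {I : Ideal A} (h : (I.map (algebraMap A S)).FG) : (I.map (algebraMap A S')).FG := by
  have h2 := h.map (IsLocalization.algEquiv M S S').toRingEquiv.toRingHom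
  rw [Ideal.map_map] at h2
  convert h2
  ext1 a
  exact ((IsLocalization.algEquiv M S S').commutes a).symm

variable {X : Scheme.{u}}

/-- The ideal sheaf whose ideal on an affine open `U` is `(I(U) : J(U))`, for an ideal sheaf `J` of
finite type. -/
noncomputable def colonOfFG (I J : X.IdealSheafData) (hJ : ∀ U, (J.ideal U).FG) :
    X.IdealSheafData where
  ideal U := (I.ideal U).colon (J.ideal U : Set Γ(X, U.1))
  map_ideal_basicOpen U f := by
    let := (X.presheaf.map (homOfLE <| X.basicOpen_le f).op).hom.toAlgebra
    have hloc : IsLocalization.Away f Γ(X, X.basicOpen f) := U.2.isLocalization_basicOpen f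
    exact (map_colon_eq (.powers f) (hJ U)).trans
      (congrArg₂ (fun I J : Ideal Γ(X, X.basicOpen f) => I.colon (J : Set Γ(X, X.basicOpen f)))
        (I.map_ideal_basicOpen U f) (J.map_ideal_basicOpen U f))

lemma stalkIdeal_mono {I J : X.IdealSheafData} (h : I ≤ J) (x : X) :
    stalkIdeal I x ≤ stalkIdeal J x := by
  obtain ⟨U, hx⟩ := exists_affineOpens_mem x
  rw [stalkIdeal_eq_map_germ I U hx, stalkIdeal_eq_map_germ J U hx]
  exact Ideal.map_mono (h U)

lemma stalkIdeal_mul (I J : X.IdealSheafData) (x : X) :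
    stalkIdeal (I * J) x = stalkIdeal I x * stalkIdeal J x := by
  obtain ⟨U, hx⟩ := exists_affineOpens_mem x
  rw [stalkIdeal_eq_map_germ _ U hx, stalkIdeal_eq_map_germ I U hx, stalkIdeal_eq_map_germ J U hx,
    ← Ideal.map_mul]
  rfl

lemma stalkIdeal_pow (I : X.IdealSheafData) (n : ℕ) (x : X) :
    stalkIdeal (I ^ n) x = stalkIdeal I x ^ n := by
  obtain ⟨U, hx⟩ := exists_affineOpens_mem x
  rw [stalkIdeal_eq_map_germ _ U hx, stalkIdeal_eq_map_germ I U hx, ← Ideal.map_pow]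
  rfl

lemma mul_colon_le (I J : X.IdealSheafData) : J * colon I J ≤ I := by
  intro U
  change J.ideal U * (colon I J).ideal U ≤ I.ideal U
  rw [colon, Scheme.IdealSheafData.ideal_sSup, sSup_apply, Ideal.mul_iSup]
  refine iSup_le ?_
  rintro ⟨_, K, hK, rfl⟩
  exact hK U

lemma mem_stalkIdeal_colon_iff (I J : X.IdealSheafData) (hJ : ∀ U, (J.ideal U).FG) {x : X}
    {f : X.presheaf.stalk x} :
    f ∈ stalkIdeal (colon I J) x ↔ ∀ t ∈ stalkIdeal J x, t * f ∈ stalkIdeal I x := by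
  refine ⟨fun hf t ht => ?_, fun hf => ?_⟩
  · have := stalkIdeal_mono (mul_colon_le I J) x
    rw [stalkIdeal_mul] at this
    exact this (Ideal.mul_mem_mul ht hf)
  · have hle : colonOfFG I J hJ ≤ colon I J := le_sSup fun U => by
      change J.ideal U * (I.ideal U).colon (J.ideal U : Set Γ(X, U.1)) ≤ I.ideal U
      refine Ideal.mul_le.mpr fun j hj a ha => ?_
      rw [mul_comm]
      exact Submodule.mem_colon.mp ha j hj
    refine stalkIdeal_mono hle x ?_
    obtain ⟨U, hx⟩ := exists_affineOpens_mem x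
    rw [stalkIdeal_eq_map_germ _ U hx] at hf ⊢
    rw [stalkIdeal_eq_map_germ I U hx] at hf
    let := TopCat.Presheaf.algebra_section_stalk X.presheaf (⟨x, hx⟩ : U.1)
    have hloc := IsAffineOpen.isLocalization_stalk U.2 ⟨x, hx⟩
    exact mem_map_colon_of_forall_mul_mem (S := X.presheaf.stalk x)
      (IsAffineOpen.primeIdealOf U.2 ⟨x, hx⟩).asIdeal.primeCompl (hJ U)
      fun j hj => hf _ (Ideal.mem_map_of_mem _ hj)

lemma IsInvertible.fg {J : X.IdealSheafData} (hJ : IsInvertible J) (U : X.affineOpens) :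
    (J.ideal U).FG := by
  choose V hV f hf hVf using hJ
  refine of_affine_open_cover (P := fun U => (J.ideal U).FG) V ?_ U ?_ ?_ ?_
  · exact top_le_iff.mp fun x _ => TopologicalSpace.Opens.mem_iSup.mpr ⟨x, hV x⟩
  · intro U f hU
    rw [← J.map_ideal_basicOpen]
    exact hU.map _
  · intro U s hs h
    refine Ideal.fg_of_localizationSpan (s : Set Γ(X, U.1)) hs fun g => ?_
    let := (X.presheaf.map (homOfLE <| X.basicOpen_le g.1).op).hom.toAlgebra
    have hloc : IsLocalization.Away g.1 Γ(X, X.basicOpen g.1) := U.2.isLocalization_basicOpen g.1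
    have h1 := h g
    rw [← J.map_ideal_basicOpen] at h1
    exact fg_map_algebraMap_of_isLocalization (S := Γ(X, X.basicOpen g.1)) (.powers g.1) h1
  · intro x
    rw [hVf]
    exact ⟨{f x}, by simp⟩

lemma IsInvertible.exists_stalkIdeal_eq_span {J : X.IdealSheafData} (hJ : IsInvertible J) (x : X) :
    ∃ t ∈ nonZeroDivisors (X.presheaf.stalk x), stalkIdeal J x = Ideal.span {t} := by
  obtain ⟨U, hx, f, hf, hU⟩ := hJ x
  refine ⟨(X.presheaf.germ U.1 x hx).hom f, ?_, ?_⟩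
  · let := TopCat.Presheaf.algebra_section_stalk X.presheaf (⟨x, hx⟩ : U.1)
    have hloc := IsAffineOpen.isLocalization_stalk U.2 ⟨x, hx⟩
    exact IsLocalization.map_nonZeroDivisors_le
      (IsAffineOpen.primeIdealOf U.2 ⟨x, hx⟩).asIdeal.primeCompl (X.presheaf.stalk x) ⟨f, hf, rfl⟩
  · rw [stalkIdeal_eq_map_germ J U hx, hU, Ideal.map_span, Set.image_singleton]

end Colon
end QDiff

namespace QDiff

open IsLocalRing

/-! ### The transform of a collection of ideals -/

section Transform

variable {V V₁ : Scheme.{u}} {π : V₁ ⟶ V} {Z : V.IdealSheafData}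

lemma stalkIdeal_eq_top_of_notMem_support {x : V} (hx : x ∉ Z.support) : stalkIdeal Z x = ⊤ := by
  by_contra hne
  exact hx ((mem_support_iff_stalkIdeal_le Z x).mpr (le_maximalIdeal hne))

/-- If the center is generated by `t` at `x₁`, then the stalks of the transforms consist of all `f`
with `t ^ (q * a) * f` in the stalk of the total transform. -/
lemma mem_stalkIdeal_aTransform_iff (hπ : IsBlowup π Z) {x₁ : V₁} {t : V₁.presheaf.stalk x₁}
    (ht : (stalkIdeal Z (π x₁)).map (π.stalkMap x₁).hom = Ideal.span {t}) (a : ℕ) {q : ℕ}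
    (G : Set.Ico 1 q → V.IdealSheafData) (i : Set.Ico 1 q) {f : V₁.presheaf.stalk x₁} :
    f ∈ stalkIdeal (aTransform π Z a G i) x₁ ↔
      t ^ (q * a) * f ∈ (stalkIdeal (G i) (π x₁)).map (π.stalkMap x₁).hom := by
  rw [aTransform, mem_stalkIdeal_colon_iff _ _ (fun U => (hπ.isInvertible.fg U).pow),
    stalkIdeal_pow, stalkIdeal_comap, stalkIdeal_comap, ht, Ideal.span_singleton_pow]
  refine ⟨fun h => h _ (Ideal.mem_span_singleton_self _), fun h s hs => ?_⟩
  obtain ⟨c, rfl⟩ := Ideal.mem_span_singleton'.mp hs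
  rw [mul_assoc]
  exact Ideal.mul_mem_left _ _ h

/-- Away from the center, the order of the transforms does not exceed that of the ideals. -/
lemma order_aTransform_le_of_notMem_support (hπ : IsBlowup π Z) {x₁ : V₁}
    (hx : π x₁ ∉ Z.support) (a : ℕ) {q : ℕ} (G : Set.Ico 1 q → V.IdealSheafData)
    (i : Set.Ico 1 q) : order (aTransform π Z a G i) x₁ ≤ order (G i) (π x₁) := by
  have htop := stalkIdeal_eq_top_of_notMem_support hx
  have h1 : (stalkIdeal Z (π x₁)).map (π.stalkMap x₁).hom = Ideal.span {1} := by
    rw [htop, Ideal.map_top, Ideal.span_singleton_one]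
  obtain ⟨ψ, hψ, hψφ⟩ := hπ.exists_stalk_hom x₁ (RingHom.id _) (π.stalkMap x₁).hom
    (RingHom.comp_id _) (w := 1) (one_mem _) (by rw [htop, Ideal.map_top, Ideal.span_singleton_one])
    (t := 1) (one_mem _) (by rw [stalkIdeal_comap, h1])
  refine ENat.forall_natCast_le_iff_le.mp fun n hn => ?_
  rw [le_order_iff] at hn ⊢
  intro f hf
  have h2 := hn ((mem_stalkIdeal_aTransform_iff hπ h1 a G i).mpr
    (Ideal.mul_mem_left _ _ (Ideal.mem_map_of_mem _ hf)))
  have h3 := Ideal.mem_map_of_mem ψ h2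
  rw [Ideal.map_pow] at h3
  have h4 : ψ ((π.stalkMap x₁).hom f) = f := RingHom.congr_fun hψφ f
  rw [h4] at h3
  exact Ideal.pow_right_mono (((local_hom_TFAE ψ).out 0 2).mp hψ) n h3

/-- Over a point of the center where `Z` and `V` are regular: if `I_i` has order at least `n ≤ q a` along
`Z`, and order exactly `n` at a point of `Z`, then its transform has order at most `n` at all points above. -/
lemma order_aTransform_le_of_mem_support (hV : IsRegularScheme V) (hZ : IsRegularScheme Z.subscheme)
    (hπ : IsBlowup π Z) {x₁ : V₁} (hx : π x₁ ∈ Z.support) {a : ℕ} {q : ℕ}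
    {G : Set.Ico 1 q → V.IdealSheafData} {i : Set.Ico 1 q} {n : ℕ} (hn : n ≤ q * a)
    (hord : ∀ ξ ∈ Z.support, (n : ℕ∞) ≤ order (G i) ξ) (hG : order (G i) (π x₁) ≤ n) :
    order (aTransform π Z a G i) x₁ ≤ n := by
  have hR := hV.isRegularLocalRing (π x₁)
  have hRP := isRegularLocalRing_quotient_stalkIdeal hZ hx
  have := isDomain_of_isRegularLocalRing (R := V.presheaf.stalk (π x₁))
  obtain ⟨r, y, hy, hyZ⟩ := exists_isPrimeFlag_span_eq (stalkIdeal Z (π x₁))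
  obtain ⟨t, ht, hZt⟩ := hπ.isInvertible.exists_stalkIdeal_eq_span x₁
  have hZt' := hZt
  rw [stalkIdeal_comap] at hZt
  obtain ⟨W, _, _, α, β, hβ, hβα, w, hw, hwα, hchart⟩ := hy.exists_chart (π.stalkMap x₁).hom ht
    (by rw [hyZ, hZt])
  rw [hyZ] at hwα hchart
  obtain ⟨ψ, hψ, hψφ⟩ := hπ.exists_stalk_hom x₁ α β hβα hw hwα ht hZt'
  by_contra! hlt
  have h1 : stalkIdeal (aTransform π Z a G i) x₁ ≤ maximalIdeal _ ^ (n + 1) :=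
    (le_order_iff _ _ _).mp (by exact_mod_cast Order.add_one_le_of_lt hlt)
  have h2 : ¬ stalkIdeal (G i) (π x₁) ≤ maximalIdeal _ ^ (n + 1) := by
    rw [← le_order_iff]
    intro h
    exact absurd (h.trans hG) (by rw [not_le]; exact_mod_cast Nat.lt_succ_self n)
  refine h2 fun f hf => ?_
  have hfP : f ∈ stalkIdeal Z (π x₁) ^ n := hy.stalkIdeal_le_pow hyZ
    (fun ξ hξ => (le_order_iff _ _ _).mp (hord ξ hξ)) hf
  have h3 := Ideal.mem_map_of_mem (π.stalkMap x₁).hom hfP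
  rw [Ideal.map_pow, hZt, Ideal.span_singleton_pow] at h3
  obtain ⟨f₁, hf₁⟩ := Ideal.mem_span_singleton.mp h3
  have h4 : f₁ ∈ stalkIdeal (aTransform π Z a G i) x₁ := by
    rw [mem_stalkIdeal_aTransform_iff hπ hZt]
    have h5 : t ^ (q * a) * f₁ = t ^ (q * a - n) * (π.stalkMap x₁).hom f := by
      rw [hf₁, ← mul_assoc, ← pow_add, Nat.sub_add_cancel hn]
    rw [h5]
    exact Ideal.mul_mem_left _ _ (Ideal.mem_map_of_mem _ hf)
  have h6 : ψ f₁ ∈ maximalIdeal W ^ (n + 1) := by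
    have := Ideal.mem_map_of_mem ψ (h1 h4)
    rw [Ideal.map_pow] at this
    exact Ideal.pow_right_mono (((local_hom_TFAE ψ).out 0 2).mp hψ) _ this
  obtain ⟨c, hc⟩ : w ∣ ψ t := by
    rw [← Ideal.mem_span_singleton, ← hwα, ← hψφ, ← Ideal.map_map, hZt]
    exact Ideal.mem_map_of_mem ψ (Ideal.mem_span_singleton_self t)
  refine hchart n f (c ^ n * ψ f₁) hfP ?_ (Ideal.mul_mem_left _ _ h6)
  have h7 : α f = ψ ((π.stalkMap x₁).hom f) := (RingHom.congr_fun hψφ f).symm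
  rw [h7, hf₁, map_mul, map_pow, hc]
  ring

/-- Taking quotients by `q`-th powers preserves `q`-differential collections, since differential operators
of order less than `q` are linear over `q`-th powers. -/
theorem IsQDifferential.aTransform {p e : ℕ} [Fact p.Prime] (hV : IsRegularScheme V)
    (hchar : (p : Γ(V, ⊤)) = 0) (hF : IsFFinite p V) (hπ : IsBlowup π Z)
    {G : Set.Ico 1 (p ^ e) → V.IdealSheafData} (hG : IsQDifferential G) (a : ℕ) :
    IsQDifferential (aTransform π Z a G) := by
  intro i k j hijk x₁
  have hR := hV.isRegularLocalRing (π x₁)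
  have hp := charP_stalk Fact.out hchar (π x₁)
  have hp₁ : CharP (V₁.presheaf.stalk x₁) p := by
    refine (CharP.charP_iff_prime_eq_zero Fact.out).mpr ?_
    rw [← map_natCast (π.stalkMap x₁).hom, CharP.cast_eq_zero, map_zero]
  obtain ⟨d, x, κ, _, _, u, -, -, hxu⟩ :=
    exists_isFrobBasis (isFFiniteRing_stalk hF (π x₁)) e
  have hj : j < p ^ e := by
    have := k.2.2
    omega
  obtain ⟨t, -, hZt⟩ := hπ.isInvertible.exists_stalkIdeal_eq_span x₁
  rw [stalkIdeal_comap] at hZt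
  let := (π.stalkMap x₁).hom.toAlgebra
  rw [diffIdeal, Ideal.span_le]
  rintro _ ⟨D, hD, f, hf, rfl⟩
  rw [SetLike.mem_coe, mem_stalkIdeal_aTransform_iff hπ hZt]
  rw [mem_stalkIdeal_aTransform_iff hπ hZt] at hf
  have h1 : t ^ (p ^ e * a) * D f = D (t ^ (p ^ e * a) * f) := by
    rw [mul_comm (p ^ e) a, pow_mul, hD.map_pow_mul hj]
  rw [h1]
  have h2 : D (t ^ (p ^ e * a) * f) ∈ (diffIdeal ℤ j (stalkIdeal (G i) (π x₁))).map
      (algebraMap (V.presheaf.stalk (π x₁)) (V₁.presheaf.stalk x₁)) :=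
    hxu.diffIdeal_map_le hj _ (Ideal.subset_span ⟨D, hD, _, hf, rfl⟩)
  exact Ideal.map_mono (hG i k j hijk (π x₁)) h2

lemma le_order_of_eta_eq {q : ℕ} {G : Set.Ico 1 q → V.IdealSheafData} {x : V}
    {N : ℕ} (h : eta G x = (N : ℕ∞)) (i : Set.Ico 1 q) : ((N - i : ℕ) : ℕ∞) ≤ order (G i) x := by
  have h1 : (N : ℕ∞) ≤ order (G i) x + ((i : ℕ) : ℕ∞) := h ▸ iInf_le _ i
  rw [ENat.natCast_sub]
  exact tsub_le_iff_right.mpr h1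

/-- If `η` is `a q + b` with `b < q` at a point, then this minimum is attained by some `I_i` with `i ≥ b`:
for `i < b`, apply an operator of order `b - i` to an element of `I_i` of order `a q + b - i`, and
obtain an element of order `a q` of `I_b`. -/
theorem exists_order_add_eq_eta {p e : ℕ} [Fact p.Prime] (hV : IsRegularScheme V)
    (hchar : (p : Γ(V, ⊤)) = 0) (hF : IsFFinite p V)
    {G : Set.Ico 1 (p ^ e) → V.IdealSheafData} (hG : IsQDifferential G) {a b : ℕ} (hb : b < p ^ e)
    {x : V} (hη : eta G x = ((a * p ^ e + b : ℕ) : ℕ∞)) :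
    ∃ i : Set.Ico 1 (p ^ e), b ≤ i ∧ (i : ℕ) ≤ a * p ^ e + b ∧
      order (G i) x ≤ ((a * p ^ e + b - i : ℕ) : ℕ∞) := by
  have hle : ∀ {i : Set.Ico 1 (p ^ e)} {n : ℕ} {f : V.presheaf.stalk x}, f ∈ stalkIdeal (G i) x →
      f ∉ maximalIdeal (V.presheaf.stalk x) ^ (n + 1) → order (G i) x ≤ n := by
    intro i n f hf hfn
    by_contra! hlt
    exact hfn ((le_order_iff _ _ _).mp (by exact_mod_cast Order.add_one_le_of_lt hlt) hf)
  obtain ⟨i, hi⟩ : ∃ i : Set.Ico 1 (p ^ e),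
      order (G i) x + ((i : ℕ) : ℕ∞) < ((a * p ^ e + b + 1 : ℕ) : ℕ∞) := by
    rw [← iInf_lt_iff]
    change eta G x < _
    rw [hη]
    exact_mod_cast Nat.lt_succ_self _
  obtain ⟨m, hm⟩ := ENat.ne_top_iff_exists.mp (ne_top_of_lt (lt_of_le_of_lt le_self_add hi))
  rw [← hm] at hi
  have hi : m + i ≤ a * p ^ e + b := by
    have : m + i < a * p ^ e + b + 1 := by exact_mod_cast hi
    omega
  have hord : order (G i) x ≤ ((a * p ^ e + b - i : ℕ) : ℕ∞) := by
    rw [← hm]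
    exact_mod_cast (show m ≤ a * p ^ e + b - i by omega)
  rcases le_or_gt b i with hbi | hib
  · exact ⟨i, hbi, by omega, hord⟩
  have hR := hV.isRegularLocalRing x
  have hp := charP_stalk Fact.out hchar x
  obtain ⟨d, y, κ, _, _, u, hy, hym, hyu⟩ := exists_isFrobBasis (isFFiniteRing_stalk hF x) e
  have hc : a * p ^ e + b - i = a * p ^ e + (b - i) := by omega
  have hlow := (le_order_iff _ _ _).mp (le_order_of_eta_eq hη i)
  obtain ⟨f, hf, hfn⟩ : ∃ f ∈ stalkIdeal (G i) x,
      f ∉ maximalIdeal (V.presheaf.stalk x) ^ (a * p ^ e + b - i + 1) := by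
    by_contra! hall
    exact absurd (((le_order_iff _ _ _).mpr hall).trans hord)
      (by rw [not_le]; exact_mod_cast Nat.lt_succ_self _)
  rw [hc] at hfn hlow
  obtain ⟨D, hD, hDf⟩ := exists_isDiffOp_notMem_pow hy hym hyu (c := b - i) (by omega) (hlow hf) hfn
  have hi1 := i.2.1
  let k : Set.Ico 1 (p ^ e) := ⟨b, by omega, hb⟩
  have hDk : D f ∈ stalkIdeal (G k) x :=
    hG i k (b - i) (by change (i : ℕ) + (b - i) = b; omega) x (Ideal.subset_span ⟨D, hD, f, hf, rfl⟩)
  refine ⟨k, le_rfl, Nat.le_add_left _ _, ?_⟩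
  change order (G k) x ≤ ((a * p ^ e + b - b : ℕ) : ℕ∞)
  rw [Nat.add_sub_cancel]
  exact hle hDk hDf

end Transform

end QDiff

theorem theorem1p6 {p : ℕ} (hp : p.Prime) (e : ℕ)
    {V V₁ : Scheme.{u}} [IsNoetherian V] [IrreducibleSpace V]
    (hV : QDiff.IsRegularScheme V) (hchar : (p : Γ(V, ⊤)) = 0) (hF : QDiff.IsFFinite p V)
    (G : Set.Ico 1 (p ^ e) → V.IdealSheafData) (hG : QDiff.IsQDifferential G)
    (Z : V.IdealSheafData) (hZ : QDiff.IsRegularScheme Z.subscheme)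
    (a b : ℕ) (hb : b < p ^ e)
    (hη : ∀ x ∈ Z.support, QDiff.eta G x = ((a * p ^ e + b : ℕ) : ℕ∞))
    (π : V₁ ⟶ V) (hπ : QDiff.IsBlowup π Z) :
    QDiff.IsQDifferential (QDiff.aTransform π Z a G) ∧
      ∀ x₁ : V₁, QDiff.eta (QDiff.aTransform π Z a G) x₁ ≤ QDiff.eta G (π x₁) := by
  have : Fact p.Prime := ⟨hp⟩
  refine ⟨hG.aTransform hV hchar hF hπ a, fun x₁ => ?_⟩
  by_cases hx : π x₁ ∈ Z.support
  · obtain ⟨i, hbi, hi, hord⟩ := QDiff.exists_order_add_eq_eta hV hchar hF hG hb (hη _ hx)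
    have h1 := QDiff.order_aTransform_le_of_mem_support hV hZ hπ hx (a := a) (i := i)
      (n := a * p ^ e + b - i) (by rw [mul_comm]; omega)
      (fun ξ hξ => QDiff.le_order_of_eta_eq (hη ξ hξ) i) hord
    refine (iInf_le _ i).trans ((add_le_add_left h1 _).trans ?_)
    rw [hη _ hx, ← Nat.cast_add, Nat.sub_add_cancel hi]
  · exact iInf_mono fun i =>
      add_le_add_left (QDiff.order_aTransform_le_of_notMem_support hπ hx a G i) _
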